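/- Let $p$ be a prime and let $K$ be a field of characteristic $0$, complete with respect to a nonarchimedean absolute value $|\cdot|$, with residue field of characteristic $p$, normalized so that $|p|=p^{-1}$. Let $\Gamma^*$ be the divisible closure of $|K^*|$. A subinterval $I$ of $[0,1)$ is called aligned if every nonzero endpoint at which it is closed lies in $\Gamma^*$; then $A(I)$ denotes the rigid analytic space $\{t : |t|\in I\}$ over $K$. A log-$\nabla$-module on $A(I)$ is a coherent locally free sheaf $\mathcal{E}$ on $A(I)$ with a connection $\nabla:\mathcal{E}\to\mathcal{E}\otimes\Omega^1_{\log}$, where $\Omega^1_{\log}$ is freely generated by $dt/t$; if $0\notin I$ this is the same as a $\nabla$-module, i.e. a coherent locally free sheaf with a connection. If $0 \in I$, the residue of $\mathcal{E}$ is the action of $t\frac{d}{dt}$ on its fibre at $t=0$. A $\nabla$-module $\mathcal{E}$ on $A(0,1)$ is overconvergent if for every $\eta\in(0,1)$ there is $r\in(0,1)$ such that for every nonempty closed aligned subinterval $J$ of $[r,1)$ and every $\mathbf{v}\in\Gamma(\mathcal{E},A(J))$, in terms of some basis of $\Gamma(\mathcal{E},A(J))$ the supremum norms on $A(J)$ of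 the coefficients of $\frac{1}{j!}\frac{d^j}{dt^j}\mathbf{v}$, multiplied by $\eta^j$, tend to $0$ as $j\to\infty$. A $\nabla$-module is constant if it is spanned by finitely many global horizontal sections, and unipotent if it admits a finite filtration by sub-$\nabla$-modules whose successive quotients are constant. Then the following categories (with horizontal morphisms, resp. linear maps commuting with the endomorphisms) are equivalent: (a) the category of finite dimensional $K$-vector spaces equipped with a nilpotent endomorphism; (b) the category of log-$\nabla$-modules on $A[0,1)$ with nilpotent residue whose restrictions to $A(0,1)$ are overconvergent; (c) for any nonempty open subinterval $I$ of $(0,1)$, the category of unipotent $\nabla$-modules on $A(I)$; (c$'$) the category of unipotent $\nabla$-modules on half-open annuli $A[r,1)$ ($r\in(0,1)\cap\Gamma^*$) considered up to shrinking the annulus, i.e. the unipotent objects of the direct limit, as $r\to1$, of the categories of $\nabla$-modules on $A[r,1)$. More precisely, there is an equivalence from (a) to (b) given by $(V,N)\mapsto\mathcal{O}\otimes_K V$, with $t\frac{d}{dt}$ acting on $V$ via $N$; and restriction to $A(I)$ (resp. to $A[r,1)$, for any $r\in(0,1)\cap\Gamma^*$) gives equivalences from (b) to (c) (resp. (c$'$)).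 -/

import Mathlib

open CategoryTheory Filter Topology TensorProduct Set

universe u

noncomputable section

namespace RigidAnnulus

/-- The divisible closure `Γ*` of the value group of `K`: the positive reals having a positive
integral power in `|K^*|`. -/
def valueGroup (K : Type u) [NormedField K] : Set ℝ :=
  {r | 0 < r ∧ ∃ n : ℕ, 0 < n ∧ ∃ x : K, x ≠ 0 ∧ r ^ n = ‖x‖}

/-- A closed aligned subinterval `[lo, hi]` of `[0, 1)` with `hi > 0`. The associated closed
annulus (or disc, if `lo = 0`) `A[lo, hi]` is an affinoid subdomain of the open unit disc. -/
structure ClosedInterval (K : Type u) [NormedField K] where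
  lo : ℝ
  hi : ℝ
  lo_nonneg : 0 ≤ lo
  lo_le_hi : lo ≤ hi
  hi_lt_one : hi < 1
  lo_aligned : lo = 0 ∨ lo ∈ valueGroup K
  hi_aligned : hi ∈ valueGroup K

section Field

variable {K : Type u} [NormedField K]

/-- The underlying set of radii. -/
def ClosedInterval.carrier (J : ClosedInterval K) : Set ℝ := Icc J.lo J.hi

lemma ClosedInterval.hi_pos (J : ClosedInterval K) : 0 < J.hi := J.hi_aligned.1

lemma ClosedInterval.hi_mem (J : ClosedInterval K) : J.hi ∈ J.carrier := ⟨J.lo_le_hi, le_rfl⟩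

lemma ClosedInterval.nonneg {J : ClosedInterval K} {r : ℝ} (h : r ∈ J.carrier) : 0 ≤ r :=
  J.lo_nonneg.trans h.1

/-- The Laurent series `∑ c_i t^i` converging on `A(J)`: `|c_i| r^i → 0` as `i → ± ∞` for every
`r ∈ J`, and there are no negative powers of `t` if `0 ∈ J`. -/
def Converges (J : ClosedInterval K) (c : ℤ → K) : Prop :=
  (∀ r ∈ J.carrier, Tendsto (fun i : ℤ => ‖c i‖ * r ^ i) cofinite (𝓝 0)) ∧
    (0 ∈ J.carrier → ∀ i < 0, c i = 0)

lemma Converges.of_le {J : ClosedInterval K} {c d : ℤ → K} (hc : Converges J c)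
    (h : ∀ i, ‖d i‖ ≤ ‖c i‖) : Converges J d := by
  refine ⟨fun r hr => ?_, fun h0 i hi => ?_⟩
  · refine squeeze_zero (fun i => ?_) (fun i => ?_) (hc.1 r hr)
    · exact mul_nonneg (norm_nonneg _) (zpow_nonneg (J.nonneg hr) _)
    · exact mul_le_mul_of_nonneg_right (h i) (zpow_nonneg (J.nonneg hr) _)
  · have := h i
    rw [hc.2 h0 i hi, norm_zero] at this
    exact norm_le_zero_iff.1 this

lemma Converges.add [IsUltrametricDist K] {J : ClosedInterval K} {c d : ℤ → K}
    (hc : Converges J c) (hd : Converges J d) : Converges J (c + d) := by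
  refine ⟨fun r hr => ?_, fun h0 i hi => ?_⟩
  · have h := (hc.1 r hr).add (hd.1 r hr)
    rw [add_zero] at h
    refine squeeze_zero (fun i => ?_) (fun i => ?_) h
    · exact mul_nonneg (norm_nonneg _) (zpow_nonneg (J.nonneg hr) _)
    · rw [← add_mul]
      exact mul_le_mul_of_nonneg_right (norm_add_le _ _) (zpow_nonneg (J.nonneg hr) _)
  · simp [hc.2 h0 i hi, hd.2 h0 i hi]

lemma Converges.smul {J : ClosedInterval K} {c : ℤ → K} (a : K)
    (hc : Converges J c) : Converges J (a • c) := by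
  refine ⟨fun r hr => ?_, fun h0 i hi => ?_⟩
  · have h := (hc.1 r hr).const_mul ‖a‖
    rw [mul_zero] at h
    simpa [mul_assoc] using h
  · simp [hc.2 h0 i hi]

lemma Converges.single {J : ClosedInterval K} (n : ℤ) (hn : 0 ∈ J.carrier → 0 ≤ n) (a : K) :
    Converges J (Pi.single n a) := by
  refine ⟨fun r _ => ?_, fun h0 i hi => ?_⟩
  · refine tendsto_const_nhds.congr' ?_
    filter_upwards [eventually_cofinite_ne n] with i hi
    simp [hi]
  · have : i ≠ n := by have := hn h0; omega
    simp [this]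

lemma Converges.mono {J J' : ClosedInterval K} (h : J'.carrier ⊆ J.carrier) {c : ℤ → K}
    (hc : Converges J c) : Converges J' c :=
  ⟨fun r hr => hc.1 r (h hr), fun h0 => hc.2 (h h0)⟩

end Field

section Ring

variable {K : Type u} [NormedField K] [IsUltrametricDist K]

/-- The convergent Laurent series as a subspace of all doubly infinite sequences. -/
def annulusSubmodule (J : ClosedInterval K) : Submodule K (ℤ → K) where
  carrier := {c | Converges J c}
  add_mem' := Converges.add
  zero_mem' := by simpa using Converges.single (J := J) 0 (fun _ => le_rfl) (0 : K)
  smul_mem' := fun a _ => Converges.smul a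

/-- The ring `R_J` of rigid analytic functions on the closed annulus `A(J)`. -/
def Fn (J : ClosedInterval K) : Type u := ↥(annulusSubmodule J)

variable {J : ClosedInterval K}

instance : AddCommGroup (Fn J) := inferInstanceAs (AddCommGroup ↥(annulusSubmodule J))

instance : Module K (Fn J) := inferInstanceAs (Module K ↥(annulusSubmodule J))

namespace Fn

/-- The coefficients of a Laurent series. -/
def coeff (f : Fn J) : ℤ → K := f.1

lemma converges (f : Fn J) : Converges J f.coeff := f.2

@[ext] lemma ext {f g : Fn J} (h : ∀ i, f.coeff i = g.coeff i) : f = g :=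
  Subtype.ext (funext h)

@[simp] lemma coeff_add (f g : Fn J) (i : ℤ) : (f + g).coeff i = f.coeff i + g.coeff i := rfl
@[simp] lemma coeff_zero (i : ℤ) : (0 : Fn J).coeff i = 0 := rfl
@[simp] lemma coeff_smul (a : K) (f : Fn J) (i : ℤ) : (a • f).coeff i = a * f.coeff i := rfl

/-- The monomial `a t^n`; negative exponents are allowed only away from `t = 0`. -/
def monomial (n : ℤ) (hn : 0 ∈ J.carrier → 0 ≤ n) (a : K) : Fn J :=
  ⟨Pi.single n a, Converges.single n hn a⟩

lemma coeff_monomial (n : ℤ) (hn : 0 ∈ J.carrier → 0 ≤ n) (a : K) (i : ℤ) :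
    (monomial n hn a).coeff i = if i = n then a else 0 := Pi.single_apply n a i

instance : One (Fn J) := ⟨monomial 0 (fun _ => le_rfl) 1⟩

lemma coeff_one (n : ℤ) : (1 : Fn J).coeff n = if n = 0 then 1 else 0 :=
  Pi.single_apply 0 1 n

/-- The coefficients of a product. -/
def conv (c d : ℤ → K) (n : ℤ) : K := ∑' i : ℤ, c i * d (n - i)

lemma tendsto_pair (f g : Fn J) {r : ℝ} (hr : r ∈ J.carrier) :
    Tendsto (fun x : ℤ × ℤ => (‖f.coeff x.1‖ * r ^ x.1) * (‖g.coeff x.2‖ * r ^ x.2))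
      cofinite (𝓝 0) :=
  tendsto_mul_cofinite_nhds_zero (f.converges.1 r hr) (g.converges.1 r hr)

lemma tendsto_conv_term (f g : Fn J) (n : ℤ) :
    Tendsto (fun i => f.coeff i * g.coeff (n - i)) cofinite (𝓝 0) := by
  have hr := J.hi_mem
  have h0 := J.hi_pos
  have h1 := (tendsto_pair f g hr).comp
    (f := fun i : ℤ => (i, n - i))
    (Function.Injective.tendsto_cofinite (fun a b h => by simpa using congrArg Prod.fst h))
  have h2 := h1.const_mul (J.hi ^ (-n))
  rw [mul_zero] at h2
  rw [tendsto_zero_iff_norm_tendsto_zero]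
  refine h2.congr fun i => ?_
  simp only [Function.comp, norm_mul]
  have : J.hi ^ (-n) * (J.hi ^ i * J.hi ^ (n - i)) = 1 := by
    rw [← zpow_add₀ h0.ne', ← zpow_add₀ h0.ne']; simp
  linear_combination (‖f.coeff i‖ * ‖g.coeff (n - i)‖) * this

lemma conv_eq_zero (f g : Fn J) (h0 : 0 ∈ J.carrier) {n : ℤ} (hn : n < 0) :
    conv f.coeff g.coeff n = 0 := by
  unfold conv
  convert tsum_zero with i
  rcases lt_or_ge i 0 with hi | hi
  · rw [f.converges.2 h0 i hi, zero_mul]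
  · rw [g.converges.2 h0 (n - i) (by omega), mul_zero]

lemma converges_conv (f g : Fn J) : Converges J (conv f.coeff g.coeff) := by
  refine ⟨fun r hr => ?_, fun h0 n hn => conv_eq_zero f g h0 hn⟩
  rcases (J.nonneg hr).eq_or_lt with h | h
  · subst h
    refine tendsto_const_nhds.congr' ?_
    filter_upwards [eventually_cofinite_ne 0] with i hi
    rw [zero_zpow _ hi, mul_zero]
  · rw [Metric.tendsto_nhds]
    intro ε hε
    have h1 := (Metric.tendsto_nhds.1 (tendsto_pair f g hr)) (ε / 2) (half_pos hε)
    rw [eventually_cofinite] at h1 ⊢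
    refine (h1.image (fun x : ℤ × ℤ => x.1 + x.2)).subset fun n hn => ?_
    by_contra hcon
    apply hn
    have key : ∀ i, ‖f.coeff i * g.coeff (n - i)‖ ≤ ε / 2 * r ^ (-n) := by
      intro i
      have h2 : ¬ ((i, n - i) ∈ {x : ℤ × ℤ | ¬ dist ((‖f.coeff x.1‖ * r ^ x.1) *
          (‖g.coeff x.2‖ * r ^ x.2)) 0 < ε / 2}) := by
        intro hmem
        exact hcon ⟨_, hmem, by simp⟩
      simp only [mem_ofPred_eq, not_not, dist_zero_right] at h2
      have h3 := (le_abs_self _).trans h2.le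
      have : r ^ i * r ^ (n - i) * r ^ (-n) = 1 := by
        rw [← zpow_add₀ h.ne', ← zpow_add₀ h.ne']; simp
      calc ‖f.coeff i * g.coeff (n - i)‖
          = (‖f.coeff i‖ * r ^ i * (‖g.coeff (n - i)‖ * r ^ (n - i))) * r ^ (-n) := by
            rw [norm_mul]
            linear_combination -(‖f.coeff i‖ * ‖g.coeff (n - i)‖) * this
        _ ≤ ε / 2 * r ^ (-n) := mul_le_mul_of_nonneg_right h3 (zpow_nonneg h.le _)
    have h4 : ‖conv f.coeff g.coeff n‖ ≤ ε / 2 * r ^ (-n) :=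
      (IsUltrametricDist.norm_tsum_le _).trans (ciSup_le key)
    have h5 : ‖conv f.coeff g.coeff n‖ * r ^ n ≤ ε / 2 := by
      calc _ ≤ ε / 2 * r ^ (-n) * r ^ n := mul_le_mul_of_nonneg_right h4 (zpow_nonneg h.le _)
        _ = ε / 2 := by rw [mul_assoc, ← zpow_add₀ h.ne']; simp
    rw [dist_zero_right, Real.norm_of_nonneg (mul_nonneg (norm_nonneg _) (zpow_nonneg h.le _))]
    linarith

/-- The product of Laurent series. -/
instance : Mul (Fn J) := ⟨fun f g => ⟨conv f.coeff g.coeff, converges_conv f g⟩⟩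

lemma coeff_mul (f g : Fn J) (n : ℤ) :
    (f * g).coeff n = ∑' i : ℤ, f.coeff i * g.coeff (n - i) := rfl

lemma mul_comm' (f g : Fn J) : f * g = g * f := by
  ext n
  rw [coeff_mul, coeff_mul, ← (Equiv.subLeft n).tsum_eq]
  refine tsum_congr fun i => ?_
  simp [mul_comm]

lemma coeff_monomial_mul (k : ℤ) (hk : 0 ∈ J.carrier → 0 ≤ k) (a : K) (f : Fn J) (n : ℤ) :
    (monomial k hk a * f).coeff n = a * f.coeff (n - k) := by
  rw [coeff_mul, tsum_eq_single k]
  · simp [coeff_monomial]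
  · intro i hi
    simp [coeff_monomial, hi]

lemma one_mul' (f : Fn J) : 1 * f = f := by
  ext n
  exact (coeff_monomial_mul 0 (fun _ => le_rfl) 1 f n).trans (by simp)

variable [CompleteSpace K]

lemma summable_conv (f g : Fn J) (n : ℤ) :
    Summable (fun i => f.coeff i * g.coeff (n - i)) :=
  NonarchimedeanAddGroup.summable_of_tendsto_cofinite_zero (tendsto_conv_term f g n)

lemma mul_add' (f g h : Fn J) : f * (g + h) = f * g + f * h := by
  ext n
  simp only [coeff_mul, coeff_add, mul_add]
  exact (summable_conv f g n).tsum_add (summable_conv f h n)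

lemma summable_triple (f g h : Fn J) (n : ℤ) :
    Summable (fun x : ℤ × ℤ => f.coeff x.1 * (g.coeff (x.2 - x.1) * h.coeff (n - x.2))) := by
  apply NonarchimedeanAddGroup.summable_of_tendsto_cofinite_zero
  have hr := J.hi_mem
  have h0 := J.hi_pos
  have h1 := tendsto_mul_cofinite_nhds_zero (f.converges.1 _ hr) (tendsto_pair g h hr)
  have h2 := h1.comp (f := fun x : ℤ × ℤ => (x.1, (x.2 - x.1, n - x.2)))
    (Function.Injective.tendsto_cofinite (fun a b h => by
      simp only [Prod.mk.injEq] at h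
      ext <;> omega))
  have h3 := h2.const_mul (J.hi ^ (-n))
  rw [mul_zero] at h3
  rw [tendsto_zero_iff_norm_tendsto_zero]
  refine h3.congr fun x => ?_
  simp only [Function.comp, norm_mul]
  have : J.hi ^ (-n) * (J.hi ^ x.1 * (J.hi ^ (x.2 - x.1) * J.hi ^ (n - x.2))) = 1 := by
    rw [← zpow_add₀ h0.ne', ← zpow_add₀ h0.ne', ← zpow_add₀ h0.ne']; simp
  linear_combination (‖f.coeff x.1‖ * (‖g.coeff (x.2 - x.1)‖ * ‖h.coeff (n - x.2)‖)) * this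

lemma mul_assoc' (f g h : Fn J) : f * g * h = f * (g * h) := by
  ext n
  have hs := summable_triple f g h n
  calc (f * g * h).coeff n
      = ∑' j, ∑' i, f.coeff i * (g.coeff (j - i) * h.coeff (n - j)) := by
        rw [coeff_mul]
        refine tsum_congr fun j => ?_
        rw [coeff_mul, ← tsum_mul_right]
        exact tsum_congr fun i => mul_assoc _ _ _
    _ = ∑' i, ∑' j, f.coeff i * (g.coeff (j - i) * h.coeff (n - j)) :=
        Summable.tsum_comm (f := fun i j => f.coeff i * (g.coeff (j - i) * h.coeff (n - j))) hs
    _ = (f * (g * h)).coeff n := by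
        rw [coeff_mul]
        refine tsum_congr fun i => ?_
        rw [coeff_mul, ← tsum_mul_left, ← (Equiv.addRight i).tsum_eq]
        refine tsum_congr fun j => ?_
        simp only [Equiv.coe_addRight, add_sub_cancel_right]
        congr 3
        ring

instance : CommRing (Fn J) :=
  { (inferInstance : AddCommGroup (Fn J)) with
    mul := (· * ·)
    one := 1
    left_distrib := mul_add'
    right_distrib := fun f g h => by
      rw [mul_comm' (f + g) h, mul_add', mul_comm' f h, mul_comm' g h]
    zero_mul := fun f => by ext n; simp [coeff_mul]
    mul_zero := fun f => by ext n; simp [coeff_mul]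
    mul_assoc := mul_assoc'
    one_mul := one_mul'
    mul_one := fun f => by rw [mul_comm', one_mul']
    mul_comm := mul_comm' }

instance : Algebra K (Fn J) :=
  Algebra.ofModule
    (fun a f g => by
      ext n; simp only [coeff_mul, coeff_smul, mul_assoc, tsum_mul_left])
    (fun a f g => by
      ext n; simp only [coeff_mul, coeff_smul, mul_left_comm, tsum_mul_left])

/-- Restriction of functions to a smaller closed annulus. -/
def res {J J' : ClosedInterval K} (h : J'.carrier ⊆ J.carrier) : Fn J →ₐ[K] Fn J' where
  toFun f := ⟨f.1, f.converges.mono h⟩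
  map_one' := rfl
  map_mul' _ _ := rfl
  map_zero' := rfl
  map_add' _ _ := rfl
  commutes' _ := rfl

/-- The coordinate function `t`. -/
def t : Fn J := monomial 1 (fun _ => zero_le_one) 1

/-- The function `t⁻¹` on an annulus which does not contain `t = 0`. -/
def tInv (h : 0 ∉ J.carrier) : Fn J := monomial (-1) (fun h0 => (h h0).elim) 1

/-- The derivation `t d/dt` of `R_J`, sending `∑ c_i t^i` to `∑ i c_i t^i`. -/
def theta (J : ClosedInterval K) : Fn J →ₗ[K] Fn J where
  toFun f := ⟨fun i => (i : K) * f.coeff i, f.converges.of_le fun i => by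
    rw [norm_mul]
    exact mul_le_of_le_one_left (norm_nonneg _) (IsUltrametricDist.norm_intCast_le_one K i)⟩
  map_add' f g := by
    ext i; exact mul_add _ _ _
  map_smul' a f := by
    ext i; exact mul_left_comm _ _ _

lemma coeff_theta (f : Fn J) (i : ℤ) : (theta J f).coeff i = (i : K) * f.coeff i := rfl

lemma theta_mul (f g : Fn J) : theta J (f * g) = theta J f * g + f * theta J g := by
  ext n
  rw [coeff_theta, coeff_add, coeff_mul, coeff_mul, coeff_mul, ← tsum_mul_left,
    ← (summable_conv _ _ n).tsum_add (summable_conv _ _ n)]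
  refine tsum_congr fun i => ?_
  simp only [coeff_theta]
  push_cast
  ring

/-- The norm `|∑ c_i t^i|_r = sup_i |c_i| r^i`. -/
def gaussNorm (r : ℝ) (f : Fn J) : ℝ := ⨆ i : ℤ, ‖f.coeff i‖ * r ^ i

/-- The supremum norm on `A(J)`, which is the supremum of the norms `|·|_r` over `r ∈ J`. -/
def supNorm (f : Fn J) : ℝ := ⨆ r : J.carrier, gaussNorm (r : ℝ) f

end Fn
end Ring

section Modules

/-- `N` is the base change of the `R`-module `M` along `φ : R → S`, via `f : M → N`: the induced
map `S ⊗_R M → N` is an isomorphism. -/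
def IsBaseChangeAlong {R S M N : Type u} [CommRing R] [CommRing S] (φ : R →+* S)
    [AddCommGroup M] [Module R M] [AddCommGroup N] [Module S N] (f : M →ₛₗ[φ] N) : Prop :=
  letI : Algebra R S := φ.toAlgebra
  letI : Module R N := Module.compHom N φ
  haveI : IsScalarTower R S N := ⟨fun r s n => mul_smul (φ r) s n⟩
  IsBaseChange S
    ({ toFun := f, map_add' := f.map_add, map_smul' := f.map_smulₛₗ } : M →ₗ[R] N)

lemma isBaseChangeAlong_of_comp {k R S M N P : Type u} [CommRing k] [CommRing R] [CommRing S]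
    [Algebra k R] [Algebra k S] (φ : R →ₐ[k] S) [AddCommGroup M] [Module k M]
    [AddCommGroup N] [Module k N] [Module R N] [IsScalarTower k R N]
    [AddCommGroup P] [Module k P] [Module S P] [IsScalarTower k S P]
    {f : M →ₗ[k] N} (hf : IsBaseChange R f) (h : N →ₛₗ[φ.toRingHom] P)
    {g : M →ₗ[k] P} (hg : IsBaseChange S g) (hfg : ∀ m, h (f m) = g m) :
    IsBaseChangeAlong φ.toRingHom h := by
  let _ : Algebra R S := φ.toRingHom.toAlgebra
  let _ : Module R P := Module.compHom P φ.toRingHom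
  have : IsScalarTower R S P := ⟨fun r s n => mul_smul (φ r) s n⟩
  have : IsScalarTower k R S := IsScalarTower.of_algebraMap_eq' φ.comp_algebraMap.symm
  have : IsScalarTower k R P := ⟨fun a r m => by
    change φ (a • r) • m = a • (φ r • m)
    rw [map_smul, smul_assoc]⟩
  let h' : N →ₗ[R] P := { toFun := h, map_add' := h.map_add, map_smul' := h.map_smulₛₗ }
  have hc : (h' : N →ₗ[k] P) ∘ₗ f = g := LinearMap.ext hfg
  have : IsBaseChange S ((h' : N →ₗ[k] P) ∘ₗ f) := hc ▸ hg
  exact IsBaseChange.of_comp hf this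

variable (K : Type u) [NormedField K] [IsUltrametricDist K] [CompleteSpace K]

/-- A log-`∇`-module on the annulus (or disc) `A(I)`.

The space `A(I)` is the increasing admissible union of its closed aligned subannuli (or subdiscs)
`A(J)`, which are affinoid. A coherent locally free sheaf on `A(I)` is thus the same as a
system of finite projective `R_J`-modules `Γ(A(J))`, together with transitive restriction
maps inducing isomorphisms `R_{J'} ⊗_{R_J} Γ(A(J)) ≅ Γ(A(J'))` for `J' ⊆ J`. Since `Ω¹_log` is free
on `dt/t`, the connection `∇` amounts to the action `D` of `t d/dt`, i.e. `∇ v = D v ⊗ dt/t`.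

If `I ⊆ (0, 1)`, then `Ω¹_log = Ω¹` on `A(I)`, so this is the same as a `∇`-module on `A(I)`. -/
structure LogNablaModule (I : Set ℝ) where
  /-- the sections over `A(J)` -/
  obj : ∀ J : ClosedInterval K, J.carrier ⊆ I → Type u
  [addCommGroup : ∀ J hJ, AddCommGroup (obj J hJ)]
  [module : ∀ J hJ, Module (Fn J) (obj J hJ)]
  finite : ∀ J hJ, Module.Finite (Fn J) (obj J hJ)
  projective : ∀ J hJ, Module.Projective (Fn J) (obj J hJ)
  /-- restriction of sections -/
  res : ∀ {J J' : ClosedInterval K} (hJ : J.carrier ⊆ I) (h : J'.carrier ⊆ J.carrier),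
    obj J hJ →ₛₗ[(Fn.res h).toRingHom] obj J' (h.trans hJ)
  res_self : ∀ {J : ClosedInterval K} (hJ : J.carrier ⊆ I) (m : obj J hJ),
    res hJ Subset.rfl m = m
  res_res : ∀ {J J' J'' : ClosedInterval K} (hJ : J.carrier ⊆ I) (h : J'.carrier ⊆ J.carrier)
    (h' : J''.carrier ⊆ J'.carrier) (m : obj J hJ),
    res (h.trans hJ) h' (res hJ h m) = res hJ (h'.trans h) m
  base_change : ∀ {J J' : ClosedInterval K} (hJ : J.carrier ⊆ I) (h : J'.carrier ⊆ J.carrier),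
    IsBaseChangeAlong (Fn.res h).toRingHom (res hJ h)
  /-- the action of `t d/dt` -/
  D : ∀ J hJ, obj J hJ →+ obj J hJ
  leibniz : ∀ (J hJ) (f : Fn J) (m : obj J hJ),
    D J hJ (f • m) = Fn.theta J f • m + f • D J hJ m
  D_res : ∀ {J J' : ClosedInterval K} (hJ : J.carrier ⊆ I) (h : J'.carrier ⊆ J.carrier)
    (m : obj J hJ), D J' (h.trans hJ) (res hJ h m) = res hJ h (D J hJ m)

attribute [instance] LogNablaModule.addCommGroup LogNablaModule.module

namespace LogNablaModule

variable {K} {I : Set ℝ}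

/-- Morphisms of log-`∇`-modules: horizontal morphisms of sheaves of modules. -/
@[ext]
structure Hom (E F : LogNablaModule K I) where
  app : ∀ J hJ, E.obj J hJ →ₗ[Fn J] F.obj J hJ
  app_res : ∀ {J J' : ClosedInterval K} (hJ : J.carrier ⊆ I) (h : J'.carrier ⊆ J.carrier)
    (m : E.obj J hJ), app J' (h.trans hJ) (E.res hJ h m) = F.res hJ h (app J hJ m)
  app_D : ∀ (J hJ) (m : E.obj J hJ), app J hJ (E.D J hJ m) = F.D J hJ (app J hJ m)

instance : Category (LogNablaModule K I) where
  Hom := Hom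
  id E :=
    { app := fun _ _ => LinearMap.id
      app_res := fun _ _ _ => rfl
      app_D := fun _ _ _ => rfl }
  comp f g :=
    { app := fun J hJ => (g.app J hJ).comp (f.app J hJ)
      app_res := fun hJ h m => (congrArg _ (f.app_res hJ h m)).trans (g.app_res hJ h _)
      app_D := fun J hJ m => (congrArg _ (f.app_D J hJ m)).trans (g.app_D J hJ _) }

@[ext]
lemma hom_ext {E F : LogNablaModule K I} {f g : E ⟶ F} (h : ∀ J hJ, f.app J hJ = g.app J hJ) :
    f = g :=
  Hom.ext (funext fun J => funext fun hJ => h J hJ)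

@[simp] lemma id_app (E : LogNablaModule K I) (J hJ) :
    Hom.app (𝟙 E) J hJ = LinearMap.id := rfl

@[simp] lemma comp_app {E F G : LogNablaModule K I} (f : E ⟶ F) (g : F ⟶ G) (J hJ) :
    Hom.app (f ≫ g) J hJ = (g.app J hJ).comp (f.app J hJ) := rfl

/-- Restriction of log-`∇`-modules from `A(I)` to `A(I')` for `I' ⊆ I`. -/
def restrict {I' I : Set ℝ} (h : I' ⊆ I) : LogNablaModule K I ⥤ LogNablaModule K I' where
  obj E :=
    { obj := fun J hJ => E.obj J (hJ.trans h)
      finite := fun J hJ => E.finite J (hJ.trans h)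
      projective := fun J hJ => E.projective J (hJ.trans h)
      res := fun hJ => E.res (hJ.trans h)
      res_self := fun hJ => E.res_self (hJ.trans h)
      res_res := fun hJ => E.res_res (hJ.trans h)
      base_change := fun hJ => E.base_change (hJ.trans h)
      D := fun J hJ => E.D J (hJ.trans h)
      leibniz := fun J hJ => E.leibniz J (hJ.trans h)
      D_res := fun hJ => E.D_res (hJ.trans h) }
  map f :=
    { app := fun J hJ => f.app J (hJ.trans h)
      app_res := fun hJ => f.app_res (hJ.trans h)
      app_D := fun J hJ => f.app_D J (hJ.trans h) }

/-- The submodule `t Γ(A(J))` of `Γ(A(J))`. -/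
def tSubmodule (E : LogNablaModule K I) (J : ClosedInterval K) (hJ : J.carrier ⊆ I) :
    Submodule (Fn J) (E.obj J hJ) :=
  LinearMap.range (LinearMap.lsmul (Fn J) (E.obj J hJ) Fn.t)

lemma D_mem_tSubmodule (E : LogNablaModule K I) (J : ClosedInterval K) (hJ : J.carrier ⊆ I)
    {m : E.obj J hJ} (hm : m ∈ E.tSubmodule J hJ) : E.D J hJ m ∈ E.tSubmodule J hJ := by
  obtain ⟨m, rfl⟩ := hm
  have ht : Fn.theta J Fn.t = Fn.t := by
    ext i
    rw [Fn.coeff_theta, Fn.t, Fn.coeff_monomial]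
    split_ifs with hi <;> simp [hi]
  refine ⟨m + E.D J hJ m, ?_⟩
  simp only [LinearMap.lsmul_apply, E.leibniz, ht, smul_add]

/-- The fibre at `t = 0` of a log-`∇`-module, computed on a disc `A(J)`, `0 ∈ J`. -/
abbrev Fibre (E : LogNablaModule K I) (J : ClosedInterval K) (hJ : J.carrier ⊆ I) : Type u :=
  E.obj J hJ ⧸ (E.tSubmodule J hJ).toAddSubgroup

/-- The residue: the action of `t d/dt` on the fibre at `t = 0`, computed on a disc `A(J)`,
`0 ∈ J`. -/
def residue (E : LogNablaModule K I) (J : ClosedInterval K) (hJ : J.carrier ⊆ I) :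
    AddMonoid.End (E.Fibre J hJ) :=
  QuotientAddGroup.map _ _ (E.D J hJ) fun _ hm => E.D_mem_tSubmodule J hJ hm

/-- The residue at `t = 0` is nilpotent. (All discs `A(J)` have the same fibre at `t = 0`.) -/
def HasNilpotentResidue (E : LogNablaModule K I) : Prop :=
  ∀ J hJ, 0 ∈ J.carrier → IsNilpotent (E.residue J hJ)

/-- The action of `d/dt = t⁻¹ (t d/dt)` on the sections over an annulus not containing `0`. -/
def ddt (E : LogNablaModule K I) (J : ClosedInterval K) (hJ : J.carrier ⊆ I)
    (h : 0 ∉ J.carrier) (m : E.obj J hJ) : E.obj J hJ :=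
  Fn.tInv h • E.D J hJ m

/-- A sequence of sections over `A(J)` is `η`-null: in terms of some basis, the norms of
the coefficients of the `j`-th term, multiplied by `η ^ j`, converge to zero. -/
def IsNullSeq (E : LogNablaModule K I) (J : ClosedInterval K) (hJ : J.carrier ⊆ I) (η : ℝ)
    (w : ℕ → E.obj J hJ) : Prop :=
  ∃ (n : ℕ) (b : Module.Basis (Fin n) (Fn J) (E.obj J hJ)),
    ∀ i, Tendsto (fun j => Fn.supNorm (b.repr (w j) i) * η ^ j) atTop (𝓝 0)

/-- Overconvergent `∇`-modules on `A(0, 1)`. -/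
def IsOverconvergent (E : LogNablaModule K (Ioo 0 1)) : Prop :=
  ∀ η ∈ Ioo (0 : ℝ) 1, ∃ r ∈ Ioo (0 : ℝ) 1, ∀ (J : ClosedInterval K)
    (hJ : J.carrier ⊆ Ioo 0 1), J.carrier ⊆ Ico r 1 → ∀ v : E.obj J hJ,
      E.IsNullSeq J hJ η fun j => algebraMap K (Fn J) (j.factorial : K)⁻¹ •
        (E.ddt J hJ fun h => lt_irrefl _ (hJ h).1)^[j] v

/-- A `∇`-module is constant if it is spanned by finitely many (global) horizontal sections. -/
def IsConstant (E : LogNablaModule K I) : Prop :=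
  ∃ (n : ℕ) (s : Fin n → ∀ J hJ, E.obj J hJ),
    (∀ k (J J' : ClosedInterval K) (hJ : J.carrier ⊆ I) (h : J'.carrier ⊆ J.carrier),
      E.res hJ h (s k J hJ) = s k J' (h.trans hJ)) ∧
    (∀ k J hJ, E.D J hJ (s k J hJ) = 0) ∧
    ∀ J hJ, Submodule.span (Fn J) (range fun k => s k J hJ) = ⊤

/-- A `∇`-module is unipotent if it is a successive extension of constant `∇`-modules, i.e. if it
admits a finite filtration by sub-`∇`-modules whose successive quotients are constant. -/
inductive IsUnipotent : LogNablaModule K I → Prop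
  | zero (E : LogNablaModule K I) (h : ∀ J hJ, Subsingleton (E.obj J hJ)) : IsUnipotent E
  | extension {E' E E'' : LogNablaModule K I} (i : E' ⟶ E) (q : E ⟶ E'')
      (inj : ∀ J hJ, Function.Injective (i.app J hJ))
      (exact : ∀ J hJ, Function.Exact (i.app J hJ) (q.app J hJ))
      (surj : ∀ J hJ, Function.Surjective (q.app J hJ))
      (hE' : IsUnipotent E') (hE'' : IsConstant E'') : IsUnipotent E

end LogNablaModule

/-- Finite dimensional `K`-vector spaces equipped with a nilpotent endomorphism. -/
structure NilpotentEnd where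
  V : Type u
  [addCommGroup : AddCommGroup V]
  [module : Module K V]
  [finite : FiniteDimensional K V]
  N : Module.End K V
  nilpotent : IsNilpotent N

attribute [instance] NilpotentEnd.addCommGroup NilpotentEnd.module NilpotentEnd.finite

namespace NilpotentEnd

variable {K}

/-- Linear maps commuting with the given endomorphisms. -/
@[ext]
structure Hom (X Y : NilpotentEnd K) where
  toLin : X.V →ₗ[K] Y.V
  comm : ∀ v, toLin (X.N v) = Y.N (toLin v)

instance : Category (NilpotentEnd K) where
  Hom := Hom
  id X := { toLin := LinearMap.id, comm := fun _ => rfl }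
  comp f g := { toLin := g.toLin.comp f.toLin, comm := fun v => by simp [f.comm, g.comm] }

/-- The action of `t d/dt` on `R_J ⊗ V`, where it acts on `V` via `N`. -/
def tensorD (X : NilpotentEnd K) (J : ClosedInterval K) : Fn J ⊗[K] X.V →ₗ[K] Fn J ⊗[K] X.V :=
  LinearMap.rTensor X.V (Fn.theta J) + LinearMap.lTensor (Fn J) X.N

@[simp] lemma tensorD_tmul (X : NilpotentEnd K) (J : ClosedInterval K) (f : Fn J) (v : X.V) :
    X.tensorD J (f ⊗ₜ v) = Fn.theta J f ⊗ₜ v + f ⊗ₜ X.N v := rfl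

/-- The restriction `R_J ⊗ V → R_{J'} ⊗ V`. -/
def tensorRes (X : NilpotentEnd K) {J J' : ClosedInterval K} (h : J'.carrier ⊆ J.carrier) :
    Fn J ⊗[K] X.V →ₛₗ[(Fn.res h).toRingHom] Fn J' ⊗[K] X.V where
  toFun := LinearMap.rTensor X.V (Fn.res h).toLinearMap
  map_add' := map_add _
  map_smul' f m := by
    induction m with
    | zero => simp
    | add x y hx hy => simp only [smul_add, map_add, hx, hy]
    | tmul g v => simp [TensorProduct.smul_tmul']

@[simp] lemma tensorRes_tmul (X : NilpotentEnd K) {J J' : ClosedInterval K}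
    (h : J'.carrier ⊆ J.carrier) (f : Fn J) (v : X.V) :
    X.tensorRes h (f ⊗ₜ v) = Fn.res h f ⊗ₜ v := rfl

lemma tensorRes_baseChange (X : NilpotentEnd K) {J J' : ClosedInterval K}
    (h : J'.carrier ⊆ J.carrier) : IsBaseChangeAlong (Fn.res h).toRingHom (X.tensorRes h) :=
  isBaseChangeAlong_of_comp (Fn.res h) (TensorProduct.isBaseChange K X.V (Fn J))
    (X.tensorRes h) (TensorProduct.isBaseChange K X.V (Fn J')) fun v => by
      simp only [TensorProduct.mk_apply, tensorRes_tmul, map_one]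

/-- The log-`∇`-module `O ⊗ V` on `A(I)`, where `t d/dt` acts on `V` via `N`. -/
def toLogNablaObj (I : Set ℝ) (X : NilpotentEnd K) : LogNablaModule K I where
  obj J _ := Fn J ⊗[K] X.V
  finite J hJ := inferInstance
  projective J hJ := inferInstance
  res _ h := X.tensorRes h
  res_self _ m := by
    induction m with
    | zero => rfl
    | add x y hx hy => simp only [map_add, hx, hy]
    | tmul g v => rfl
  res_res _ h h' m := by
    induction m with
    | zero => rfl
    | add x y hx hy => simp only [map_add, hx, hy]
    | tmul g v => rfl
  base_change _ h := X.tensorRes_baseChange h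
  D J _ := (X.tensorD J).toAddMonoidHom
  leibniz J _ f m := by
    induction m with
    | zero => simp
    | add x y hx hy =>
      simp only [smul_add, map_add, hx, hy]
      abel
    | tmul g v =>
      simp only [TensorProduct.smul_tmul', LinearMap.toAddMonoidHom_coe, tensorD_tmul,
        smul_eq_mul, Fn.theta_mul, TensorProduct.add_tmul, smul_add, add_assoc]
  D_res _ h m := by
    induction m with
    | zero => rfl
    | add x y hx hy => simp only [map_add, hx, hy]
    | tmul g v => rfl

/-- The map `R_J ⊗ V → R_J ⊗ W` induced by a morphism `V → W`. -/
def tensorMap {X Y : NilpotentEnd K} (f : X ⟶ Y) (J : ClosedInterval K) :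
    Fn J ⊗[K] X.V →ₗ[Fn J] Fn J ⊗[K] Y.V :=
  TensorProduct.AlgebraTensorModule.map LinearMap.id f.toLin

@[simp] lemma tensorMap_tmul {X Y : NilpotentEnd K} (f : X ⟶ Y) (J : ClosedInterval K)
    (g : Fn J) (v : X.V) : tensorMap f J (g ⊗ₜ v) = g ⊗ₜ f.toLin v := rfl

lemma tensorMap_res {X Y : NilpotentEnd K} (f : X ⟶ Y) {J J' : ClosedInterval K}
    (h : J'.carrier ⊆ J.carrier) (m : Fn J ⊗[K] X.V) :
    tensorMap f J' (X.tensorRes h m) = Y.tensorRes h (tensorMap f J m) := by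
  induction m with
  | zero => simp only [map_zero]
  | add x y hx hy => simp only [map_add, hx, hy]
  | tmul g v => rfl

lemma tensorMap_D {X Y : NilpotentEnd K} (f : X ⟶ Y) (J : ClosedInterval K)
    (m : Fn J ⊗[K] X.V) :
    tensorMap f J (X.tensorD J m) = Y.tensorD J (tensorMap f J m) := by
  induction m with
  | zero => simp only [map_zero]
  | add x y hx hy => simp only [map_add, hx, hy]
  | tmul g v => simp only [tensorD_tmul, map_add, tensorMap_tmul, f.comm]

lemma tensorMap_id (X : NilpotentEnd K) (J : ClosedInterval K) :
    tensorMap (𝟙 X) J = LinearMap.id := by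
  ext m
  rfl

lemma tensorMap_comp {X Y Z : NilpotentEnd K} (f : X ⟶ Y) (g : Y ⟶ Z) (J : ClosedInterval K) :
    tensorMap (f ≫ g) J = (tensorMap g J).comp (tensorMap f J) := by
  ext m
  rfl

/-- The functor taking `(V, N)` to the log-`∇`-module `O ⊗ V` on `A(I)`, where `t d/dt`
acts on `V` via `N`. -/
def toLogNabla (I : Set ℝ) : NilpotentEnd K ⥤ LogNablaModule K I where
  obj X := toLogNablaObj I X
  map f :=
    { app := fun J _ => tensorMap f J
      app_res := fun _ h m => tensorMap_res f h m
      app_D := fun J _ m => tensorMap_D f J m }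
  map_id X := LogNablaModule.hom_ext fun J _ => tensorMap_id X J
  map_comp f g := LogNablaModule.hom_ext fun J _ => tensorMap_comp f g J

end NilpotentEnd

/-- A `∇`-module defined on some annulus `A[r, 1)`, `r ∈ (0, 1) ∩ Γ^*`, to be considered
up to shrinking the annulus. -/
structure GermModule where
  r : ℝ
  r_mem : r ∈ valueGroup K ∩ Ioo 0 1
  E : LogNablaModule K (Ico r 1)

namespace GermModule

variable {K}

/-- A morphism between the restrictions of two `∇`-modules to some common annulus `A[s, 1)`. -/
structure PreHom (X Y : GermModule K) where
  s : ℝ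
  s_mem : s ∈ valueGroup K ∩ Ioo 0 1
  left : X.r ≤ s
  right : Y.r ≤ s
  hom : (LogNablaModule.restrict (Ico_subset_Ico_left left)).obj X.E ⟶
    (LogNablaModule.restrict (Ico_subset_Ico_left right)).obj Y.E

/-- The map on sections over `A(J)`, for `J ⊆ [s, 1)`. -/
def PreHom.app {X Y : GermModule K} (f : PreHom X Y) (J : ClosedInterval K)
    (hJ : J.carrier ⊆ Ico f.s 1) :
    X.E.obj J (hJ.trans (Ico_subset_Ico_left f.left)) →ₗ[Fn J]
      Y.E.obj J (hJ.trans (Ico_subset_Ico_left f.right)) :=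
  f.hom.app J hJ

/-- Two such morphisms define the same germ if they agree on a smaller annulus `A[s', 1)`. -/
instance PreHom.setoid (X Y : GermModule K) : Setoid (PreHom X Y) where
  r f g := ∃ s' < 1, f.s ≤ s' ∧ g.s ≤ s' ∧ ∀ (J : ClosedInterval K)
    (hf : J.carrier ⊆ Ico f.s 1) (hg : J.carrier ⊆ Ico g.s 1), J.carrier ⊆ Ico s' 1 →
      f.app J hf = g.app J hg
  iseqv :=
    { refl := fun f => ⟨f.s, f.s_mem.2.2, le_rfl, le_rfl, fun _ _ _ _ => rfl⟩
      symm := fun ⟨s', h1, h2, h3, h⟩ => ⟨s', h1, h3, h2, fun J hf hg hJ => (h J hg hf hJ).symm⟩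
      trans := fun {f g k} ⟨s, h1, h2, h3, h⟩ ⟨s', h1', h2', h3', h'⟩ =>
        ⟨max s s', max_lt h1 h1', h2.trans (le_max_left _ _), h3'.trans (le_max_right _ _),
          fun J hf hk hJ => by
            have e1 : J.carrier ⊆ Ico s 1 := hJ.trans (Ico_subset_Ico_left (le_max_left _ _))
            have e2 : J.carrier ⊆ Ico s' 1 := hJ.trans (Ico_subset_Ico_left (le_max_right _ _))
            have hg : J.carrier ⊆ Ico g.s 1 := e1.trans (Ico_subset_Ico_left h3)
            exact (h J hf hg e1).trans (h' J hg hk e2)⟩ }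

/-- The identity, defined on all of `A[r, 1)`. -/
def PreHom.id (X : GermModule K) : PreHom X X := ⟨X.r, X.r_mem, le_rfl, le_rfl, 𝟙 _⟩

/-- Composition, on the smaller of the two annuli. -/
def PreHom.comp {X Y Z : GermModule K} (f : PreHom X Y) (g : PreHom Y Z) : PreHom X Z where
  s := max f.s g.s
  s_mem := by rcases max_choice f.s g.s with h | h <;> rw [h]; exacts [f.s_mem, g.s_mem]
  left := f.left.trans (le_max_left _ _)
  right := g.right.trans (le_max_right _ _)
  hom := (LogNablaModule.restrict (Ico_subset_Ico_left (le_max_left f.s g.s))).map f.hom ≫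
    (LogNablaModule.restrict (Ico_subset_Ico_left (le_max_right f.s g.s))).map g.hom

lemma PreHom.comp_app {X Y Z : GermModule K} (f : PreHom X Y) (g : PreHom Y Z)
    (J : ClosedInterval K) (h : J.carrier ⊆ Ico (f.comp g).s 1) :
    (f.comp g).app J h =
      (g.app J (h.trans (Ico_subset_Ico_left (le_max_right _ _)))).comp
        (f.app J (h.trans (Ico_subset_Ico_left (le_max_left _ _)))) := rfl

/-- The category of `∇`-modules on annuli `A[r, 1)`, with morphisms defined up to shrinking:
the direct limit, as `r` tends to `1`, of the categories of `∇`-modules on `A[r, 1)`. -/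
instance : Category (GermModule K) where
  Hom X Y := Quotient (PreHom.setoid X Y)
  id X := Quotient.mk _ (PreHom.id X)
  comp := Quotient.map₂ PreHom.comp fun f f' ⟨s, h1, h2, h3, h⟩ g g' ⟨s', h1', h2', h3', h'⟩ =>
    ⟨max s s', max_lt h1 h1', max_le_max h2 h2', max_le_max h3 h3', fun J hf hg hJ => by
      have e1 : J.carrier ⊆ Ico s 1 := hJ.trans (Ico_subset_Ico_left (le_max_left _ _))
      have e2 : J.carrier ⊆ Ico s' 1 := hJ.trans (Ico_subset_Ico_left (le_max_right _ _))
      rw [PreHom.comp_app, PreHom.comp_app, h J _ _ e1, h' J _ _ e2]⟩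
  id_comp {X Y} f := by
    induction f using Quotient.inductionOn with
    | h f =>
      refine Quotient.sound ⟨f.s, f.s_mem.2.2, max_le f.left le_rfl, le_rfl, fun J hf hg hJ => ?_⟩
      rfl
  comp_id {X Y} f := by
    induction f using Quotient.inductionOn with
    | h f =>
      refine Quotient.sound ⟨f.s, f.s_mem.2.2, max_le le_rfl f.right, le_rfl, fun J hf hg hJ => ?_⟩
      rfl
  assoc {X Y Z W} f g k := by
    induction f using Quotient.inductionOn with
    | h f =>
    induction g using Quotient.inductionOn with
    | h g =>
    induction k using Quotient.inductionOn with
    | h k =>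
      refine Quotient.sound ⟨max (max f.s g.s) k.s,
        max_lt (max_lt f.s_mem.2.2 g.s_mem.2.2) k.s_mem.2.2, le_rfl, ?_, fun J hf hg hJ => ?_⟩
      · exact (max_assoc _ _ _).symm.le
      · rfl

/-- The functor from `∇`-modules on `A[r, 1)` to germs. -/
def ofLogNabla (r : ℝ) (hr : r ∈ valueGroup K ∩ Ioo 0 1) :
    LogNablaModule K (Ico r 1) ⥤ GermModule K where
  obj E := ⟨r, hr, E⟩
  map {E F} f := Quotient.mk _ ⟨r, hr, le_rfl, le_rfl,
    (LogNablaModule.restrict (Ico_subset_Ico_left le_rfl)).map f⟩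
  map_id E := rfl
  map_comp f g := by
    refine Quotient.sound ⟨r, hr.2.2, le_rfl, ?_, fun J hf hg hJ => ?_⟩
    · exact (max_self r).le
    · rfl

/-- A germ is unipotent if it is so on some annulus `A[s, 1)`. -/
def IsUnipotent (X : GermModule K) : Prop :=
  ∃ (s : ℝ) (_ : s ∈ valueGroup K ∩ Ioo 0 1) (h : X.r ≤ s),
    ((LogNablaModule.restrict (Ico_subset_Ico_left h)).obj X.E).IsUnipotent

end GermModule

/-- The log-`∇`-modules on `A[0, 1)` with nilpotent residue, whose restrictions to `A(0, 1)` are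
overconvergent. -/
def overconvergentLog : ObjectProperty (LogNablaModule K (Ico 0 1)) := fun E =>
  E.HasNilpotentResidue ∧
    ((LogNablaModule.restrict Ioo_subset_Ico_self).obj E).IsOverconvergent

/-- The unipotent `∇`-modules on `A(I)`. -/
def unipotent (I : Set ℝ) : ObjectProperty (LogNablaModule K I) := fun E => E.IsUnipotent

/-- The unipotent germs of `∇`-modules. -/
def unipotentGerm : ObjectProperty (GermModule K) := fun X => X.IsUnipotent

/-- The category of log-`∇`-modules on `A[0, 1)` with nilpotent residue, whose restrictions to
`A(0, 1)` are overconvergent. -/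
abbrev OverconvergentLogModule : Type (u + 1) :=
  (overconvergentLog K).FullSubcategory

/-- The category of unipotent `∇`-modules on `A(I)`. -/
abbrev UnipotentModule (I : Set ℝ) : Type (u + 1) :=
  (unipotent K I).FullSubcategory

/-- The category of germs of unipotent `∇`-modules on annuli `A[r, 1)`. -/
abbrev UnipotentGerm : Type (u + 1) :=
  (unipotentGerm K).FullSubcategory

end Modules

end RigidAnnulus

end

/-! Each of (b), (c), (c') is compared with (a) through the functor `(V, N) ↦ O ⊗ V`. Restricting `O
⊗ V` to a smaller annulus gives `O ⊗ V` again, so once these comparisons are equivalences, the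
restriction functors out of (b) are too.

Write `D` for `t d/dt`, and call a section null if a power of `D` kills it. On `O ⊗ V` the operator
`D` acts on the coefficient of `t^i` through `i + N`, which is invertible for `i ≠ 0` in
characteristic `0`; hence the null elements of `R_J ⊗ V` are exactly those of `V`. Horizontal maps
preserve null sections, which gives full faithfulness (`toLogNabla_full`). A module comes from (a)
as soon as its null sections generate it (`exists_iso_toLogNabla`): null sections independent over
`K` stay independent over the functions on an annulus (`liftBaseChange_injective`), because such a
ring of functions has no nontrivial `θ`-stable ideals (`eq_top_of_theta_stable_of_ne_bot`).

What remains is generation by null sections. For unipotent modules (`IsUnipotent.isSpannedByNull`),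
horizontal sections of a quotient are lifted by solving `D y = z` up to constants. Integration
divides coefficients by powers of `i`, and `|1/i| ≤ |i|`, so it costs only a slight shrinking of the
annulus.

For overconvergent log-modules on the disc (`isSpannedByNull_of_overconvergentLog`), integer valued
polynomials `P_N` are built with `P_N ≡ 1` modulo `X^d` and zeros of order `d` at `1, …, N`.
Nilpotence of the residue makes `P_{N+1}(D) w - P_N(D) w` divisible by `t^(N+1)`; overconvergence,
through Newton expansions in binomial coefficients, bounds it near the boundary by a slowly growing
geometric sequence. So `P_N(D) w` converges on smaller discs, to a null section congruent to `w`
modulo `t`, and a Nakayama argument concludes. Conversely `O ⊗ V` is overconvergent because the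
binomial coefficients of a nilpotent `N` grow polynomially. -/

noncomputable section

namespace RigidAnnulus

/-! ### Convergence on an annulus read off from its two boundary radii. -/

section Weight

variable {K : Type u} [NormedField K]

/-- The maximum `max (lo ^ i) (hi ^ i)` of the monomial `t ^ i` on `A(J)`. If `lo = 0`, this is
`hi ^ i`, also for negative `i`. -/
def weight (J : ClosedInterval K) (i : ℤ) : ℝ := max (J.lo ^ i) (J.hi ^ i)

variable {J : ClosedInterval K}

lemma weight_pos (i : ℤ) : 0 < weight J i :=
  lt_max_of_lt_right (zpow_pos J.hi_pos i)

lemma weight_zero : weight J 0 = 1 := by simp [weight]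

lemma weight_of_lo_eq_zero (h : J.lo = 0) (i : ℤ) : weight J i = J.hi ^ i := by
  rcases eq_or_ne i 0 with rfl | hi
  · simp [weight]
  · rw [weight, h, zero_zpow i hi]
    exact max_eq_right (zpow_pos J.hi_pos i).le

lemma weight_add_le (i j : ℤ) : weight J (i + j) ≤ weight J i * weight J j := by
  have h0 := J.hi_pos
  rcases J.lo_nonneg.eq_or_lt with h | h
  · simp only [weight_of_lo_eq_zero h.symm, zpow_add₀ h0.ne', le_refl]
  · refine max_le ?_ ?_
    · rw [zpow_add₀ h.ne']
      exact mul_le_mul (le_max_left _ _) (le_max_left _ _) (zpow_nonneg h.le _) (weight_pos _).le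
    · rw [zpow_add₀ h0.ne']
      exact mul_le_mul (le_max_right _ _) (le_max_right _ _) (zpow_nonneg h0.le _)
        (weight_pos _).le

lemma zero_mem_carrier_iff : 0 ∈ J.carrier ↔ J.lo = 0 :=
  ⟨fun h => le_antisymm h.1 J.lo_nonneg, fun h => ⟨h.le, J.hi_pos.le⟩⟩

/-- The condition on `i` excludes negative exponents on a disc, where `r ^ i` is unbounded near the
centre while `weight` is only `hi ^ i`. -/
lemma zpow_le_weight {r : ℝ} (hr : r ∈ J.carrier) {i : ℤ} (hi : 0 ∈ J.carrier → 0 ≤ i) :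
    r ^ i ≤ weight J i := by
  rcases le_or_gt 0 i with h | h
  · exact (zpow_le_zpow_left₀ h (J.nonneg hr) hr.2).trans (le_max_right _ _)
  · have hlo : 0 < J.lo := J.lo_nonneg.lt_of_ne fun h0 =>
      absurd (hi (zero_mem_carrier_iff.2 h0.symm)) (not_le.2 h)
    refine le_trans ?_ (le_max_left _ _)
    rw [← neg_neg i, zpow_neg r, zpow_neg J.lo]
    exact inv_anti₀ (zpow_pos hlo _) (zpow_le_zpow_left₀ (neg_nonneg.2 h.le) hlo.le hr.1)

/-- A monomial is largest at an end of the interval of radii, so decay at the two ends implies decay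
at all radii between them. -/
lemma converges_iff {c : ℤ → K} : Converges J c ↔
    Tendsto (fun i => ‖c i‖ * weight J i) cofinite (𝓝 0) ∧ (0 ∈ J.carrier → ∀ i < 0, c i = 0) := by
  refine ⟨fun h => ⟨?_, h.2⟩, fun h => ⟨fun r hr => ?_, h.2⟩⟩
  · have h1 := (h.1 J.lo ⟨le_rfl, J.lo_le_hi⟩).max (h.1 J.hi J.hi_mem)
    rw [max_self] at h1
    refine h1.congr fun i => ?_
    rw [weight, mul_max_of_nonneg _ _ (norm_nonneg _)]
  · refine squeeze_zero (fun i => mul_nonneg (norm_nonneg _) (zpow_nonneg (J.nonneg hr) _))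
      (fun i => ?_) h.1
    by_cases hi : 0 ∈ J.carrier → 0 ≤ i
    · exact mul_le_mul_of_nonneg_left (zpow_le_weight hr hi) (norm_nonneg _)
    · push Not at hi
      simp [h.2 hi.1 i hi.2]

end Weight

/-! ### The Banach algebra structure of `R_J`. -/

section NormedRing

variable {K : Type u} [NormedField K] [IsUltrametricDist K] {J : ClosedInterval K}

namespace Fn

/-- The norm `sup_i |c_i| max (lo ^ i) (hi ^ i)`, i.e. the supremum norm on `A(J)`. -/
instance : Norm (Fn J) := ⟨fun f => ⨆ i, ‖f.coeff i‖ * weight J i⟩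

lemma tendsto_coeff_weight (f : Fn J) :
    Tendsto (fun i => ‖f.coeff i‖ * weight J i) cofinite (𝓝 0) :=
  (converges_iff.1 f.converges).1

lemma coeff_weight_le (f : Fn J) (i : ℤ) : ‖f.coeff i‖ * weight J i ≤ ‖f‖ :=
  le_ciSup (f := fun i => ‖f.coeff i‖ * weight J i)
    (f.tendsto_coeff_weight.bddAbove_range_of_cofinite) i

lemma norm_le {f : Fn J} {C : ℝ} (h : ∀ i, ‖f.coeff i‖ * weight J i ≤ C) : ‖f‖ ≤ C :=
  ciSup_le h

lemma norm_nonneg' (f : Fn J) : 0 ≤ ‖f‖ :=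
  (mul_nonneg (norm_nonneg _) (weight_pos 0).le).trans (f.coeff_weight_le 0)

lemma norm_add_le_max (f g : Fn J) : ‖f + g‖ ≤ max ‖f‖ ‖g‖ := by
  refine norm_le fun i => ?_
  rw [coeff_add]
  calc ‖f.coeff i + g.coeff i‖ * weight J i
      ≤ max ‖f.coeff i‖ ‖g.coeff i‖ * weight J i :=
        mul_le_mul_of_nonneg_right (IsUltrametricDist.norm_add_le_max _ _) (weight_pos i).le
    _ = max (‖f.coeff i‖ * weight J i) (‖g.coeff i‖ * weight J i) :=
        max_mul_of_nonneg _ _ (weight_pos i).le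
    _ ≤ _ := max_le_max (coeff_weight_le f i) (coeff_weight_le g i)

@[simp] lemma coeff_neg (f : Fn J) (i : ℤ) : (-f).coeff i = -f.coeff i := rfl
@[simp] lemma coeff_sub (f g : Fn J) (i : ℤ) : (f - g).coeff i = f.coeff i - g.coeff i := rfl

lemma norm_mul_le' (f g : Fn J) : ‖f * g‖ ≤ ‖f‖ * ‖g‖ := by
  refine norm_le fun n => ?_
  rw [← le_div_iff₀ (weight_pos n), coeff_mul]
  refine (IsUltrametricDist.norm_tsum_le _).trans (ciSup_le fun i => ?_)
  rw [le_div_iff₀ (weight_pos n), norm_mul]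
  calc ‖f.coeff i‖ * ‖g.coeff (n - i)‖ * weight J n
      ≤ ‖f.coeff i‖ * ‖g.coeff (n - i)‖ * (weight J i * weight J (n - i)) := by
        refine mul_le_mul_of_nonneg_left ?_ (by positivity)
        simpa using weight_add_le (J := J) i (n - i)
    _ = (‖f.coeff i‖ * weight J i) * (‖g.coeff (n - i)‖ * weight J (n - i)) := by ring
    _ ≤ _ := mul_le_mul (coeff_weight_le _ _) (coeff_weight_le _ _)
        (mul_nonneg (norm_nonneg _) (weight_pos _).le) (norm_nonneg' f)

lemma supNorm_nonneg (f : Fn J) : 0 ≤ supNorm f :=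
  Real.iSup_nonneg fun r => Real.iSup_nonneg fun _ =>
    mul_nonneg (norm_nonneg _) (zpow_nonneg (J.nonneg r.2) _)

variable [CompleteSpace K]

instance : NormedCommRing (Fn J) :=
  { (inferInstance : CommRing (Fn J)), AddGroupNorm.toNormedAddCommGroup (E := Fn J)
      { toFun := norm
        map_zero' := le_antisymm (norm_le fun i => by simp) (norm_nonneg' _)
        add_le' := fun f g => (norm_add_le_max f g).trans
          (max_le_add_of_nonneg (norm_nonneg' f) (norm_nonneg' g))
        neg' := fun f => by simp only [norm, coeff_neg, norm_neg]
        eq_zero_of_map_eq_zero' := fun f hf => by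
          ext i
          have h1 := (f.coeff_weight_le i).trans hf.le
          have h2 := nonpos_of_mul_nonpos_left h1 (weight_pos i)
          simpa using h2 } with
    norm_mul_le := norm_mul_le' }

instance : IsUltrametricDist (Fn J) :=
  IsUltrametricDist.isUltrametricDist_of_forall_norm_add_le_max_norm norm_add_le_max

lemma norm_smul_le' (a : K) (f : Fn J) : ‖a • f‖ ≤ ‖a‖ * ‖f‖ := by
  refine norm_le fun i => ?_
  rw [coeff_smul, norm_mul, mul_assoc]
  exact mul_le_mul_of_nonneg_left (coeff_weight_le f i) (norm_nonneg a)

instance : NormedAlgebra K (Fn J) where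
  norm_smul_le := norm_smul_le'

/-- Completeness serves twice: to invert elements within distance less than `1` of `1`, and to sum
the series of corrections that produces null sections on a disc. -/
instance : CompleteSpace (Fn J) := by
  refine Metric.complete_of_cauchySeq_tendsto fun u hu => ?_
  have hsub (i : ℤ) (m n : ℕ) :
      ‖(u m).coeff i - (u n).coeff i‖ * weight J i ≤ dist (u m) (u n) := by
    rw [dist_eq_norm]
    exact coeff_weight_le (u m - u n) i
  have hc (i : ℤ) : ∃ c, Tendsto (fun n => (u n).coeff i) atTop (𝓝 c) := by
    refine cauchySeq_tendsto_of_complete (Metric.cauchySeq_iff.2 fun ε hε => ?_)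
    obtain ⟨N, hN⟩ := Metric.cauchySeq_iff.1 hu _ (mul_pos hε (weight_pos (J := J) i))
    refine ⟨N, fun m hm n hn => ?_⟩
    rw [dist_eq_norm]
    exact lt_of_mul_lt_mul_right ((hsub i m n).trans_lt (hN m hm n hn)) (weight_pos i).le
  choose c hc using hc
  have key (ε : ℝ) (hε : 0 < ε) : ∃ N, ∀ n ≥ N, ∀ i, ‖c i - (u n).coeff i‖ * weight J i ≤ ε := by
    obtain ⟨N, hN⟩ := Metric.cauchySeq_iff.1 hu ε hε
    refine ⟨N, fun n hn i => ?_⟩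
    refine le_of_tendsto (((hc i).sub_const _).norm.mul_const _) ?_
    filter_upwards [eventually_ge_atTop N] with m hm
    exact (hsub i m n).trans (hN m hm n hn).le
  have hconv : Converges J c := by
    refine converges_iff.2 ⟨?_, fun h0 i hi => ?_⟩
    · rw [Metric.tendsto_nhds]
      intro ε hε
      obtain ⟨N, hN⟩ := key (ε / 2) (half_pos hε)
      filter_upwards [(Metric.tendsto_nhds.1 (u N).tendsto_coeff_weight) (ε / 2) (half_pos hε)]
        with i hi
      rw [dist_zero_right, Real.norm_of_nonneg (mul_nonneg (norm_nonneg _) (weight_pos i).le)]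
        at hi ⊢
      have h1 : ‖c i‖ ≤ ‖c i - (u N).coeff i‖ + ‖(u N).coeff i‖ := by
        simpa using norm_add_le (c i - (u N).coeff i) ((u N).coeff i)
      have h2 := mul_le_mul_of_nonneg_right h1 (weight_pos (J := J) i).le
      have h3 := hN N le_rfl i
      rw [add_mul] at h2
      linarith
    · refine tendsto_nhds_unique (hc i) (tendsto_const_nhds.congr fun n => ?_)
      exact ((u n).converges.2 h0 i hi).symm
  let g : Fn J := ⟨c, hconv⟩
  refine ⟨g, Metric.tendsto_atTop.2 fun ε hε => ?_⟩
  obtain ⟨N, hN⟩ := key (ε / 2) (half_pos hε)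
  refine ⟨N, fun n hn => ?_⟩
  rw [dist_comm, dist_eq_norm]
  refine lt_of_le_of_lt (norm_le (C := ε / 2) fun i => ?_) (half_lt_self hε)
  exact hN n hn i

lemma continuous_coeff (i : ℤ) : Continuous fun f : Fn J => f.coeff i := by
  let φ : Fn J →+ K := { toFun := fun f => f.coeff i, map_zero' := rfl, map_add' := fun _ _ => rfl }
  refine AddMonoidHomClass.continuous_of_bound φ (weight J i)⁻¹ fun f => ?_
  rw [inv_mul_eq_div, le_div_iff₀ (weight_pos i)]
  exact coeff_weight_le f i

lemma gaussNorm_le_norm (f : Fn J) {r : ℝ} (hr : r ∈ J.carrier) : gaussNorm r f ≤ ‖f‖ := by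
  refine ciSup_le fun i => ?_
  by_cases hi : 0 ∈ J.carrier → 0 ≤ i
  · exact (mul_le_mul_of_nonneg_left (zpow_le_weight hr hi) (norm_nonneg _)).trans
      (coeff_weight_le f i)
  · push Not at hi
    simp [f.converges.2 hi.1 i hi.2]

lemma supNorm_le_norm (f : Fn J) : supNorm f ≤ ‖f‖ :=
  haveI : Nonempty J.carrier := ⟨⟨J.hi, J.hi_mem⟩⟩
  ciSup_le fun r => gaussNorm_le_norm f r.2

/-- Overconvergence is phrased with `supNorm` and will be exploited on circles only, where a single
radius accounts for both norms. -/
lemma norm_le_supNorm (hJ : J.lo = J.hi) (f : Fn J) : ‖f‖ ≤ supNorm f := by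
  have h1 : ‖f‖ = gaussNorm J.hi f := by
    simp only [gaussNorm, norm, weight, hJ, max_self]
  rw [h1]
  refine le_ciSup (f := fun r : J.carrier => gaussNorm (r : ℝ) f) ⟨‖f‖, ?_⟩ ⟨J.hi, J.hi_mem⟩
  rintro _ ⟨r, rfl⟩
  exact gaussNorm_le_norm f r.2

end Fn
end NormedRing

end RigidAnnulus

end

noncomputable section

namespace RigidAnnulus

/-! ### Integer valued polynomials in `θ` and the `θ`-stable ideals of `R_J`. -/

section Binomial

open Polynomial

variable (K : Type u) [Field K]

/-- The polynomial `∏_{j = 1}^n (1 - X / j)`. It takes integral values at integers. -/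
def binomPoly (n : ℕ) : K[X] := ∏ j ∈ Finset.range n, (1 - C ((j + 1 : K)⁻¹) * X)

lemma binomPoly_zero : binomPoly K 0 = 1 := by simp [binomPoly]

lemma binomPoly_succ (n : ℕ) :
    binomPoly K (n + 1) = binomPoly K n * (1 - C ((n + 1 : K)⁻¹) * X) :=
  Finset.prod_range_succ _ _

lemma natDegree_binomPoly_le (n : ℕ) : (binomPoly K n).natDegree ≤ n := by
  induction n with
  | zero => simp [binomPoly]
  | succ n ih =>
    rw [binomPoly_succ]
    refine natDegree_mul_le.trans (add_le_add ih ?_)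
    refine (natDegree_sub_le _ _).trans ?_
    simpa using (natDegree_C_mul_le _ _).trans natDegree_X_le

lemma eval_zero_binomPoly (n : ℕ) : (binomPoly K n).eval 0 = 1 := by
  simp [binomPoly, eval_prod]

variable [CharZero K]

/-- Multiplying each factor `1 - i / j` by `j` leaves `(1 - i)(2 - i) ⋯ (n - i)`, a rising
factorial, and `n!` divides every product of `n` consecutive integers. Integrality of the values
follows. -/
lemma eval_binomPoly_mul_factorial (n : ℕ) (i : ℤ) :
    (binomPoly K n).eval (i : K) * n.factorial = ((ascPochhammer ℤ n).eval (1 - i) : ℤ) := by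
  induction n with
  | zero => simp [binomPoly]
  | succ n ih =>
    have hn : (n + 1 : K) ≠ 0 := by exact_mod_cast n.succ_ne_zero
    rw [binomPoly_succ, ascPochhammer_succ_right, eval_mul, eval_mul, Int.cast_mul, ← ih,
      Nat.factorial_succ]
    simp only [eval_sub, eval_one, eval_mul, eval_C, eval_X, eval_add, eval_natCast]
    push_cast
    field_simp
    ring

lemma eval_binomPoly_intCast (n : ℕ) (i : ℤ) : ∃ z : ℤ, (binomPoly K n).eval (i : K) = z := by
  refine ⟨Ring.multichoose (1 - i) n, ?_⟩
  have h1 := Ring.factorial_nsmul_multichoose_eq_ascPochhammer (1 - i : ℤ) n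
  have h2 := eval_binomPoly_mul_factorial K n i
  have h3 : (ascPochhammer ℤ n).eval (1 - i) = (ascPochhammer ℕ n).smeval (1 - i : ℤ) := by
    rw [← Ring.smeval_ascPochhammer_int_ofNat, eval_eq_smeval]
  rw [h3, ← h1] at h2
  have hn : (n.factorial : K) ≠ 0 := by exact_mod_cast n.factorial_ne_zero
  apply mul_right_cancel₀ hn
  rw [h2, nsmul_eq_mul]
  push_cast
  ring

lemma eval_binomPoly_eq_zero {n : ℕ} {j : ℕ} (hj : 1 ≤ j) (hjn : j ≤ n) :
    (binomPoly K n).eval (j : K) = 0 := by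
  rw [binomPoly, eval_prod]
  refine Finset.prod_eq_zero (i := j - 1) (Finset.mem_range.2 (by omega)) ?_
  have h1 : ((j - 1 : ℕ) : K) + 1 = j := by exact_mod_cast Nat.sub_add_cancel hj
  have hj' : (j : K) ≠ 0 := by exact_mod_cast (by omega : j ≠ 0)
  simp [h1, hj']

end Binomial

lemma aeval_mem_of_stable {k M : Type*} [Field k] [AddCommGroup M] [Module k M]
    {D : Module.End k M} {W : Submodule k M} (hW : ∀ x ∈ W, D x ∈ W) (P : Polynomial k) {x : M}
    (hx : x ∈ W) : Polynomial.aeval D P x ∈ W := by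
  induction P using Polynomial.induction_on' with
  | add P Q hP hQ => rw [map_add, LinearMap.add_apply]; exact W.add_mem hP hQ
  | monomial n a =>
    rw [Polynomial.aeval_monomial, Module.End.mul_apply, Module.algebraMap_end_apply]
    refine W.smul_mem a ?_
    induction n with
    | zero => exact hx
    | succ n ih => rw [pow_succ', Module.End.mul_apply]; exact hW _ ih

section Theta

open Polynomial

variable {K : Type u} [NormedField K] [IsUltrametricDist K] {J : ClosedInterval K}

namespace Fn

lemma coeff_t_mul (f : Fn J) (i : ℤ) : (t * f).coeff i = f.coeff (i - 1) := by
  rw [t, coeff_monomial_mul, one_mul]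

/-- The function with given coefficients. -/
def mk (c : ℤ → K) (hc : Converges J c) : Fn J := ⟨c, hc⟩

@[simp] lemma coeff_mk (c : ℤ → K) (hc : Converges J c) : (mk c hc : Fn J).coeff = c := rfl

lemma t_mul_tInv (h : 0 ∉ J.carrier) : t * tInv h = 1 := by
  ext i
  rw [coeff_t_mul, tInv, coeff_monomial, coeff_one]
  simp [sub_eq_neg_self]

variable [CompleteSpace K]

lemma coeff_aeval_theta (P : K[X]) (f : Fn J) (i : ℤ) :
    (aeval (theta J) P f).coeff i = P.eval (i : K) * f.coeff i := by
  induction P using Polynomial.induction_on' with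
  | add P Q hP hQ => simp [hP, hQ, add_mul]
  | monomial n a =>
    rw [aeval_monomial, eval_monomial]
    simp only [Module.End.mul_apply, Module.algebraMap_end_apply, coeff_smul, mul_assoc]
    congr 1
    induction n with
    | zero => simp
    | succ n ih => rw [pow_succ', Module.End.mul_apply, coeff_theta, ih]; ring

lemma coeff_algebraMap (a : K) (i : ℤ) :
    (algebraMap K (Fn J) a).coeff i = if i = 0 then a else 0 := by
  rw [Algebra.algebraMap_eq_smul_one, coeff_smul, coeff_one]
  simp

lemma theta_algebraMap (a : K) : theta J (algebraMap K (Fn J) a) = 0 := by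
  ext i
  rw [coeff_theta, coeff_algebraMap]
  split_ifs with h <;> simp [h]

lemma coeff_t_pow_mul (n : ℕ) (f : Fn J) (i : ℤ) : (t ^ n * f).coeff i = f.coeff (i - n) := by
  induction n generalizing i with
  | zero => simp
  | succ n ih => rw [pow_succ', mul_assoc, coeff_t_mul, ih]; push_cast; congr 1; ring

lemma theta_t : theta J t = t := by
  ext i
  rw [coeff_theta, t, coeff_monomial]
  split_ifs with h <;> simp [h]

lemma theta_t_pow (n : ℕ) : theta J (t ^ n) = (n : K) • t ^ n := by
  ext i
  have h : (t ^ n : Fn J).coeff i = if i = n then 1 else 0 := by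
    have := coeff_t_pow_mul (J := J) n 1 i
    rw [mul_one, coeff_one] at this
    simpa [sub_eq_zero] using this
  rw [coeff_theta, coeff_smul, h]
  split_ifs with hi <;> simp [hi]

/-- On a disc, a function whose coefficients of index `< n` vanish is divisible by `t ^ n`. -/
lemma exists_eq_t_pow_mul (h0 : 0 ∈ J.carrier) (n : ℕ) (f : Fn J)
    (hf : ∀ i < (n : ℤ), f.coeff i = 0) : ∃ g : Fn J, f = t ^ n * g := by
  have hw (i : ℤ) : weight J i = J.hi ^ i := weight_of_lo_eq_zero (zero_mem_carrier_iff.1 h0) i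
  have hpos := J.hi_pos
  refine ⟨mk (fun i => f.coeff (i + n)) (converges_iff.2 ⟨?_, fun _ i hi => hf _ (by omega)⟩), ?_⟩
  · have h1 := (f.tendsto_coeff_weight.comp
      (add_left_injective (n : ℤ)).tendsto_cofinite).mul_const (J.hi ^ (-(n : ℤ)))
    rw [zero_mul] at h1
    refine h1.congr fun i => ?_
    simp only [Function.comp, hw, mul_assoc, ← zpow_add₀ hpos.ne', add_neg_cancel_right]
  · ext i
    rw [coeff_t_pow_mul]
    simp

lemma coeff_res {J' : ClosedInterval K} (h : J'.carrier ⊆ J.carrier) (f : Fn J) (i : ℤ) :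
    (res h f).coeff i = f.coeff i := rfl

lemma res_injective {J' : ClosedInterval K} (h : J'.carrier ⊆ J.carrier) :
    Function.Injective (res h) := fun f g hfg => by
  ext i
  rw [← coeff_res h f, hfg, coeff_res]

/-- A `θ`-stable ideal of `R_J` containing a series with constant coefficient `1` is trivial. -/
lemma eq_top_of_theta_stable [CharZero K] (I : Ideal (Fn J)) (hI : ∀ f ∈ I, theta J f ∈ I)
    {g : Fn J} (hg : g ∈ I) (hg0 : g.coeff 0 = 1) : I = ⊤ := by
  have hP (P : K[X]) : aeval (theta J) P g ∈ I := by
    let W : Submodule K (Fn J) := I.restrictScalars K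
    exact aeval_mem_of_stable (W := W) hI P hg
  have hsmall := (Metric.tendsto_nhds.1 g.tendsto_coeff_weight) (1 / 2) (by norm_num)
  rw [eventually_cofinite] at hsmall
  obtain ⟨n, hn⟩ : ∃ n : ℕ, ∀ i : ℤ, n < i.natAbs → ‖g.coeff i‖ * weight J i ≤ 1 / 2 := by
    obtain ⟨n, hn⟩ := (hsmall.image Int.natAbs).bddAbove
    refine ⟨n, fun i hi => ?_⟩
    by_contra hcon
    refine absurd (hn ⟨i, ?_, rfl⟩) (not_le.2 hi)
    intro hlt
    rw [dist_zero_right, Real.norm_of_nonneg (mul_nonneg (norm_nonneg _) (weight_pos i).le)] at hlt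
    exact hcon hlt.le
  -- The first factor vanishes at `1, …, n`, its reflection at `-1, …, -n`, and both are `1` at `0`
  -- and integral at integers. So `P(θ)` keeps the constant coefficient of `g`, kills the others of
  -- index up to `n` in absolute value, and does not enlarge the small tail: `P(θ) g` lies within `1
  -- / 2` of `1`.
  set P : K[X] := binomPoly K n * (binomPoly K n).comp (-X) with hPdef
  have hev (i : ℤ) : P.eval (i : K) =
      (binomPoly K n).eval (i : K) * (binomPoly K n).eval ((-i : ℤ) : K) := by
    simp [hPdef]
  have hunit : IsUnit (1 - (1 - aeval (theta J) P g)) := by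
    refine isUnit_one_sub_of_norm_lt_one (lt_of_le_of_lt (norm_le (C := 1 / 2) fun i => ?_)
      (by norm_num))
    rw [coeff_sub, coeff_aeval_theta, coeff_one]
    split_ifs with h0
    · subst h0
      have h1 := hev 0
      simp only [Int.cast_zero, neg_zero, eval_zero_binomPoly, mul_one] at h1
      simp [h1, hg0]
    · rw [zero_sub, norm_neg, norm_mul]
      rcases le_or_gt i.natAbs n with hle | hlt
      · have : P.eval (i : K) = 0 := by
          rw [hev]
          rcases i.natAbs_eq with h | h
          · rw [h, Int.cast_natCast, eval_binomPoly_eq_zero K (by omega) hle, zero_mul]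
          · rw [h, neg_neg, Int.cast_natCast, eval_binomPoly_eq_zero K (by omega) hle, mul_zero]
        simp [this]
      · have h1 : ‖P.eval (i : K)‖ ≤ 1 := by
          rw [hev]
          obtain ⟨z, hz⟩ := eval_binomPoly_intCast K n i
          obtain ⟨z', hz'⟩ := eval_binomPoly_intCast K n (-i)
          rw [hz, hz', ← Int.cast_mul]
          exact IsUltrametricDist.norm_intCast_le_one K _
        refine le_trans ?_ (hn i hlt)
        exact mul_le_mul_of_nonneg_right (mul_le_of_le_one_left (norm_nonneg _) h1)
          (weight_pos i).le
  rw [sub_sub_cancel] at hunit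
  exact I.eq_top_of_isUnit_mem (hP P) hunit

/-- The ring of functions on a closed annulus not containing `0` has no nontrivial `θ`-stable
ideals. -/
lemma eq_top_of_theta_stable_of_ne_bot [CharZero K] (h0 : 0 ∉ J.carrier) (I : Ideal (Fn J))
    (hI : ∀ f ∈ I, theta J f ∈ I) (hne : I ≠ ⊥) : I = ⊤ := by
  obtain ⟨f, hf, hf0⟩ := Submodule.exists_mem_ne_zero_of_ne_bot hne
  obtain ⟨i, hi⟩ : ∃ i, f.coeff i ≠ 0 := by
    by_contra! hcon
    exact hf0 (Fn.ext hcon)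
  -- Away from `t = 0` monomials are units, so division by `c_i t^i` moves a nonzero coefficient to
  -- index `0` and makes it `1`.
  refine eq_top_of_theta_stable I hI
    (I.mul_mem_left (monomial (-i) (fun h => (h0 h).elim) (f.coeff i)⁻¹) hf) ?_
  rw [coeff_monomial_mul, zero_sub, neg_neg, inv_mul_cancel₀ hi]

end Fn

end Theta

end RigidAnnulus

end

/-! ### Null elements of `R_J ⊗ V` and their linear independence over `R_J`. -/

noncomputable section

namespace RigidAnnulus

/-- A nilpotent endomorphism of a nonzero space has a nonzero functional vanishing on the image. -/
lemma exists_functional_of_isNilpotent {k V : Type*} [Field k] [AddCommGroup V] [Module k V]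
    [Nontrivial V] {N : Module.End k V} (hN : IsNilpotent N) :
    ∃ φ : V →ₗ[k] k, φ ≠ 0 ∧ ∀ v, φ (N v) = 0 := by
  have hlt : LinearMap.range N < ⊤ := by
    refine lt_top_iff_ne_top.2 fun htop => ?_
    obtain ⟨n, hn⟩ := hN
    have hs : Function.Surjective (N ^ n) := by
      rw [Module.End.coe_pow]
      exact (LinearMap.range_eq_top.1 htop).iterate n
    obtain ⟨v, hv⟩ := exists_ne (0 : V)
    obtain ⟨w, rfl⟩ := hs v
    simp [hn] at hv
  obtain ⟨φ, h0, hφ⟩ := Submodule.exists_le_ker_of_lt_top _ hlt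
  exact ⟨φ, h0, fun v => hφ ⟨v, rfl⟩⟩

variable {K : Type u} [NormedField K] [IsUltrametricDist K] [CompleteSpace K]
  {J : ClosedInterval K}

/-- A `K`-linear action `D` of `t d/dt` on an `R_J`-module, satisfying the Leibniz rule. -/
def IsConnection (J : ClosedInterval K) {M : Type*} [AddCommGroup M] [Module K M] [Module (Fn J) M]
    (D : Module.End K M) : Prop :=
  ∀ (f : Fn J) (m : M), D (f • m) = Fn.theta J f • m + f • D m

namespace NilpotentEnd

variable (X Y : NilpotentEnd K)

lemma isConnection_tensorD : IsConnection J (X.tensorD J) := fun f m => by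
  induction m with
  | zero => simp
  | add x y hx hy =>
    simp only [smul_add, map_add, hx, hy]
    abel
  | tmul g v =>
    simp only [TensorProduct.smul_tmul', tensorD_tmul, smul_eq_mul, Fn.theta_mul,
      TensorProduct.add_tmul, smul_add, add_assoc]

/-- The coefficient of `t ^ i` of an element of `R_J ⊗ V`. -/
def coeffMap (J : ClosedInterval K) (i : ℤ) : Fn J ⊗[K] X.V →ₗ[K] X.V :=
  TensorProduct.lift (LinearMap.mk₂ K (fun (f : Fn J) (v : X.V) => f.coeff i • v)
    (fun f g v => by rw [Fn.coeff_add, add_smul]) (fun a f v => by rw [Fn.coeff_smul, mul_smul])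
    (fun f v w => smul_add _ _ _) (fun a f v => smul_comm _ _ _))

@[simp] lemma coeffMap_tmul (i : ℤ) (f : Fn J) (v : X.V) :
    X.coeffMap J i (f ⊗ₜ v) = f.coeff i • v := rfl

variable {X} in
lemma tensor_ext {z : Fn J ⊗[K] X.V} (h : ∀ i, X.coeffMap J i z = 0) : z = 0 := by
  let b := Module.finBasis K X.V
  let c := b.baseChange (Fn J)
  have hz : z = ∑ k, c.repr z k ⊗ₜ[K] b k := by
    conv_lhs => rw [← c.sum_repr z]
    exact Finset.sum_congr rfl fun k _ => by
      rw [Module.Basis.baseChange_apply, TensorProduct.smul_tmul', smul_eq_mul, mul_one]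
  have h0 (k) : c.repr z k = 0 := by
    ext i
    have h1 := h i
    rw [hz, map_sum] at h1
    simp only [coeffMap_tmul] at h1
    exact Fintype.linearIndependent_iff.1 b.linearIndependent _ h1 k
  rw [hz]
  simp [h0]

lemma coeffMap_tensorD (i : ℤ) (z : Fn J ⊗[K] X.V) :
    X.coeffMap J i (X.tensorD J z) = ((i : K) • 1 + X.N) (X.coeffMap J i z) := by
  induction z with
  | zero => simp
  | add x y hx hy => simp only [map_add, hx, hy]
  | tmul f v =>
    simp only [tensorD_tmul, map_add, coeffMap_tmul, Fn.coeff_theta, mul_smul, LinearMap.add_apply,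
      LinearMap.smul_apply, Module.End.one_apply, map_smul, smul_add]
    rw [smul_comm]

lemma coeffMap_tensorD_pow (i : ℤ) (n : ℕ) (z : Fn J ⊗[K] X.V) :
    X.coeffMap J i ((X.tensorD J ^ n) z) = (((i : K) • 1 + X.N) ^ n) (X.coeffMap J i z) := by
  induction n with
  | zero => simp
  | succ n ih => rw [pow_succ', pow_succ', Module.End.mul_apply, coeffMap_tensorD, ih]; rfl

lemma one_tmul_injective : Function.Injective fun v : X.V => (1 : Fn J) ⊗ₜ[K] v := fun v w h => by
  simpa [Fn.coeff_one] using congrArg (X.coeffMap J 0) h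

lemma tensorD_pow_one_tmul (n : ℕ) (v : X.V) :
    (X.tensorD J ^ n) ((1 : Fn J) ⊗ₜ v) = 1 ⊗ₜ (X.N ^ n) v := by
  induction n with
  | zero => simp
  | succ n ih =>
    have h1 : Fn.theta J 1 = 0 := by simpa using Fn.theta_algebraMap (J := J) (1 : K)
    rw [pow_succ', pow_succ', Module.End.mul_apply, ih, tensorD_tmul, h1]
    simp

variable {X} in
/-- The elements of `R_J ⊗ V` killed by a power of `t d/dt` are those of `V`. -/
lemma eq_one_tmul_of_tensorD_pow_eq_zero [CharZero K] {n : ℕ} {z : Fn J ⊗[K] X.V}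
    (h : (X.tensorD J ^ n) z = 0) : z = 1 ⊗ₜ X.coeffMap J 0 z := by
  rw [← sub_eq_zero]
  refine tensor_ext fun i => ?_
  rcases eq_or_ne i 0 with rfl | hi
  · simp [Fn.coeff_one]
  -- For `i ≠ 0` the operator `i + N` is a nonzero scalar plus a commuting nilpotent, hence
  -- invertible, and a power of it kills the coefficient of `t^i`.
  · have h1 : IsUnit ((((i : K) • 1 + X.N : Module.End K X.V)) ^ n) := by
      refine IsUnit.pow n ?_
      have hu : IsUnit ((i : K) • (1 : Module.End K X.V)) :=
        (isUnit_one.smul (Units.mk0 (i : K) (Int.cast_ne_zero.2 hi)))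
      exact X.nilpotent.isUnit_add_left_of_commute hu
        ((Commute.one_right _).smul_right _)
    have h2 := X.coeffMap_tensorD_pow i n z
    rw [h, map_zero] at h2
    have h3 : X.coeffMap J i z = 0 := by
      obtain ⟨u, hu⟩ := h1
      rw [← hu] at h2
      have h4 := congrArg (↑u⁻¹ : Module.End K X.V) h2
      rwa [map_zero, ← Module.End.mul_apply, Units.inv_mul, Module.End.one_apply, eq_comm] at h4
    simp [h3, Fn.coeff_one, hi]

/-- The restriction of the nilpotent endomorphism to a stable subspace. -/
def sub (W : Submodule K X.V) (hW : ∀ v ∈ W, X.N v ∈ W) : NilpotentEnd K where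
  V := W
  N := X.N.restrict hW
  nilpotent := by
    obtain ⟨n, hn⟩ := X.nilpotent
    refine ⟨n, LinearMap.ext fun v => Subtype.ext ?_⟩
    rw [Module.End.pow_restrict]
    simp [hn]

section Lift

variable {M : Type*} [AddCommGroup M] [Module K M] [Module (Fn J) M] [IsScalarTower K (Fn J) M]
  {D : Module.End K M}

variable {X} in
lemma liftBaseChange_tensorD (hD : IsConnection J D) {s : X.V →ₗ[K] M}
    (hs : ∀ v, s (X.N v) = D (s v)) (z : Fn J ⊗[K] X.V) :
    s.liftBaseChange (Fn J) (X.tensorD J z) = D (s.liftBaseChange (Fn J) z) := by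
  induction z with
  | zero => simp
  | add x y hx hy => simp only [map_add, hx, hy]
  | tmul f v => simp [hs, hD f (s v)]

variable {X} in
/-- Elements killed by powers of `t d/dt` which are independent over `K` are independent over the
ring of functions of an annulus. -/
lemma liftBaseChange_injective [CharZero K] (h0 : 0 ∉ J.carrier) (hD : IsConnection J D)
    {s : X.V →ₗ[K] M} (hs : ∀ v, s (X.N v) = D (s v)) (hinj : Function.Injective s) :
    Function.Injective (s.liftBaseChange (Fn J)) := by
  induction hn : Module.finrank K X.V using Nat.strong_induction_on generalizing X with
  | _ n ih =>
  subst hn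
  rcases subsingleton_or_nontrivial X.V with hV | hV
  · exact Function.injective_of_subsingleton _
  -- Induction on the dimension: a functional vanishing on the image of `N` induces a horizontal map
  -- `φ'` from `R_J ⊗ V` to `R_J` with its derivation `θ`, and its kernel `ker φ` carries a smaller
  -- nilpotent endomorphism.
  obtain ⟨φ, hφ0, hφ⟩ := exists_functional_of_isNilpotent X.nilpotent
  let X' := X.sub (LinearMap.ker φ) fun v _ => hφ v
  obtain ⟨v₀, hv₀⟩ : ∃ v₀, φ v₀ = 1 := by
    obtain ⟨v, hv⟩ := DFunLike.ne_iff.1 hφ0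
    exact ⟨(φ v)⁻¹ • v, by simpa using inv_mul_cancel₀ hv⟩
  -- The projection onto `ker φ` along `v₀`. It need not commute with `N`; it only serves to
  -- decompose elements.
  let π : X.V →ₗ[K] X'.V := LinearMap.codRestrict (LinearMap.ker φ)
    (LinearMap.id - φ.smulRight v₀) fun v => by simp [hv₀]
  let incl : X'.V →ₗ[K] X.V := (LinearMap.ker φ).subtype
  have hincl (v) : incl (π v) = v - φ v • v₀ := rfl
  let s' : X'.V →ₗ[K] M := s ∘ₗ incl
  have ih' : Function.Injective (s'.liftBaseChange (Fn J)) := by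
    refine ih _ ?_ (X := X') (s := s') (fun v => hs v.1) (hinj.comp Subtype.val_injective) rfl
    exact Submodule.finrank_lt fun htop => hφ0 (LinearMap.ker_eq_top.1 htop)
  let φ' : Fn J ⊗[K] X.V →ₗ[Fn J] Fn J :=
    LinearMap.liftBaseChange (Fn J) ((Algebra.linearMap K (Fn J)) ∘ₗ φ)
  have hφ'D (z) : φ' (X.tensorD J z) = Fn.theta J (φ' z) := by
    induction z with
    | zero => simp
    | add x y hx hy => simp only [map_add, hx, hy]
    | tmul f v =>
      simp [φ', hφ, Fn.theta_mul, Fn.theta_algebraMap]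
  -- A relation with `φ' z = 0` lies in `R_J ⊗ ker φ`, where the induction hypothesis applies.
  have hker {z} (hz : s.liftBaseChange (Fn J) z = 0) (hz' : φ' z = 0) : z = 0 := by
    have h1 (z : Fn J ⊗[K] X.V) : z = φ' z ⊗ₜ v₀ +
        incl.lTensor (Fn J) (π.lTensor (Fn J) z) := by
      induction z with
      | zero => simp
      | add x y hx hy =>
        conv_lhs => rw [hx, hy]
        simp only [map_add, TensorProduct.add_tmul]
        abel
      | tmul f v =>
        have h2 : φ' (f ⊗ₜ v) = φ v • f := by simp [φ', Algebra.smul_def, mul_comm]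
        rw [h2, LinearMap.lTensor_tmul, LinearMap.lTensor_tmul, hincl,
          TensorProduct.tmul_sub, TensorProduct.smul_tmul]
        abel
    have h4 : π.lTensor (Fn J) z = 0 := by
      apply ih'
      rw [map_zero, ← hz]
      conv_rhs => rw [h1 z, hz', TensorProduct.zero_tmul, zero_add]
      generalize π.lTensor (Fn J) z = y
      induction y with
      | zero => simp
      | add x y hx hy => simp only [map_add, hx, hy]
      | tmul f v => simp [s']
    rw [h1 z, hz', h4]
    simp
  -- The values of `φ'` on the relations form a `θ`-stable ideal, so it is zero or everything. In
  -- the first case all relations are trivial by `hker`.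
  let 𝔞 : Ideal (Fn J) := (LinearMap.ker (s.liftBaseChange (Fn J))).map φ'
  rw [← LinearMap.ker_eq_bot, eq_bot_iff]
  rcases eq_or_ne 𝔞 ⊥ with ha | ha
  · intro z hz
    refine hker hz ?_
    have : φ' z ∈ 𝔞 := ⟨z, hz, rfl⟩
    rwa [ha] at this
  · exfalso
    have htop : 𝔞 = ⊤ := by
      refine Fn.eq_top_of_theta_stable_of_ne_bot h0 𝔞 ?_ ha
      rintro _ ⟨z, hz, rfl⟩
      refine ⟨X.tensorD J z, ?_, hφ'D z⟩
      change _ = _ at hz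
      change _ = _
      rw [liftBaseChange_tensorD hD hs, hz, map_zero]
    obtain ⟨z, hz, hz1⟩ : (1 : Fn J) ∈ 𝔞 := htop ▸ Submodule.mem_top
    replace hz : s.liftBaseChange (Fn J) z = 0 := hz
    -- Now `z` is a relation with `φ' z = 1`. Its derivative is again a relation and `φ'` sends it
    -- to `θ 1 = 0`, so it vanishes by `hker`. Thus `z` is a constant `1 ⊗ v` with `s v = 0`, and
    -- injectivity of `s` gives `z = 0`, a contradiction.
    have hDz : X.tensorD J z = 0 := by
      refine hker ?_ ?_
      · rw [liftBaseChange_tensorD hD hs, hz, map_zero]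
      · rw [hφ'D, hz1]
        simpa using Fn.theta_algebraMap (J := J) (1 : K)
    have h5 := eq_one_tmul_of_tensorD_pow_eq_zero (n := 1) (by simpa using hDz)
    rw [h5, LinearMap.liftBaseChange_tmul, one_smul] at hz
    have h6 : X.coeffMap J 0 z = 0 := hinj (by rw [hz, map_zero])
    rw [h6, TensorProduct.tmul_zero] at h5
    rw [h5, map_zero] at hz1
    have := congrArg (fun f => f.coeff 0) hz1
    simp [Fn.coeff_one] at this

end Lift

end NilpotentEnd

end RigidAnnulus

end

/-! ### Hulls of intervals, restriction of sections, and null sections of a log-module. -/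

noncomputable section

namespace RigidAnnulus

section Intervals

variable {K : Type u} [NormedField K]

/-- The smallest closed interval containing two given ones. -/
def ClosedInterval.hull (J J' : ClosedInterval K) : ClosedInterval K where
  lo := min J.lo J'.lo
  hi := max J.hi J'.hi
  lo_nonneg := le_min J.lo_nonneg J'.lo_nonneg
  lo_le_hi := (min_le_left _ _).trans (J.lo_le_hi.trans (le_max_left _ _))
  hi_lt_one := max_lt J.hi_lt_one J'.hi_lt_one
  lo_aligned := by
    rcases min_choice J.lo J'.lo with h | h <;> rw [h]
    exacts [J.lo_aligned, J'.lo_aligned]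
  hi_aligned := by
    rcases max_choice J.hi J'.hi with h | h <;> rw [h]
    exacts [J.hi_aligned, J'.hi_aligned]

lemma ClosedInterval.left_subset_hull (J J' : ClosedInterval K) :
    J.carrier ⊆ (J.hull J').carrier :=
  Icc_subset_Icc (min_le_left _ _) (le_max_left _ _)

lemma ClosedInterval.right_subset_hull (J J' : ClosedInterval K) :
    J'.carrier ⊆ (J.hull J').carrier :=
  Icc_subset_Icc (min_le_right _ _) (le_max_right _ _)

lemma ClosedInterval.lo_mem (J : ClosedInterval K) : J.lo ∈ J.carrier := ⟨le_rfl, J.lo_le_hi⟩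

lemma ClosedInterval.hull_subset {I : Set ℝ} (hI : I.OrdConnected) {J J' : ClosedInterval K}
    (hJ : J.carrier ⊆ I) (hJ' : J'.carrier ⊆ I) : (J.hull J').carrier ⊆ I := by
  refine hI.out ?_ ?_
  · rcases min_choice J.lo J'.lo with h | h
    · exact (h.symm ▸ hJ J.lo_mem : min J.lo J'.lo ∈ I)
    · exact (h.symm ▸ hJ' J'.lo_mem : min J.lo J'.lo ∈ I)
  · rcases max_choice J.hi J'.hi with h | h
    · exact (h.symm ▸ hJ J.hi_mem : max J.hi J'.hi ∈ I)
    · exact (h.symm ▸ hJ' J'.hi_mem : max J.hi J'.hi ∈ I)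

/-- The outer circle of an annulus. -/
def ClosedInterval.outer (J : ClosedInterval K) : ClosedInterval K where
  lo := J.hi
  hi := J.hi
  lo_nonneg := J.hi_pos.le
  lo_le_hi := le_rfl
  hi_lt_one := J.hi_lt_one
  lo_aligned := Or.inr J.hi_aligned
  hi_aligned := J.hi_aligned

lemma ClosedInterval.outer_subset (J : ClosedInterval K) : J.outer.carrier ⊆ J.carrier :=
  Icc_subset_Icc J.lo_le_hi le_rfl

lemma ClosedInterval.zero_notMem_outer (J : ClosedInterval K) : 0 ∉ J.outer.carrier :=
  fun h => absurd h.1 (not_le.2 J.hi_pos)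

end Intervals

variable {K : Type u} [NormedField K] [IsUltrametricDist K] [CompleteSpace K]

namespace LogNablaModule

variable {I : Set ℝ} (E : LogNablaModule K I)

instance (J : ClosedInterval K) (hJ : J.carrier ⊆ I) : Module K (E.obj J hJ) :=
  Module.compHom _ (algebraMap K (Fn J))

instance (J : ClosedInterval K) (hJ : J.carrier ⊆ I) : IsScalarTower K (Fn J) (E.obj J hJ) :=
  ⟨fun a f m => by
    rw [Algebra.smul_def, mul_smul]
    rfl⟩

/-- The action of `t d/dt` as a `K`-linear map. -/
def linD (J : ClosedInterval K) (hJ : J.carrier ⊆ I) : Module.End K (E.obj J hJ) where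
  toFun := E.D J hJ
  map_add' := map_add _
  map_smul' a m := by
    rw [← algebraMap_smul (Fn J) a m, E.leibniz, Fn.theta_algebraMap, zero_smul, zero_add,
      algebraMap_smul]
    rfl

@[simp] lemma linD_apply (J : ClosedInterval K) (hJ : J.carrier ⊆ I) (m : E.obj J hJ) :
    E.linD J hJ m = E.D J hJ m := rfl

lemma isConnection_linD (J : ClosedInterval K) (hJ : J.carrier ⊆ I) :
    IsConnection J (E.linD J hJ) := E.leibniz J hJ

variable {E} {J J' : ClosedInterval K} (hJ : J.carrier ⊆ I) (h : J'.carrier ⊆ J.carrier)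

lemma res_smul (f : Fn J) (m : E.obj J hJ) :
    E.res hJ h (f • m) = Fn.res h f • E.res hJ h m := (E.res hJ h).map_smulₛₗ f m

variable (E) in
/-- Restriction of sections as a `K`-linear map. -/
def linRes : E.obj J hJ →ₗ[K] E.obj J' (h.trans hJ) where
  toFun := E.res hJ h
  map_add' := map_add _
  map_smul' a m := by
    rw [← algebraMap_smul (Fn J) a m, res_smul, AlgHom.commutes, algebraMap_smul]
    rfl

@[simp] lemma linRes_apply (m : E.obj J hJ) : E.linRes hJ h m = E.res hJ h m := rfl

lemma linD_pow_res (n : ℕ) (m : E.obj J hJ) :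
    (E.linD J' (h.trans hJ) ^ n) (E.res hJ h m) = E.res hJ h ((E.linD J hJ ^ n) m) := by
  induction n with
  | zero => rfl
  | succ n ih =>
    rw [pow_succ', pow_succ', Module.End.mul_apply, ih, Module.End.mul_apply, linD_apply,
      E.D_res]
    rfl

/-- The universal property behind `IsBaseChangeAlong`: semilinear maps out of the sections over
`A(J)` factor through those over `A(J')`. -/
lemma exists_extend {N : Type u} [AddCommGroup N] [Module (Fn J') N]
    (g : E.obj J hJ →ₛₗ[(Fn.res h).toRingHom] N) :
    ∃ g' : E.obj J' (h.trans hJ) →ₗ[Fn J'] N, ∀ m, g' (E.res hJ h m) = g m := by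
  let _ : Algebra (Fn J) (Fn J') := (Fn.res h).toRingHom.toAlgebra
  let _ : Module (Fn J) (E.obj J' (h.trans hJ)) := Module.compHom _ (Fn.res h).toRingHom
  have : IsScalarTower (Fn J) (Fn J') (E.obj J' (h.trans hJ)) :=
    ⟨fun r s n => mul_smul (Fn.res h r) s n⟩
  let _ : Module (Fn J) N := Module.compHom _ (Fn.res h).toRingHom
  have : IsScalarTower (Fn J) (Fn J') N := ⟨fun r s n => mul_smul (Fn.res h r) s n⟩
  have hb := E.base_change hJ h
  unfold IsBaseChangeAlong at hb
  let g₀ : E.obj J hJ →ₗ[Fn J] N :=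
    { toFun := g, map_add' := g.map_add, map_smul' := g.map_smulₛₗ }
  exact ⟨IsBaseChange.lift hb g₀, fun m => IsBaseChange.lift_eq hb g₀ m⟩

variable (E) in
lemma span_range_res : Submodule.span (Fn J') (range (E.res hJ h)) = ⊤ := by
  let _ : Algebra (Fn J) (Fn J') := (Fn.res h).toRingHom.toAlgebra
  let _ : Module (Fn J) (E.obj J' (h.trans hJ)) := Module.compHom _ (Fn.res h).toRingHom
  have : IsScalarTower (Fn J) (Fn J') (E.obj J' (h.trans hJ)) :=
    ⟨fun r s n => mul_smul (Fn.res h r) s n⟩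
  have hb := E.base_change hJ h
  unfold IsBaseChangeAlong at hb
  refine eq_top_iff.2 fun x _ => ?_
  refine IsBaseChange.inductionOn hb x (fun x => x ∈ Submodule.span (Fn J') (range (E.res hJ h)))
    (Submodule.zero_mem _) (fun m => Submodule.subset_span ⟨m, rfl⟩)
    (fun s n hn => Submodule.smul_mem _ s hn) (fun a b ha hb => Submodule.add_mem _ ha hb)

variable (E) in
/-- The sections over `A(J)` embed into a free module. -/
lemma exists_embedding (J : ClosedInterval K) (hJ : J.carrier ⊆ I) :
    ∃ (n : ℕ) (ι : E.obj J hJ →ₗ[Fn J] Fin n → Fn J) (π : (Fin n → Fn J) →ₗ[Fn J] E.obj J hJ),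
      π ∘ₗ ι = LinearMap.id := by
  have := E.finite J hJ
  have := E.projective J hJ
  obtain ⟨n, π, hπ⟩ := Module.Finite.exists_fin' (Fn J) (E.obj J hJ)
  obtain ⟨ι, hι⟩ := Module.projective_lifting_property π LinearMap.id hπ
  exact ⟨n, ι, π, hι⟩

/-- An embedding of the sections over `A(J)` into a free module extends to `A(J')`. -/
lemma exists_extend_embedding {n : ℕ} {ι : E.obj J hJ →ₗ[Fn J] Fin n → Fn J}
    {π : (Fin n → Fn J) →ₗ[Fn J] E.obj J hJ} (hπι : π ∘ₗ ι = LinearMap.id) :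
    ∃ (ι' : E.obj J' (h.trans hJ) →ₗ[Fn J'] Fin n → Fn J')
      (π' : (Fin n → Fn J') →ₗ[Fn J'] E.obj J' (h.trans hJ)),
      π' ∘ₗ ι' = LinearMap.id ∧ ∀ m k, ι' (E.res hJ h m) k = Fn.res h (ι m k) := by
  let g : E.obj J hJ →ₛₗ[(Fn.res h).toRingHom] (Fin n → Fn J') :=
    { toFun := fun m k => Fn.res h (ι m k)
      map_add' := fun m m' => by ext1 k; simp
      map_smul' := fun f m => by ext1 k; simp }
  obtain ⟨ι', hι'⟩ := exists_extend hJ h g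
  let π' : (Fin n → Fn J') →ₗ[Fn J'] E.obj J' (h.trans hJ) :=
    Fintype.linearCombination (Fn J') fun k => E.res hJ h (π (Pi.single k 1))
  refine ⟨ι', π', ?_, fun m k => congrFun (hι' m) k⟩
  refine LinearMap.ext_on (span_range_res E hJ h) ?_
  rintro _ ⟨m, rfl⟩
  have h1 : π (ι m) = m := LinearMap.congr_fun hπι m
  rw [LinearMap.comp_apply, hι', LinearMap.id_apply, Fintype.linearCombination_apply]
  conv_rhs => rw [← h1, pi_eq_sum_univ' (ι m), map_sum, map_sum]
  refine Finset.sum_congr rfl fun k _ => ?_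
  rw [map_smul, res_smul]
  rfl

variable (E) in
-- Projectivity embeds the sections into a free module, compatibly with restriction, and a series
-- keeps its coefficients when restricted. This makes extensions of null sections to larger annuli
-- unique.
lemma res_injective : Function.Injective (E.res hJ h) := by
  rw [injective_iff_map_eq_zero]
  intro m hm
  obtain ⟨n, ι, π, hπι⟩ := E.exists_embedding J hJ
  obtain ⟨ι', -, -, hι'⟩ := exists_extend_embedding hJ h hπι
  have h1 : ι m = 0 := by
    ext1 k
    apply Fn.res_injective h
    rw [← hι', hm, map_zero, Pi.zero_apply, Pi.zero_apply, map_zero]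
  rw [← LinearMap.id_apply (R := Fn J) m, ← hπι, LinearMap.comp_apply, h1, map_zero]

variable (E) in
/-- The sections over `A(J)` killed by a power of `t d/dt`. -/
def null (J : ClosedInterval K) (hJ : J.carrier ⊆ I) : Submodule K (E.obj J hJ) where
  carrier := {m | ∃ n, (E.linD J hJ ^ n) m = 0}
  zero_mem' := ⟨0, map_zero _⟩
  add_mem' := by
    rintro a b ⟨n, hn⟩ ⟨k, hk⟩
    have ha : (E.linD J hJ ^ (n + k)) a = 0 := by
      rw [add_comm, pow_add, Module.End.mul_apply, hn, map_zero]
    have hb : (E.linD J hJ ^ (n + k)) b = 0 := by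
      rw [pow_add, Module.End.mul_apply, hk, map_zero]
    exact ⟨n + k, by rw [map_add, ha, hb, add_zero]⟩
  smul_mem' := by
    rintro a m ⟨n, hn⟩
    exact ⟨n, by rw [map_smul, hn, smul_zero]⟩

lemma mem_null {m : E.obj J hJ} : m ∈ E.null J hJ ↔ ∃ n, (E.linD J hJ ^ n) m = 0 := Iff.rfl

lemma res_mem_null {m : E.obj J hJ} (hm : m ∈ E.null J hJ) :
    E.res hJ h m ∈ E.null J' (h.trans hJ) := by
  obtain ⟨n, hn⟩ := hm
  exact ⟨n, by rw [linD_pow_res, hn, map_zero]⟩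

lemma D_mem_null {m : E.obj J hJ} (hm : m ∈ E.null J hJ) : E.D J hJ m ∈ E.null J hJ := by
  obtain ⟨n, hn⟩ := hm
  refine ⟨n, ?_⟩
  rw [← linD_apply, ← Module.End.mul_apply, ← pow_succ, pow_succ', Module.End.mul_apply, hn,
    map_zero]

variable (E) in
/-- The sections killed by powers of `t d/dt` generate the sheaf. -/
def IsSpannedByNull : Prop :=
  ∀ J hJ, Submodule.span (Fn J) (E.null J hJ : Set (E.obj J hJ)) = ⊤

end LogNablaModule

end RigidAnnulus

end

/-! ### Modules generated by null sections come from nilpotent endomorphisms; full faithfulness. -/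

noncomputable section

namespace RigidAnnulus

variable {K : Type u} [NormedField K] [IsUltrametricDist K] [CompleteSpace K]

namespace LogNablaModule

variable {I : Set ℝ} {E F : LogNablaModule K I}

/-- A morphism which is bijective on sections is an isomorphism. -/
def isoOfBijective (f : E ⟶ F) (hf : ∀ J hJ, Function.Bijective (f.app J hJ)) : E ≅ F where
  hom := f
  inv :=
    { app := fun J hJ => (LinearEquiv.ofBijective (f.app J hJ) (hf J hJ)).symm
      app_res := fun {J J'} hJ h m => by
        obtain ⟨m, rfl⟩ := (hf J hJ).2 m
        apply (hf J' (h.trans hJ)).1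
        rw [f.app_res]
        simp only [LinearEquiv.coe_coe, LinearEquiv.ofBijective_symm_apply_apply]
        rw [← f.app_res]
        exact (LinearEquiv.ofBijective (f.app J' _) (hf J' _)).apply_symm_apply _
      app_D := fun J hJ m => by
        obtain ⟨m, rfl⟩ := (hf J hJ).2 m
        rw [← f.app_D]
        simp only [LinearEquiv.coe_coe, LinearEquiv.ofBijective_symm_apply_apply] }
  hom_inv_id := hom_ext fun J hJ => LinearMap.ext fun m =>
    (LinearEquiv.ofBijective (f.app J hJ) (hf J hJ)).symm_apply_apply m
  inv_hom_id := hom_ext fun J hJ => LinearMap.ext fun m =>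
    (LinearEquiv.ofBijective (f.app J hJ) (hf J hJ)).apply_symm_apply m

variable {J J' : ClosedInterval K} (hJ : J.carrier ⊆ I) (h : J'.carrier ⊆ J.carrier)

/-- Finitely many null sections already generate, and each has only finitely many nonzero iterates
under `t d/dt`. All these iterates span a finite dimensional stable space on which `t d/dt` is
nilpotent. -/
lemma exists_nilpotentEnd_of_span_null
    (hspan : Submodule.span (Fn J) (E.null J hJ : Set (E.obj J hJ)) = ⊤) :
    ∃ (X : NilpotentEnd K) (s : X.V →ₗ[K] E.obj J hJ), Function.Injective s ∧
      (∀ v, s (X.N v) = E.D J hJ (s v)) ∧ Submodule.span (Fn J) (range s) = ⊤ := by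
  have := E.finite J hJ
  have hfg : (Submodule.span (Fn J) (E.null J hJ : Set (E.obj J hJ))).FG :=
    hspan ▸ Module.Finite.fg_top
  obtain ⟨T, hT, hTspan⟩ := (Submodule.fg_span_iff_fg_span_finset_subset _).1 hfg
  choose! k hk using fun v (hv : v ∈ T) => mem_null hJ |>.1 (hT hv)
  set n := T.sup k + 1 with hn
  let D := E.linD J hJ
  have hDn {v} (hv : v ∈ T) {j : ℕ} (hj : T.sup k ≤ j) : (D ^ j) v = 0 := by
    have h1 : k v ≤ j := (Finset.le_sup hv).trans hj
    rw [← Nat.sub_add_cancel h1, pow_add, Module.End.mul_apply, hk v hv, map_zero]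
  let S : Set (E.obj J hJ) := (fun p : E.obj J hJ × ℕ => (D ^ p.2) p.1) ''
    (T ×ˢ Finset.range n : Finset (E.obj J hJ × ℕ))
  let W := Submodule.span K S
  have hS (v) (hv : v ∈ T) (j : ℕ) : (D ^ j) v ∈ W := by
    rcases lt_or_ge j n with hj | hj
    · exact Submodule.subset_span ⟨(v, j), by simp [hv, hj], rfl⟩
    · rw [hDn hv (by omega)]
      exact W.zero_mem
  have hW : ∀ x ∈ W, D x ∈ W := by
    intro x hx
    induction hx using Submodule.span_induction with
    | mem x hx =>
      obtain ⟨⟨v, j⟩, hvj, rfl⟩ := hx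
      simp only [Finset.coe_product, Finset.coe_range, mem_prod, Finset.mem_coe] at hvj
      rw [← Module.End.mul_apply, ← pow_succ']
      exact hS v hvj.1 _
    | zero => rw [map_zero]; exact W.zero_mem
    | add x y _ _ hx hy => rw [map_add]; exact W.add_mem hx hy
    | smul a x _ hx => rw [map_smul]; exact W.smul_mem a hx
  have hnil : ∀ x ∈ W, (D ^ n) x = 0 := by
    intro x hx
    induction hx using Submodule.span_induction with
    | mem x hx =>
      obtain ⟨⟨v, j⟩, hvj, rfl⟩ := hx
      simp only [Finset.coe_product, Finset.coe_range, mem_prod, Finset.mem_coe] at hvj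
      rw [← Module.End.mul_apply, ← pow_add]
      exact hDn hvj.1 (by omega)
    | zero => exact map_zero _
    | add x y _ _ hx hy => rw [map_add, hx, hy, add_zero]
    | smul a x _ hx => rw [map_smul, hx, smul_zero]
  have hfin : FiniteDimensional K W :=
    FiniteDimensional.span_of_finite K ((Finset.finite_toSet _).image _)
  refine ⟨{ V := W, N := D.restrict hW, nilpotent := ⟨n, ?_⟩ }, W.subtype, Subtype.val_injective,
    fun v => rfl, ?_⟩
  · refine LinearMap.ext fun v => Subtype.ext ?_
    rw [Module.End.pow_restrict]
    exact hnil v.1 v.2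
  · rw [eq_top_iff, ← hspan, hTspan]
    refine Submodule.span_mono fun v hv => ⟨⟨v, ?_⟩, rfl⟩
    simpa using hS v hv 0

lemma linRes_comm {X : NilpotentEnd K} {s : X.V →ₗ[K] E.obj J hJ}
    (hs : ∀ v, s (X.N v) = E.D J hJ (s v)) (v : X.V) :
    (E.linRes hJ h ∘ₗ s) (X.N v) = E.D J' (h.trans hJ) ((E.linRes hJ h ∘ₗ s) v) := by
  simp only [LinearMap.comp_apply, hs, linRes_apply, E.D_res]

/-- Independence was proved for `0 ∉ J` only. A disc is reduced to its outer circle, to which both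
`R_J ⊗ V` and the sections of `E` restrict injectively. -/
lemma liftBaseChange_injective [CharZero K] {X : NilpotentEnd K} {s : X.V →ₗ[K] E.obj J hJ}
    (hinj : Function.Injective s) (hs : ∀ v, s (X.N v) = E.D J hJ (s v)) :
    Function.Injective (s.liftBaseChange (Fn J)) := by
  have ho := J.outer_subset
  have h1 : Function.Injective ((E.linRes hJ ho ∘ₗ s).liftBaseChange (Fn J.outer)) :=
    NilpotentEnd.liftBaseChange_injective J.zero_notMem_outer (E.isConnection_linD _ _)
      (linRes_comm hJ ho hs) ((E.res_injective hJ ho).comp hinj)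
  have h2 (z) : (E.linRes hJ ho ∘ₗ s).liftBaseChange (Fn J.outer) (X.tensorRes ho z) =
      E.res hJ ho (s.liftBaseChange (Fn J) z) := by
    induction z with
    | zero => simp only [map_zero]
    | add x y hx hy => simp only [map_add, hx, hy]
    | tmul f v =>
      rw [NilpotentEnd.tensorRes_tmul, LinearMap.liftBaseChange_tmul,
        LinearMap.liftBaseChange_tmul, res_smul]
      rfl
  have h3 : Function.Injective (X.tensorRes ho) := by
    rw [injective_iff_map_eq_zero]
    intro z hz
    refine NilpotentEnd.tensor_ext fun i => ?_
    have h4 : X.coeffMap J i z = X.coeffMap J.outer i (X.tensorRes ho z) := by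
      clear hz
      induction z with
      | zero => simp only [map_zero]
      | add x y hx hy => simp only [map_add, hx, hy]
      | tmul f v => rfl
    rw [h4, hz, map_zero]
  intro z w hzw
  exact h3 (h1 (by rw [h2, h2, hzw]))

lemma liftBaseChange_surjective {X : NilpotentEnd K} {s : X.V →ₗ[K] E.obj J hJ}
    (hspan : Submodule.span (Fn J) (range s) = ⊤) :
    Function.Surjective (s.liftBaseChange (Fn J)) := by
  rw [← LinearMap.range_eq_top, eq_top_iff, ← hspan, Submodule.span_le]
  rintro _ ⟨v, rfl⟩
  exact ⟨1 ⊗ₜ v, by simp⟩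

/-- Under the horizontal isomorphism between `R_J ⊗ V` and the sections, a null section corresponds
to a null element of `R_J ⊗ V`, hence to some `1 ⊗ v`. -/
lemma exists_eq_of_mem_null [CharZero K] {X : NilpotentEnd K} {s : X.V →ₗ[K] E.obj J hJ}
    (hs : ∀ v, s (X.N v) = E.D J hJ (s v)) (hinj : Function.Injective s)
    (hspan : Submodule.span (Fn J) (range s) = ⊤) {m : E.obj J hJ} (hm : m ∈ E.null J hJ) :
    ∃ v, s v = m := by
  obtain ⟨n, hn⟩ := hm
  obtain ⟨z, rfl⟩ := liftBaseChange_surjective hJ hspan m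
  have h1 (n : ℕ) : s.liftBaseChange (Fn J) ((X.tensorD J ^ n) z) =
      (E.linD J hJ ^ n) (s.liftBaseChange (Fn J) z) := by
    induction n with
    | zero => rfl
    | succ n ih =>
      rw [pow_succ', pow_succ', Module.End.mul_apply, Module.End.mul_apply, ← ih]
      exact NilpotentEnd.liftBaseChange_tensorD (E.isConnection_linD J hJ) hs _
  have h2 : (X.tensorD J ^ n) z = 0 :=
    liftBaseChange_injective hJ hinj hs (by rw [h1, hn, map_zero])
  have h3 := NilpotentEnd.eq_one_tmul_of_tensorD_pow_eq_zero h2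
  refine ⟨X.coeffMap J 0 z, ?_⟩
  conv_rhs => rw [h3]
  simp

lemma span_range_linRes {X : NilpotentEnd K} {s : X.V →ₗ[K] E.obj J hJ}
    (hspan : Submodule.span (Fn J) (range s) = ⊤) :
    Submodule.span (Fn J') (range (E.linRes hJ h ∘ₗ s)) = ⊤ := by
  rw [eq_top_iff, ← E.span_range_res hJ h, Submodule.span_le]
  rintro _ ⟨m, rfl⟩
  have hm : m ∈ Submodule.span (Fn J) (range s) := hspan ▸ Submodule.mem_top
  induction hm using Submodule.span_induction with
  | mem x hx =>
    obtain ⟨v, rfl⟩ := hx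
    exact Submodule.subset_span ⟨v, rfl⟩
  | zero => rw [map_zero]; exact Submodule.zero_mem _
  | add x y _ _ hx hy => rw [map_add]; exact Submodule.add_mem _ hx hy
  | smul a x _ hx => rw [res_smul]; exact Submodule.smul_mem _ _ hx

/-- Sections killed by powers of `t d/dt` extend to larger annuli. -/
lemma exists_mem_null_res_eq [CharZero K]
    (hspan : Submodule.span (Fn J) (E.null J hJ : Set (E.obj J hJ)) = ⊤)
    {m : E.obj J' (h.trans hJ)} (hm : m ∈ E.null J' (h.trans hJ)) :
    ∃ m' ∈ E.null J hJ, E.res hJ h m' = m := by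
  obtain ⟨X, s, hinj, hs, hsspan⟩ := exists_nilpotentEnd_of_span_null hJ hspan
  -- The restriction of `s` to `A(J')` is still injective with generating image, so its image
  -- contains every null section there, and `s` itself supplies the extension.
  obtain ⟨v, hv⟩ := exists_eq_of_mem_null (h.trans hJ) (linRes_comm hJ h hs)
    ((E.res_injective hJ h).comp hinj) (span_range_linRes hJ h hsspan) hm
  refine ⟨s v, ?_, hv⟩
  obtain ⟨n, hn⟩ := X.nilpotent
  have h1 (n : ℕ) : (E.linD J hJ ^ n) (s v) = s ((X.N ^ n) v) := by
    induction n with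
    | zero => rfl
    | succ n ih =>
      rw [pow_succ', pow_succ', Module.End.mul_apply, Module.End.mul_apply, ih, hs, linD_apply]
  exact ⟨n, by rw [h1, hn, LinearMap.zero_apply, map_zero]⟩

/-- A log-`∇`-module generated by sections killed by powers of `t d/dt` comes from a vector space
with a nilpotent endomorphism. -/
theorem exists_iso_toLogNabla [CharZero K] (hI : I.OrdConnected) {J₀ : ClosedInterval K}
    (hJ₀ : J₀.carrier ⊆ I) (hE : E.IsSpannedByNull) :
    ∃ X : NilpotentEnd K, Nonempty ((NilpotentEnd.toLogNabla I).obj X ≅ E) := by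
  obtain ⟨X, s₀, hinj₀, hs₀, hspan₀⟩ := exists_nilpotentEnd_of_span_null hJ₀ (hE J₀ hJ₀)
  have hnull (v : X.V) : s₀ v ∈ E.null J₀ hJ₀ := by
    obtain ⟨n, hn⟩ := X.nilpotent
    have h1 (n : ℕ) : (E.linD J₀ hJ₀ ^ n) (s₀ v) = s₀ ((X.N ^ n) v) := by
      induction n with
      | zero => rfl
      | succ n ih =>
        rw [pow_succ', pow_succ', Module.End.mul_apply, Module.End.mul_apply, ih, hs₀, linD_apply]
    exact ⟨n, by rw [h1, hn, LinearMap.zero_apply, map_zero]⟩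
  have hl (J : ClosedInterval K) := J₀.left_subset_hull J
  have hr (J : ClosedInterval K) := J₀.right_subset_hull J
  have hh {J : ClosedInterval K} (hJ : J.carrier ⊆ I) := ClosedInterval.hull_subset hI hJ₀ hJ
  -- The space `V` found over `J₀` is transported to any `J` through the hull of the two intervals:
  -- its elements extend uniquely to the hull, and are then restricted to `J`.
  have hex (J : ClosedInterval K) (hJ : J.carrier ⊆ I) (v : X.V) :=
    exists_mem_null_res_eq (hh hJ) (hl J) (hE _ (hh hJ)) (hnull v)
  choose g hg hg' using hex
  have huniq {J : ClosedInterval K} (hJ : J.carrier ⊆ I) {v : X.V} {m}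
      (hm : E.res (hh hJ) (hl J) m = s₀ v) : g J hJ v = m :=
    E.res_injective (hh hJ) (hl J) ((hg' J hJ v).trans hm.symm)
  let s (J : ClosedInterval K) (hJ : J.carrier ⊆ I) : X.V →ₗ[K] E.obj J hJ :=
    E.linRes (hh hJ) (hr J) ∘ₗ
      { toFun := g J hJ
        map_add' := fun v w => huniq hJ (by rw [map_add, hg', hg', map_add])
        map_smul' := fun a v => huniq hJ (by
          rw [← linRes_apply, map_smul, linRes_apply, hg', map_smul]
          rfl) }
  have hs (J : ClosedInterval K) (hJ : J.carrier ⊆ I) (v : X.V) :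
      s J hJ (X.N v) = E.D J hJ (s J hJ v) := by
    have h1 : g J hJ (X.N v) = E.D _ _ (g J hJ v) := huniq hJ (by rw [← E.D_res, hg', hs₀])
    change E.res _ _ (g J hJ (X.N v)) = E.D J hJ (E.res _ _ (g J hJ v))
    rw [h1, E.D_res]
  have hginj (J : ClosedInterval K) (hJ : J.carrier ⊆ I) : Function.Injective (g J hJ) :=
    fun v w hvw => hinj₀ (by rw [← hg' J hJ v, hvw, hg'])
  have hsinj (J : ClosedInterval K) (hJ : J.carrier ⊆ I) : Function.Injective (s J hJ) :=
    (E.res_injective _ _).comp (hginj J hJ)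
  have hsurj (J : ClosedInterval K) (hJ : J.carrier ⊆ I) :
      Submodule.span (Fn J) (range (s J hJ)) = ⊤ := by
    rw [eq_top_iff, ← hE J hJ]
    refine Submodule.span_mono fun m hm => ?_
    obtain ⟨m', hm', rfl⟩ := exists_mem_null_res_eq (hh hJ) (hr J) (hE _ (hh hJ)) hm
    obtain ⟨v, hv⟩ := exists_eq_of_mem_null hJ₀ hs₀ hinj₀ hspan₀ (res_mem_null (hh hJ) (hl J) hm')
    exact ⟨v, congrArg (E.res _ _) (huniq hJ hv.symm)⟩
  -- For `J' ⊆ J` the hulls with `J₀` are nested, and uniqueness of extensions identifies the two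
  -- transported sections.
  have hres {J J' : ClosedInterval K} (hJ : J.carrier ⊆ I) (h : J'.carrier ⊆ J.carrier) (v : X.V) :
      E.res hJ h (s J hJ v) = s J' (h.trans hJ) v := by
    have hsub : (J₀.hull J').carrier ⊆ (J₀.hull J).carrier :=
      Icc_subset_Icc (min_le_min le_rfl (h J'.lo_mem).1) (max_le_max le_rfl (h J'.hi_mem).2)
    have h1 : g J' (h.trans hJ) v = E.res (hh hJ) hsub (g J hJ v) :=
      huniq _ (by rw [E.res_res, hg'])
    change E.res hJ h (E.res _ _ (g J hJ v)) = E.res _ _ (g J' _ v)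
    rw [h1, E.res_res, E.res_res]
  refine ⟨X, ⟨isoOfBijective
    { app := fun J hJ => (s J hJ).liftBaseChange (Fn J)
      app_res := fun {J J'} hJ h m => ?_
      app_D := fun J hJ m =>
        NilpotentEnd.liftBaseChange_tensorD (E.isConnection_linD J hJ) (hs J hJ) m }
    fun J hJ => ⟨liftBaseChange_injective hJ (hsinj J hJ) (hs J hJ),
      liftBaseChange_surjective hJ (hsurj J hJ)⟩⟩⟩
  change (s J' _).liftBaseChange (Fn J') (X.tensorRes h m) =
    E.res hJ h ((s J hJ).liftBaseChange (Fn J) m)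
  change Fn J ⊗[K] X.V at m
  induction m with
  | zero => simp only [map_zero]
  | add x y hx hy => simp only [map_add, hx, hy]
  | tmul f v =>
    rw [NilpotentEnd.tensorRes_tmul, LinearMap.liftBaseChange_tmul,
      LinearMap.liftBaseChange_tmul, res_smul, hres]

end LogNablaModule

namespace NilpotentEnd

variable {I : Set ℝ}

lemma toLogNabla_faithful {J₀ : ClosedInterval K} (hJ₀ : J₀.carrier ⊆ I) :
    (toLogNabla (K := K) I).Faithful where
  map_injective {X Y} f g hfg := by
    refine Hom.ext (LinearMap.ext fun v => one_tmul_injective (J := J₀) Y ?_)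
    exact congrArg (fun φ => LogNablaModule.Hom.app φ J₀ hJ₀ ((1 : Fn J₀) ⊗ₜ[K] v)) hfg

/-- A horizontal morphism sends null elements to null elements, that is, constants to constants, so
over each `A(J)` it comes from a map `V → W`. Comparison on the hull with `J₀` shows that this map
does not depend on `J`. -/
lemma toLogNabla_full [CharZero K] (hI : I.OrdConnected) {J₀ : ClosedInterval K}
    (hJ₀ : J₀.carrier ⊆ I) : (toLogNabla (K := K) I).Full where
  map_surjective {X Y} φ := by
    let ψ (J : ClosedInterval K) (hJ : J.carrier ⊆ I) : Fn J ⊗[K] X.V →ₗ[Fn J] Fn J ⊗[K] Y.V :=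
      LogNablaModule.Hom.app φ J hJ
    have hψD (J hJ) (m) : ψ J hJ (X.tensorD J m) = Y.tensorD J (ψ J hJ m) :=
      LogNablaModule.Hom.app_D φ J hJ m
    have hψres {J J' : ClosedInterval K} (hJ : J.carrier ⊆ I) (h : J'.carrier ⊆ J.carrier) (m) :
        ψ J' (h.trans hJ) (X.tensorRes h m) = Y.tensorRes h (ψ J hJ m) :=
      LogNablaModule.Hom.app_res φ hJ h m
    have hψpow (J hJ) (n : ℕ) (m) : ψ J hJ ((X.tensorD J ^ n) m) =
        (Y.tensorD J ^ n) (ψ J hJ m) := by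
      induction n with
      | zero => rfl
      | succ n ih =>
        rw [pow_succ', pow_succ', Module.End.mul_apply, Module.End.mul_apply, hψD, ih]
    have hex (J hJ) (v : X.V) : ∃ w : Y.V, ψ J hJ (1 ⊗ₜ v) = 1 ⊗ₜ w := by
      obtain ⟨n, hn⟩ := X.nilpotent
      refine ⟨_, eq_one_tmul_of_tensorD_pow_eq_zero (n := n) ?_⟩
      rw [← hψpow, tensorD_pow_one_tmul, hn, LinearMap.zero_apply, TensorProduct.tmul_zero,
        map_zero]
    choose g hg using hex
    have huniq {J hJ} {v : X.V} {w : Y.V} (hw : ψ J hJ (1 ⊗ₜ v) = 1 ⊗ₜ w) : g J hJ v = w :=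
      one_tmul_injective (J := J) Y ((hg J hJ v).symm.trans hw)
    have hgres {J J' : ClosedInterval K} (hJ : J.carrier ⊆ I) (h : J'.carrier ⊆ J.carrier) (v) :
        g J' (h.trans hJ) v = g J hJ v := by
      refine huniq ?_
      have h1 := hψres hJ h (1 ⊗ₜ v)
      rwa [tensorRes_tmul, map_one, hg J hJ, tensorRes_tmul, map_one] at h1
    have hgconst {J : ClosedInterval K} (hJ : J.carrier ⊆ I) (v) : g J hJ v = g J₀ hJ₀ v := by
      have hh := ClosedInterval.hull_subset hI hJ₀ hJ
      rw [hgres hh (J₀.right_subset_hull J), ← hgres hh (J₀.left_subset_hull J)]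
    let f : Hom X Y :=
      { toLin :=
          { toFun := g J₀ hJ₀
            map_add' := fun v w => huniq (by
              rw [TensorProduct.tmul_add, map_add, hg, hg, TensorProduct.tmul_add])
            map_smul' := fun a v => huniq (by
              rw [RingHom.id_apply, TensorProduct.tmul_smul, TensorProduct.tmul_smul,
                ← algebraMap_smul (Fn J₀) a, ← algebraMap_smul (Fn J₀) a, map_smul, hg]) }
        comm := fun v => huniq (by
          have h1 := hψpow J₀ hJ₀ 1 (1 ⊗ₜ v)
          rw [tensorD_pow_one_tmul, hg _ _ v, tensorD_pow_one_tmul, pow_one, pow_one] at h1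
          exact h1) }
    refine ⟨f, LogNablaModule.hom_ext fun J hJ => ?_⟩
    change tensorMap f J = ψ J hJ
    refine LinearMap.ext fun m => ?_
    induction m with
    | zero => simp only [map_zero]
    | add x y hx hy => simp only [map_add, hx, hy]
    | tmul a v =>
      have h1 : (a ⊗ₜ[K] v : Fn J ⊗[K] X.V) = a • (1 ⊗ₜ v) := by
        rw [TensorProduct.smul_tmul', smul_eq_mul, mul_one]
      rw [h1, map_smul, map_smul, hg, hgconst]
      rfl

end NilpotentEnd

end RigidAnnulus

end

/-! ### Density of `Γ*`, the size of `1 / i`, and primitives on smaller annuli. -/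

noncomputable section

namespace RigidAnnulus

section ResidueCharacteristic

/-- The divisible closure of the value group is dense in the positive reals. -/
lemma exists_mem_valueGroup {K : Type u} [NormedField K] {p : ℕ} [hpp : Fact p.Prime]
    (hp : ‖(p : K)‖ = (p : ℝ)⁻¹) {a b : ℝ} (ha : 0 ≤ a) (hab : a < b) :
    ∃ r ∈ valueGroup K, a < r ∧ r < b := by
  have hp1 : (1 : ℝ) < p := by exact_mod_cast hpp.out.one_lt
  have hp0 : (0 : ℝ) < p := zero_lt_one.trans hp1
  have hb : 0 < b := ha.trans_lt hab
  obtain ⟨c, hac, hcb⟩ := exists_between hab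
  have hc : 0 < c := ha.trans_lt hac
  obtain ⟨q, hcq, hqb⟩ := exists_rat_btwn (Real.logb_lt_logb hp1 hc hcb)
  -- For `q = num / den` the `den`-th power of `p ^ q` is `p ^ num`, the norm of `p ^ (-num)`; the
  -- sign comes from `|p| = 1 / p`.
  refine ⟨(p : ℝ) ^ (q : ℝ), ⟨Real.rpow_pos_of_pos hp0 _, q.den, q.den_pos,
    (p : K) ^ (-q.num), ?_, ?_⟩, hac.trans ((Real.logb_lt_iff_lt_rpow hp1 hc).1 hcq),
    (Real.lt_logb_iff_rpow_lt hp1 hb).1 hqb⟩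
  · have : (p : K) ≠ 0 := fun h0 => by
      rw [h0, norm_zero] at hp
      exact (inv_pos.2 hp0).ne hp
    exact zpow_ne_zero _ this
  · rw [norm_zpow, hp, inv_zpow, zpow_neg, inv_inv, ← Real.rpow_natCast, ← Real.rpow_mul hp0.le,
      ← Real.rpow_intCast]
    congr 1
    exact_mod_cast Rat.mul_den_eq_num q

variable {K : Type u} [NormedField K] [IsUltrametricDist K]

/-- Bézout writes `1 = p a + m b` with integers `a`, `b`. Since `|p a| < 1`, the ultrametric
inequality forces `|m b| ≥ 1`. -/
lemma norm_natCast_eq_one_of_coprime {p : ℕ} (hp1 : ‖(p : K)‖ < 1) {m : ℕ}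
    (hm : p.Coprime m) : ‖(m : K)‖ = 1 := by
  refine le_antisymm (IsUltrametricDist.norm_natCast_le_one K m) ?_
  by_contra! hlt
  have h1 : ((p : K) * (p.gcdA m : K) + (m : K) * (p.gcdB m : K)) = 1 := by
    have := Nat.gcd_eq_gcd_ab p m
    rw [hm] at this
    exact_mod_cast congrArg (Int.cast : ℤ → K) this.symm
  have h2 := IsUltrametricDist.norm_add_le_max ((p : K) * (p.gcdA m : K)) ((m : K) * (p.gcdB m : K))
  rw [h1, norm_one, norm_mul, norm_mul] at h2
  have h3 := mul_le_of_le_one_right (norm_nonneg (p : K))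
    (IsUltrametricDist.norm_intCast_le_one K (p.gcdA m))
  have h4 := mul_le_of_le_one_right (norm_nonneg (m : K))
    (IsUltrametricDist.norm_intCast_le_one K (p.gcdB m))
  rcases le_max_iff.1 h2 with h | h <;> linarith

variable {p : ℕ} [hpp : Fact p.Prime] (hp : ‖(p : K)‖ = (p : ℝ)⁻¹)
include hp

/-- If `p ^ e` is the exact power of `p` in `n`, then `|n|⁻¹ = p ^ e ≤ n`. Dividing by integers thus
costs only polynomial growth, both for primitives and for the coefficients of binomial polynomials.
-/
lemma norm_natCast_inv_le {n : ℕ} (hn : n ≠ 0) : ‖(n : K)‖⁻¹ ≤ n := by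
  have hp0 : (0 : ℝ) < p := by exact_mod_cast hpp.out.pos
  have hp1 : ‖(p : K)‖ < 1 := hp ▸ inv_lt_one_of_one_lt₀ (by exact_mod_cast hpp.out.one_lt)
  obtain ⟨e, m, hm, rfl⟩ := Nat.exists_eq_pow_mul_and_not_dvd hn p hpp.out.ne_one
  have hm1 := norm_natCast_eq_one_of_coprime hp1 ((Nat.Prime.coprime_iff_not_dvd hpp.out).2 hm)
  have hm0 : 1 ≤ m := Nat.one_le_iff_ne_zero.2 fun h => hm (h ▸ dvd_zero p)
  rw [Nat.cast_mul, Nat.cast_pow, norm_mul, norm_pow, hm1, hp, mul_one, inv_pow, inv_inv]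
  push_cast
  exact le_mul_of_one_le_right (pow_nonneg hp0.le _) (by exact_mod_cast hm0)

lemma norm_intCast_inv_le {i : ℤ} (hi : i ≠ 0) : ‖(i : K)‖⁻¹ ≤ i.natAbs := by
  have h1 : ‖(i : K)‖ = ‖(i.natAbs : K)‖ := by
    rcases i.natAbs_eq with h | h
    · conv_lhs => rw [h, Int.cast_natCast]
    · conv_lhs => rw [h, Int.cast_neg, norm_neg, Int.cast_natCast]
  rw [h1]
  exact norm_natCast_inv_le hp (Int.natAbs_ne_zero.2 hi)

end ResidueCharacteristic

section Primitive

variable {K : Type u} [NormedField K] [IsUltrametricDist K]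

lemma tendsto_natAbs_cofinite : Tendsto Int.natAbs cofinite atTop := by
  rw [← Nat.cofinite_eq_atTop]
  refine Tendsto.cofinite_of_finite_preimage_singleton fun n => ?_
  refine (Set.finite_Icc (-(n : ℤ)) n).subset fun i hi => ?_
  have : i.natAbs = n := hi
  exact ⟨by omega, by omega⟩

variable {p : ℕ} [hpp : Fact p.Prime] (hp : ‖(p : K)‖ = (p : ℝ)⁻¹)
include hp

/-- Passing strictly inside gains `q ^ |i|` with `q < 1`, where `r / J.hi` serves the positive
exponents and `J.lo / r` the negative ones. This beats the factor `|i| ^ k` lost to the division. -/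
lemma Fn.converges_div_pow [CompleteSpace K] [CharZero K] {J J' : ClosedInterval K}
    (h0 : 0 < J.lo) (hlo : J.lo < J'.lo) (hhi : J'.hi < J.hi) (k : ℕ) (f : Fn J) :
    Converges J' fun i => if i = 0 then 0 else f.coeff i / (i : K) ^ k := by
  have hlo' : 0 < J'.lo := h0.trans hlo
  refine ⟨fun r hr => ?_, fun h => absurd h.1 (not_le.2 hlo')⟩
  have hr0 : 0 < r := hlo'.trans_le hr.1
  set q := max (r / J.hi) (J.lo / r) with hq
  have hq0 : 0 ≤ q := (div_pos hr0 J.hi_pos).le.trans (le_max_left _ _)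
  have hq1 : q < 1 := max_lt ((div_lt_one J.hi_pos).2 (hr.2.trans_lt hhi))
    ((div_lt_one hr0).2 (hlo.trans_le hr.1))
  have hlim := ((tendsto_pow_const_mul_const_pow_of_lt_one k hq0 hq1).comp
    tendsto_natAbs_cofinite).const_mul ‖f‖
  rw [mul_zero] at hlim
  refine squeeze_zero (fun i => mul_nonneg (norm_nonneg _) (zpow_nonneg hr0.le _)) (fun i => ?_)
    hlim
  simp only [Function.comp]
  split_ifs with hi
  · rw [norm_zero, zero_mul]
    positivity
  · have h1 : r ^ i ≤ weight J i * q ^ i.natAbs := by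
      rcases le_or_gt 0 i with h | h
      · lift i to ℕ using h
        rw [Int.natAbs_natCast]
        calc r ^ (i : ℤ) = J.hi ^ (i : ℤ) * (r / J.hi) ^ i := by
              rw [zpow_natCast, zpow_natCast, ← mul_pow, mul_div_cancel₀ _ J.hi_pos.ne']
          _ ≤ _ := mul_le_mul (le_max_right _ _)
              (pow_le_pow_left₀ (div_pos hr0 J.hi_pos).le (le_max_left _ _) _)
              (pow_nonneg (div_pos hr0 J.hi_pos).le _) (weight_pos _).le
      · obtain ⟨n, rfl⟩ : ∃ n : ℕ, i = -n := ⟨i.natAbs, by omega⟩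
        rw [Int.natAbs_neg, Int.natAbs_natCast]
        calc r ^ (-(n : ℤ)) = J.lo ^ (-(n : ℤ)) * (J.lo / r) ^ n := by
              rw [zpow_neg, zpow_neg, zpow_natCast, zpow_natCast, div_pow]
              field_simp
          _ ≤ _ := mul_le_mul (le_max_left _ _)
              (pow_le_pow_left₀ (div_pos h0 hr0).le (le_max_right _ _) _)
              (pow_nonneg (div_pos h0 hr0).le _) (weight_pos _).le
    have h2 : ‖f.coeff i / (i : K) ^ k‖ ≤ ‖f.coeff i‖ * (i.natAbs : ℝ) ^ k := by
      rw [norm_div, norm_pow, div_eq_mul_inv, ← inv_pow]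
      gcongr
      exact norm_intCast_inv_le hp hi
    calc ‖f.coeff i / (i : K) ^ k‖ * r ^ i
        ≤ (‖f.coeff i‖ * (i.natAbs : ℝ) ^ k) * (weight J i * q ^ i.natAbs) :=
          mul_le_mul h2 h1 (zpow_nonneg hr0.le _) (by positivity)
      _ = (‖f.coeff i‖ * weight J i) * ((i.natAbs : ℝ) ^ k * q ^ i.natAbs) := by ring
      _ ≤ _ := mul_le_mul_of_nonneg_right (f.coeff_weight_le i) (by positivity)

variable [CompleteSpace K] [CharZero K] {J J' : ClosedInterval K}

/-- The `k`-th iterated primitive `∑ c_i t^i ↦ ∑_{i ≠ 0} (c_i / i^k) t^i` with respect to `t d/dt`,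
which converges on smaller annuli. -/
def Fn.primitive (h0 : 0 < J.lo) (hlo : J.lo < J'.lo) (hhi : J'.hi < J.hi) (k : ℕ) :
    Fn J →ₗ[K] Fn J' where
  toFun f := mk _ (converges_div_pow hp h0 hlo hhi k f)
  map_add' f g := by
    ext i
    simp only [coeff_mk, coeff_add]
    split_ifs
    · simp
    · rw [add_div]
  map_smul' a f := by
    ext i
    simp only [coeff_mk, coeff_smul, RingHom.id_apply]
    split_ifs
    · simp
    · rw [mul_div_assoc]

lemma Fn.coeff_primitive (h0 : 0 < J.lo) (hlo : J.lo < J'.lo) (hhi : J'.hi < J.hi) (k : ℕ)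
    (f : Fn J) (i : ℤ) : (primitive hp h0 hlo hhi k f).coeff i =
      if i = 0 then 0 else f.coeff i / (i : K) ^ k := rfl

lemma Fn.theta_primitive_succ (h0 : 0 < J.lo) (hlo : J.lo < J'.lo) (hhi : J'.hi < J.hi) (k : ℕ)
    (f : Fn J) : theta J' (primitive hp h0 hlo hhi (k + 1) f) = primitive hp h0 hlo hhi k f := by
  ext i
  rw [coeff_theta, coeff_primitive, coeff_primitive]
  split_ifs with hi
  · simp
  · have : (i : K) ≠ 0 := Int.cast_ne_zero.2 hi
    field_simp
    ring

/-- After shrinking the annulus, every element of `R ⊗ V` is a constant modulo the image of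
`t d/dt`. -/
lemma NilpotentEnd.exists_eq_tensorD_add (h0 : 0 < J.lo) (hlo : J.lo < J'.lo) (hhi : J'.hi < J.hi)
    (h : J'.carrier ⊆ J.carrier) (X : NilpotentEnd K) (z : Fn J ⊗[K] X.V) :
    ∃ (y : Fn J' ⊗[K] X.V) (c : X.V), X.tensorRes h z = X.tensorD J' y + 1 ⊗ₜ c := by
  let T := Fn.primitive hp h0 hlo hhi
  -- The formal inverse of `θ + N` is `∑ (-1)^k θ^(-k-1) N^k`, a finite sum as `N` is nilpotent. `B
  -- k` is its `k`-th term without sign, and applying `t d/dt` to the alternating sum telescopes.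
  let A (k : ℕ) := TensorProduct.map (T k) (X.N ^ k) z
  let B (k : ℕ) := TensorProduct.map (T (k + 1)) (X.N ^ k) z
  have hB (k : ℕ) : X.tensorD J' (B k) = A k + A (k + 1) := by
    simp only [A, B]
    clear A B
    induction z with
    | zero => simp
    | add x y hx hy =>
      simp only [map_add, hx, hy]
      abel
    | tmul f v =>
      simp only [TensorProduct.map_tmul, tensorD_tmul, T, Fn.theta_primitive_succ]
      rw [pow_succ', Module.End.mul_apply]
  have hsum (n : ℕ) : X.tensorD J' (∑ k ∈ Finset.range n, (-1 : K) ^ k • B k) =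
      A 0 - (-1 : K) ^ n • A n := by
    induction n with
    | zero => simp
    | succ n ih =>
      rw [Finset.sum_range_succ, map_add, ih, map_smul, hB, smul_add, pow_succ]
      module
  obtain ⟨n, hn⟩ := X.nilpotent
  have hAn : A n = 0 := by simp [A, hn]
  -- The primitive of order `0` also drops the constant coefficient, which `θ` cannot reach; this is
  -- where the constant `1 ⊗ c` comes from.
  have hA0 : A 0 = X.tensorRes h z - 1 ⊗ₜ X.coeffMap J 0 z := by
    simp only [A]
    clear hAn hsum hB A B
    induction z with
    | zero => simp only [map_zero, TensorProduct.tmul_zero, sub_zero]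
    | add x y hx hy =>
      simp only [map_add, hx, hy, TensorProduct.tmul_add]
      abel
    | tmul f v =>
      rw [TensorProduct.map_tmul, pow_zero, Module.End.one_apply, tensorRes_tmul, coeffMap_tmul,
        ← TensorProduct.smul_tmul, ← TensorProduct.sub_tmul]
      congr 1
      ext i
      rw [Fn.coeff_primitive, Fn.coeff_sub, Fn.coeff_res, Fn.coeff_smul, Fn.coeff_one]
      split_ifs with hi <;> simp [hi]
  refine ⟨∑ k ∈ Finset.range n, (-1 : K) ^ k • B k, X.coeffMap J 0 z, ?_⟩
  rw [hsum n, hAn, hA0, smul_zero, sub_zero, sub_add_cancel]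

end Primitive

end RigidAnnulus

end

/-! ### Unipotent modules on open annuli. -/

noncomputable section

namespace RigidAnnulus

/-- The strict room on both sides is what allows integration on the larger annulus with a result
that converges on `A(J)`. -/
lemma exists_larger_interval {K : Type u} [NormedField K] {p : ℕ} [hpp : Fact p.Prime] (hp : ‖(p : K)‖ = (p : ℝ)⁻¹)
    {I : Set ℝ} (hI : I ⊆ Ioo 0 1) (hconn : I.OrdConnected) (hopen : IsOpen I)
    {J : ClosedInterval K} (hJ : J.carrier ⊆ I) :
    ∃ J' : ClosedInterval K, J'.carrier ⊆ I ∧ 0 < J'.lo ∧ J'.lo < J.lo ∧ J.hi < J'.hi := by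
  obtain ⟨ε, hε, hlo⟩ := Metric.isOpen_iff.1 hopen _ (hJ J.lo_mem)
  obtain ⟨δ, hδ, hhi⟩ := Metric.isOpen_iff.1 hopen _ (hJ J.hi_mem)
  have hlo0 : 0 < J.lo := (hI (hJ J.lo_mem)).1
  obtain ⟨a, ha, ha1, ha2⟩ := exists_mem_valueGroup hp (le_max_right (J.lo - ε) 0)
    (max_lt (sub_lt_self _ hε) hlo0)
  obtain ⟨b, hb, hb1, hb2⟩ := exists_mem_valueGroup hp J.hi_pos.le (lt_add_of_pos_right J.hi hδ)
  have haI : a ∈ I := hlo (by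
    rw [Metric.mem_ball, Real.dist_eq, abs_lt]
    constructor <;> linarith [(le_max_left _ _).trans_lt ha1])
  have hbI : b ∈ I := hhi (by
    rw [Metric.mem_ball, Real.dist_eq, abs_lt]
    constructor <;> linarith)
  exact ⟨{ lo := a, hi := b, lo_nonneg := (hI haI).1.le,
           lo_le_hi := (ha2.trans_le (J.lo_le_hi.trans hb1.le)).le, hi_lt_one := (hI hbI).2,
           lo_aligned := Or.inr ha, hi_aligned := hb }, hconn.out haI hbI, (hI haI).1, ha2, hb1⟩

variable {K : Type u} [NormedField K] [IsUltrametricDist K] [CompleteSpace K]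

namespace LogNablaModule

variable {I : Set ℝ} {E : LogNablaModule K I}

lemma app_mem_null {E F : LogNablaModule K I} (f : E ⟶ F) {J : ClosedInterval K}
    {hJ : J.carrier ⊆ I} {m : E.obj J hJ} (hm : m ∈ E.null J hJ) :
    f.app J hJ m ∈ F.null J hJ := by
  obtain ⟨n, hn⟩ := hm
  have h1 (n : ℕ) : (F.linD J hJ ^ n) (f.app J hJ m) = f.app J hJ ((E.linD J hJ ^ n) m) := by
    induction n with
    | zero => rfl
    | succ n ih =>
      rw [pow_succ', pow_succ', Module.End.mul_apply, Module.End.mul_apply, ih, linD_apply,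
        linD_apply, f.app_D]
  exact ⟨n, by rw [h1, hn, map_zero]⟩

lemma mem_null_of_D_mem_null {J : ClosedInterval K} {hJ : J.carrier ⊆ I} {m : E.obj J hJ}
    (hm : E.D J hJ m ∈ E.null J hJ) : m ∈ E.null J hJ := by
  obtain ⟨n, hn⟩ := hm
  exact ⟨n + 1, by rw [pow_succ, Module.End.mul_apply, linD_apply, hn]⟩

/-- Unipotent `∇`-modules on open annuli are generated by sections killed by powers of `t d/dt`. -/
theorem IsUnipotent.isSpannedByNull [CharZero K] {p : ℕ} [Fact p.Prime]
    (hp : ‖(p : K)‖ = (p : ℝ)⁻¹) (hI : I ⊆ Ioo 0 1) (hconn : I.OrdConnected) (hopen : IsOpen I)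
    (hE : E.IsUnipotent) : E.IsSpannedByNull := by
  induction hE with
  | zero E h =>
    intro J hJ
    have := h J hJ
    exact Subsingleton.elim _ _
  | @extension E' E E'' i q inj exact surj hE' hE'' ih =>
    intro J hJ
    obtain ⟨n, e, hres, hhor, hspan⟩ := hE''
    obtain ⟨J', hJ', h0, hlo, hhi⟩ := exists_larger_interval hp hI hconn hopen hJ
    have h : J.carrier ⊆ J'.carrier := Icc_subset_Icc hlo.le hhi.le
    -- A horizontal section of `E''` is lifted to `m` over the larger annulus. Its derivative lies
    -- in `E'`, which by induction is generated by null sections, so over `A(J)` it is `D y` plus a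
    -- null section with `y` in `E'`. Then `m - y` has null derivative, hence is null, and it has
    -- the same image in `E''`.
    have hlift (k : Fin n) : ∃ m ∈ E.null J hJ, q.app J hJ m = e k J hJ := by
      obtain ⟨m, hm⟩ := surj J' hJ' (e k J' hJ')
      obtain ⟨x, hx⟩ := (exact J' hJ' (E.D J' hJ' m)).1 (by rw [q.app_D, hm, hhor])
      obtain ⟨X, s, -, hs, hsspan⟩ := exists_nilpotentEnd_of_span_null hJ' (ih J' hJ')
      obtain ⟨z, rfl⟩ := liftBaseChange_surjective hJ' hsspan x
      obtain ⟨y, c, hyc⟩ := X.exists_eq_tensorD_add hp h0 hlo hhi h z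
      set s' := E'.linRes hJ' h ∘ₗ s with hs'
      have h2 (z) : s'.liftBaseChange (Fn J) (X.tensorRes h z) =
          E'.res hJ' h (s.liftBaseChange (Fn J') z) := by
        induction z with
        | zero => simp only [map_zero]
        | add x y hx hy => simp only [map_add, hx, hy]
        | tmul f v =>
          rw [NilpotentEnd.tensorRes_tmul, LinearMap.liftBaseChange_tmul,
            LinearMap.liftBaseChange_tmul, res_smul]
          rfl
      have hc : s' c ∈ E'.null J hJ := by
        obtain ⟨n, hn⟩ := X.nilpotent
        have h1 (n : ℕ) : (E'.linD J hJ ^ n) (s' c) = s' ((X.N ^ n) c) := by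
          induction n with
          | zero => rfl
          | succ n ih =>
            rw [pow_succ', pow_succ', Module.End.mul_apply, Module.End.mul_apply, ih,
              hs', linRes_comm hJ' h hs, linD_apply]
        exact ⟨n, by rw [h1, hn, LinearMap.zero_apply, map_zero]⟩
      refine ⟨E.res hJ' h m - i.app J hJ (s'.liftBaseChange (Fn J) y),
        mem_null_of_D_mem_null ?_, ?_⟩
      · have h3 := NilpotentEnd.liftBaseChange_tensorD (E'.isConnection_linD J hJ)
          (linRes_comm hJ' h hs) y
        rw [linD_apply] at h3
        rw [map_sub, E.D_res, ← hx, ← i.app_D, ← i.app_res, ← map_sub, ← h2, hyc, map_add, h3,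
          add_sub_cancel_left, LinearMap.liftBaseChange_tmul, one_smul]
        exact app_mem_null i hc
      · rw [map_sub, (exact J hJ _).2 ⟨_, rfl⟩, sub_zero, q.app_res, hm, hres]
    choose m hm hqm using hlift
    rw [eq_top_iff]
    intro x _
    have hqx : q.app J hJ x ∈ Submodule.span (Fn J) (range fun k => e k J hJ) :=
      hspan J hJ ▸ Submodule.mem_top
    obtain ⟨f, hf⟩ := (Submodule.mem_span_range_iff_exists_fun _).1 hqx
    obtain ⟨y, hy⟩ := (exact J hJ (x - ∑ k, f k • m k)).1 (by
      rw [map_sub, map_sum, ← hf, sub_eq_zero]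
      exact Finset.sum_congr rfl fun k _ => by rw [map_smul, hqm])
    rw [← sub_add_cancel x (∑ k, f k • m k), ← hy]
    refine Submodule.add_mem _ ?_ (Submodule.sum_mem _ fun k _ =>
      Submodule.smul_mem _ _ (Submodule.subset_span (hm k)))
    have hy' : y ∈ Submodule.span (Fn J) (E'.null J hJ : Set (E'.obj J hJ)) :=
      ih J hJ ▸ Submodule.mem_top
    clear hy
    induction hy' using Submodule.span_induction with
    | mem y hy => exact Submodule.subset_span (app_mem_null i hy)
    | zero => rw [map_zero]; exact Submodule.zero_mem _
    | add a b _ _ ha hb => rw [map_add]; exact Submodule.add_mem _ ha hb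
    | smul a b _ hb => rw [map_smul]; exact Submodule.smul_mem _ _ hb

lemma IsUnipotent.restrict {I' : Set ℝ} (h : I' ⊆ I) (hE : E.IsUnipotent) :
    ((LogNablaModule.restrict h).obj E).IsUnipotent := by
  induction hE with
  | zero E hE => exact .zero _ fun J hJ => hE J (hJ.trans h)
  | @extension E' E E'' i q inj exact surj hE' hE'' ih =>
    refine .extension ((LogNablaModule.restrict h).map i) ((LogNablaModule.restrict h).map q)
      (fun J hJ => inj J (hJ.trans h)) (fun J hJ => exact J (hJ.trans h))
      (fun J hJ => surj J (hJ.trans h)) ih ?_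
    obtain ⟨n, e, hres, hhor, hspan⟩ := hE''
    exact ⟨n, fun k J hJ => e k J (hJ.trans h), fun k J J' hJ => hres k J J' (hJ.trans h),
      fun k J hJ => hhor k J (hJ.trans h), fun J hJ => hspan J (hJ.trans h)⟩

end LogNablaModule

namespace NilpotentEnd

variable {I : Set ℝ}

/-- A functional vanishing on the image of `N` exhibits `V` as an extension of `K`, with zero
endomorphism, by the smaller space `ker φ`. Tensoring with `R_J` over the field `K` keeps this
exact, and induction on the dimension finishes. -/
lemma isUnipotent_toLogNabla (X : NilpotentEnd K) :
    ((toLogNabla I).obj X).IsUnipotent := by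
  induction hn : Module.finrank K X.V using Nat.strong_induction_on generalizing X with
  | _ n ih =>
  subst hn
  rcases subsingleton_or_nontrivial X.V with hV | hV
  · exact .zero _ fun J hJ => inferInstanceAs (Subsingleton (Fn J ⊗[K] X.V))
  obtain ⟨φ, hφ0, hφ⟩ := exists_functional_of_isNilpotent X.nilpotent
  let X' := X.sub (LinearMap.ker φ) fun v _ => hφ v
  let Y : NilpotentEnd K := { V := K, N := 0, nilpotent := IsNilpotent.zero }
  let i : X' ⟶ X := (⟨(LinearMap.ker φ).subtype, fun _ => rfl⟩ : Hom X' X)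
  let q : X ⟶ Y := (⟨φ, fun v => hφ v⟩ : Hom X Y)
  have hsurj : Function.Surjective φ := LinearMap.surjective hφ0
  have hexact : Function.Exact (LinearMap.ker φ).subtype φ := fun v =>
    ⟨fun hv => ⟨⟨v, hv⟩, rfl⟩, fun ⟨w, hw⟩ => hw ▸ w.2⟩
  refine .extension ((toLogNabla I).map i) ((toLogNabla I).map q)
    (fun J hJ => Module.Flat.lTensor_preserves_injective_linearMap (M := Fn J)
      (LinearMap.ker φ).subtype Subtype.val_injective)
    (fun J hJ => lTensor_exact (Fn J) hexact hsurj)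
    (fun J hJ => LinearMap.lTensor_surjective (Fn J) hsurj)
    (ih _ ?_ X' rfl) ⟨1, fun _ J _ => (1 : Fn J) ⊗ₜ[K] (1 : K), ?_, ?_, ?_⟩
  · exact Submodule.finrank_lt fun htop => hφ0 (LinearMap.ker_eq_top.1 htop)
  · intro k J J' hJ h
    rfl
  · intro k J hJ
    have := tensorD_pow_one_tmul (J := J) Y 1 (1 : K)
    rw [pow_one, pow_one] at this
    exact this.trans (TensorProduct.tmul_zero _ _)
  · intro J hJ
    rw [eq_top_iff]
    rintro z -
    change Fn J ⊗[K] K at z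
    induction z with
    | zero => exact Submodule.zero_mem _
    | add x y hx hy => exact Submodule.add_mem _ hx hy
    | tmul f a =>
      have h1 : (f ⊗ₜ[K] a : Fn J ⊗[K] K) = (a • f) • ((1 : Fn J) ⊗ₜ[K] (1 : K)) := by
        rw [TensorProduct.smul_tmul', smul_eq_mul, mul_one, TensorProduct.smul_tmul, smul_eq_mul,
          mul_one]
      rw [h1]
      exact Submodule.smul_mem _ _ (Submodule.subset_span ⟨0, rfl⟩)

end NilpotentEnd

end RigidAnnulus

end

/-! ### Binomial coefficients as polynomials and the growth of their coefficients. -/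

noncomputable section

namespace RigidAnnulus

section ChoosePoly

open Polynomial

variable (K : Type u) [Field K]

/-- The binomial coefficient `X (X - 1) ⋯ (X - n + 1) / n!` as a polynomial. -/
def choosePoly (n : ℕ) : K[X] := C (n.factorial : K)⁻¹ * descPochhammer K n

lemma natDegree_choosePoly_le (n : ℕ) : (choosePoly K n).natDegree ≤ n :=
  (natDegree_C_mul_le _ _).trans (descPochhammer_natDegree K n).le

lemma aeval_descPochhammer {A : Type*} [Ring A] [Algebra K A] (a : A) (n : ℕ) :
    aeval a (descPochhammer K n) = (descPochhammer ℤ n).smeval a := by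
  rw [← descPochhammer_map (algebraMap ℤ K), aeval_map_algebraMap, aeval_eq_smeval]

lemma aeval_apply_of_comm {M M' : Type*} [AddCommGroup M] [Module K M] [AddCommGroup M']
    [Module K M'] {D : Module.End K M} {D' : Module.End K M'} (g : M →ₗ[K] M')
    (hg : ∀ m, g (D m) = D' (g m)) (P : K[X]) (m : M) :
    g (aeval D P m) = aeval D' P (g m) := by
  induction P using Polynomial.induction_on' with
  | add P Q hP hQ => simp only [map_add, LinearMap.add_apply, hP, hQ]
  | monomial n a =>
    simp only [aeval_monomial, Module.End.mul_apply, Module.algebraMap_end_apply, map_smul]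
    congr 1
    induction n with
    | zero => rfl
    | succ n ih => rw [pow_succ', pow_succ', Module.End.mul_apply, Module.End.mul_apply, hg, ih]

variable [CharZero K]

/-- Each factor `X - j` with `j ≥ 1` is `-j (1 - X / j)`. The formula carries coefficient bounds
from `binomPoly` over to `choosePoly`. -/
lemma choosePoly_succ (n : ℕ) :
    choosePoly K (n + 1) = C ((-1) ^ n * (n + 1 : K)⁻¹) * (X * binomPoly K n) := by
  induction n with
  | zero => simp [choosePoly, binomPoly_zero]
  | succ n ih =>
    have hn : (n + 1 : K) ≠ 0 := by exact_mod_cast n.succ_ne_zero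
    have hn' : ((n + 1 : ℕ) + 1 : K) ≠ 0 := by exact_mod_cast (n + 1).succ_ne_zero
    have h1 : choosePoly K (n + 1 + 1) =
        choosePoly K (n + 1) * (C (((n + 1 : ℕ) + 1 : K)⁻¹) * (X - C (n + 1 : K))) := by
      simp only [choosePoly]
      rw [descPochhammer_succ_right K (n + 1), Nat.factorial_succ (n + 1), Nat.cast_mul, mul_inv,
        C_mul]
      simp only [Nat.cast_add, Nat.cast_one, map_add, map_natCast, map_one]
      ring
    have h2 : (X - C (n + 1 : K)) = C (-(n + 1 : K)) * (1 - C ((n + 1 : K)⁻¹) * X) := by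
      rw [mul_sub, ← mul_assoc, ← C_mul, neg_mul, mul_inv_cancel₀ hn]
      simp only [map_neg, map_one]
      ring
    have h3 : (-1) ^ n * (n + 1 : K)⁻¹ * (((n + 1 : ℕ) + 1 : K)⁻¹ * -(n + 1 : K)) =
        (-1) ^ (n + 1) * ((n + 1 : ℕ) + 1 : K)⁻¹ := by
      rw [pow_succ]
      field_simp
    rw [h1, ih, h2, binomPoly_succ, ← h3]
    simp only [C_mul]
    ring

lemma eval_choosePoly_intCast (n : ℕ) (i : ℤ) : ∃ z : ℤ, (choosePoly K n).eval (i : K) = z := by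
  refine ⟨Ring.choose i n, ?_⟩
  have h1 := Ring.descPochhammer_eq_factorial_smul_choose i n
  have hn : (n.factorial : K) ≠ 0 := by exact_mod_cast n.factorial_ne_zero
  have h2 : (descPochhammer K n).eval (i : K) = ((descPochhammer ℤ n).smeval i : ℤ) := by
    rw [← eval_eq_smeval, ← descPochhammer_map (Int.castRingHom K), eval_intCast_map]
    simp
  rw [choosePoly, eval_mul, eval_C, h2, h1, nsmul_eq_mul, Int.cast_mul, Int.cast_natCast,
    inv_mul_cancel_left₀ hn]

lemma eval_choosePoly_natCast (n k : ℕ) : (choosePoly K n).eval (k : K) = k.choose n := by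
  have hn : (n.factorial : K) ≠ 0 := by exact_mod_cast n.factorial_ne_zero
  rw [choosePoly, eval_mul, eval_C, descPochhammer_eval_eq_descFactorial,
    Nat.descFactorial_eq_factorial_mul_choose, Nat.cast_mul, inv_mul_cancel_left₀ hn]

/-- The Vandermonde identity for commuting elements of an algebra. -/
lemma aeval_choosePoly_add {A : Type*} [Ring A] [Algebra K A] {a b : A} (h : Commute a b) (n : ℕ) :
    aeval (a + b) (choosePoly K n) = ∑ ij ∈ Finset.HasAntidiagonal.antidiagonal n,
      aeval a (choosePoly K ij.1) * aeval b (choosePoly K ij.2) := by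
  simp only [choosePoly, map_mul, aeval_C, aeval_descPochhammer]
  rw [Ring.descPochhammer_smeval_add n h, Finset.mul_sum]
  refine Finset.sum_congr rfl fun ij hij => ?_
  have h1 := Nat.choose_mul_factorial_mul_factorial (Finset.HasAntidiagonal.antidiagonal.fst_le hij)
  rw [tsub_eq_of_eq_add_rev (Finset.HasAntidiagonal.mem_antidiagonal.1 hij).symm] at h1
  have hn (n : ℕ) : (n.factorial : K) ≠ 0 := by exact_mod_cast n.factorial_ne_zero
  have h2 : (n.factorial : K)⁻¹ * (n.choose ij.1 : K) =
      (ij.1.factorial : K)⁻¹ * (ij.2.factorial : K)⁻¹ := by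
    rw [← h1, Nat.cast_mul, Nat.cast_mul]
    have h3 : (n.choose ij.1 : K) ≠ 0 := by
      exact_mod_cast (Nat.choose_pos (Finset.HasAntidiagonal.antidiagonal.fst_le hij)).ne'
    field_simp [hn ij.1, hn ij.2]
  have h3 : ((n.choose ij.1 : ℕ) : A) = algebraMap K A (n.choose ij.1 : K) := by simp
  rw [h3]
  simp only [← Algebra.smul_def, smul_smul, smul_mul_smul_comm, h2]

end ChoosePoly

section Growth

open Polynomial

variable {K : Type u} [NormedField K] [IsUltrametricDist K] {p : ℕ} [hpp : Fact p.Prime]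
  (hp : ‖(p : K)‖ = (p : ℝ)⁻¹)
include hp

/-- Up to sign, the coefficient of `X ^ k` is a sum of products of `k` inverses `1 / j` with `j ≤
n`, each of norm at most `n`. For fixed `k` the growth in `n` is polynomial, which suffices for a
nilpotent endomorphism. -/
lemma norm_coeff_binomPoly_le [CharZero K] (n k : ℕ) :
    ‖(binomPoly K n).coeff k‖ ≤ ((n + 1 : ℕ) : ℝ) ^ k := by
  induction n generalizing k with
  | zero =>
    rw [binomPoly_zero, coeff_one]
    split_ifs <;> simp
  | succ n ih =>
    have hle : ((n + 1 : ℕ) : ℝ) ≤ (n + 1 + 1 : ℕ) := by exact_mod_cast (n + 1).le_succ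
    rw [binomPoly_succ, mul_sub, mul_one, coeff_sub, sub_eq_add_neg]
    refine (IsUltrametricDist.norm_add_le_max _ _).trans (max_le ?_ ?_)
    · exact (ih k).trans (pow_le_pow_left₀ (by positivity) hle k)
    · rw [norm_neg, mul_left_comm, coeff_C_mul]
      cases k with
      | zero => simp
      | succ k =>
        rw [coeff_mul_X, norm_mul, norm_inv, pow_succ']
        refine mul_le_mul ?_ ((ih k).trans (pow_le_pow_left₀ (by positivity) hle k))
          (norm_nonneg _) (by positivity)
        exact_mod_cast (norm_natCast_inv_le hp n.succ_ne_zero).trans hle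

lemma norm_coeff_choosePoly_le [CharZero K] (n k : ℕ) :
    ‖(choosePoly K n).coeff k‖ ≤ ((n + 1 : ℕ) : ℝ) ^ k := by
  cases n with
  | zero =>
    have : choosePoly K 0 = 1 := by simp [choosePoly]
    rw [this, coeff_one]
    split_ifs <;> simp
  | succ n =>
    have hle : ((n + 1 : ℕ) : ℝ) ≤ (n + 1 + 1 : ℕ) := by exact_mod_cast (n + 1).le_succ
    rw [choosePoly_succ, coeff_C_mul]
    cases k with
    | zero => simp
    | succ k =>
      rw [coeff_X_mul, norm_mul, norm_mul, norm_pow, norm_neg, norm_one, one_pow, one_mul,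
        norm_inv, pow_succ']
      refine mul_le_mul ?_ ((norm_coeff_binomPoly_le hp n k).trans
        (pow_le_pow_left₀ (by positivity) hle k)) (norm_nonneg _) (by positivity)
      exact_mod_cast (norm_natCast_inv_le hp n.succ_ne_zero).trans hle

end Growth

end RigidAnnulus

end

/-! ### `O ⊗ V` has nilpotent residue and is overconvergent. -/

noncomputable section

namespace RigidAnnulus

open Polynomial

variable {K : Type u} [NormedField K] [IsUltrametricDist K] {J : ClosedInterval K}

namespace Fn

lemma norm_tInv_le (h : 0 ∉ J.carrier) : ‖tInv h‖ ≤ J.lo⁻¹ := by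
  have hlo : 0 < J.lo := J.lo_nonneg.lt_of_ne' fun h0 => h (zero_mem_carrier_iff.2 h0)
  refine norm_le fun i => ?_
  rw [tInv, coeff_monomial]
  split_ifs with hi
  · rw [hi, norm_one, one_mul, weight, zpow_neg_one, zpow_neg_one]
    exact max_le le_rfl (inv_anti₀ hlo J.lo_le_hi)
  · simpa using hlo.le

lemma norm_t_le : ‖(t : Fn J)‖ ≤ J.hi := by
  refine norm_le fun i => ?_
  rw [t, coeff_monomial]
  split_ifs with hi
  · rw [hi, norm_one, one_mul, weight, zpow_one, zpow_one]
    exact max_le J.lo_le_hi le_rfl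
  · simpa using J.hi_pos.le

end Fn

variable [CompleteSpace K]

instance : NormOneClass (Fn J) where
  norm_one := by
    refine le_antisymm (Fn.norm_le fun i => ?_) ?_
    · rw [Fn.coeff_one]
      split_ifs with h
      · rw [h, norm_one, weight_zero, mul_one]
      · simp
    · have := Fn.coeff_weight_le (1 : Fn J) 0
      rwa [Fn.coeff_one, if_pos rfl, norm_one, weight_zero, mul_one] at this

namespace Fn

lemma theta_tInv (h : 0 ∉ J.carrier) : theta J (tInv h) = -tInv h := by
  ext i
  rw [coeff_theta, coeff_neg, tInv, coeff_monomial]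
  split_ifs with hi <;> simp [hi]

lemma theta_tInv_pow (h : 0 ∉ J.carrier) (n : ℕ) :
    theta J (tInv h ^ n) = -((n : K) • tInv h ^ n) := by
  induction n with
  | zero => simpa using theta_algebraMap (J := J) (1 : K)
  | succ n ih =>
    rw [pow_succ, theta_mul, ih, theta_tInv, Nat.cast_succ, add_smul, one_smul, neg_mul,
      smul_mul_assoc]
    ring

/-- Integer valued polynomials in `θ` do not increase the norm. -/
lemma norm_aeval_theta_le {P : K[X]} (hP : ∀ i : ℤ, ‖P.eval (i : K)‖ ≤ 1) (f : Fn J) :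
    ‖aeval (theta J) P f‖ ≤ ‖f‖ := by
  refine norm_le fun i => ?_
  rw [coeff_aeval_theta, norm_mul]
  exact (mul_le_mul_of_nonneg_right (mul_le_of_le_one_left (norm_nonneg _) (hP i))
    (weight_pos i).le).trans (coeff_weight_le f i)

end Fn

section Connection

variable {M : Type*} [AddCommGroup M] [Module K M] [Module (Fn J) M] {D : Module.End K M}

lemma exists_pow_apply_t_smul (hD : IsConnection J D) (n : ℕ) (m : M) :
    ∃ y, (D ^ n) ((Fn.t : Fn J) • m) = (Fn.t : Fn J) • y := by
  induction n with
  | zero => exact ⟨m, rfl⟩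
  | succ n ih =>
    obtain ⟨y, hy⟩ := ih
    exact ⟨y + D y, by rw [pow_succ', Module.End.mul_apply, hy, hD, Fn.theta_t, smul_add]⟩

variable [IsScalarTower K (Fn J) M]

/-- The iterates of `d/dt = t⁻¹ (t d/dt)`. -/
lemma iterate_ddt (hD : IsConnection J D) (h : 0 ∉ J.carrier) (n : ℕ) (m : M) :
    (fun m => Fn.tInv h • D m)^[n] m = Fn.tInv h ^ n • aeval D (descPochhammer K n) m := by
  induction n with
  | zero => simp
  | succ n ih =>
    rw [Function.iterate_succ_apply', ih, hD, Fn.theta_tInv_pow, descPochhammer_succ_right,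
      mul_comm, map_mul, Module.End.mul_apply, pow_succ', mul_smul, map_sub, aeval_X,
      LinearMap.sub_apply, map_natCast, Module.End.natCast_apply, smul_sub, neg_smul, smul_assoc,
      Nat.cast_smul_eq_nsmul, smul_comm (Fn.tInv h ^ n) n, neg_add_eq_sub, smul_sub]

/-- This turns overconvergence into a growth condition on binomial coefficients in `t d/dt`, the
power of `t⁻¹` being harmless near the outer boundary. -/
lemma inv_factorial_smul_iterate_ddt (hD : IsConnection J D) (h : 0 ∉ J.carrier) (n : ℕ) (m : M) :
    algebraMap K (Fn J) (n.factorial : K)⁻¹ • (fun m => Fn.tInv h • D m)^[n] m =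
      Fn.tInv h ^ n • aeval D (choosePoly K n) m := by
  rw [iterate_ddt hD, choosePoly, map_mul, aeval_C, Module.End.mul_apply,
    Module.algebraMap_end_apply, smul_comm, algebraMap_smul]

end Connection

namespace NilpotentEnd

/-- On a disc `f = f(0) + t g`. The constant part is killed by `N ^ n = 0`, and multiples of `t`
remain multiples of `t` under `t d/dt`. -/
lemma exists_tensorD_pow_eq_t_smul (X : NilpotentEnd K) (h0 : 0 ∈ J.carrier) {n : ℕ}
    (hn : X.N ^ n = 0) (z : Fn J ⊗[K] X.V) :
    ∃ y, (X.tensorD J ^ n) z = (Fn.t : Fn J) • y := by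
  induction z with
  | zero => exact ⟨0, by simp⟩
  | add x y hx hy =>
    obtain ⟨x', hx'⟩ := hx
    obtain ⟨y', hy'⟩ := hy
    exact ⟨x' + y', by rw [map_add, hx', hy', smul_add]⟩
  | tmul f v =>
    obtain ⟨g, hg⟩ := Fn.exists_eq_t_pow_mul h0 1 (f - algebraMap K (Fn J) (f.coeff 0)) (by
      intro i hi
      rw [Fn.coeff_sub, Fn.coeff_algebraMap]
      split_ifs with hi0
      · rw [hi0, sub_self]
      · rw [f.converges.2 h0 i (by omega), sub_zero])
    have hf : f ⊗ₜ[K] v = 1 ⊗ₜ (f.coeff 0 • v) + (Fn.t : Fn J) • (g ⊗ₜ[K] v) := by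
      rw [TensorProduct.smul_tmul', smul_eq_mul, ← pow_one Fn.t, ← hg, TensorProduct.sub_tmul,
        Algebra.algebraMap_eq_smul_one, TensorProduct.smul_tmul, add_sub_cancel]
    rw [hf, map_add, tensorD_pow_one_tmul, hn, LinearMap.zero_apply, TensorProduct.tmul_zero,
      zero_add]
    exact exists_pow_apply_t_smul X.isConnection_tensorD n _

end NilpotentEnd

lemma LogNablaModule.residue_pow_mk {I : Set ℝ} (E : LogNablaModule K I) (hJ : J.carrier ⊆ I)
    (n : ℕ) (m : E.obj J hJ) :
    (E.residue J hJ ^ n) (QuotientAddGroup.mk m) = QuotientAddGroup.mk ((E.D J hJ)^[n] m) := by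
  induction n with
  | zero => rfl
  | succ n ih =>
    rw [pow_succ', Function.iterate_succ_apply']
    exact congrArg (E.residue J hJ) ih

namespace NilpotentEnd

lemma hasNilpotentResidue_toLogNabla {I : Set ℝ} (X : NilpotentEnd K) :
    ((toLogNabla I).obj X).HasNilpotentResidue := by
  intro J hJ h0
  obtain ⟨n, hn⟩ := X.nilpotent
  refine ⟨n, ?_⟩
  ext m
  obtain ⟨m, rfl⟩ := QuotientAddGroup.mk_surjective m
  rw [LogNablaModule.residue_pow_mk]
  refine (QuotientAddGroup.eq_zero_iff _).2 ?_
  obtain ⟨y, hy⟩ := X.exists_tensorD_pow_eq_t_smul h0 hn m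
  rw [Module.End.coe_pow] at hy
  exact ⟨y, hy.symm⟩

/-- Vandermonde's identity splits the binomial coefficients of `θ + N`. Those of `θ` do not increase
norms, being integer valued, and those of the nilpotent `N` grow polynomially. The factor `t^(-j)`
costs at most `r^(-j)`, so any `r` between `η` and `1` leaves a polynomial times `(η / r)^j`. -/
lemma isOverconvergent_toLogNabla [CharZero K] {p : ℕ} [hpp : Fact p.Prime]
    (hp : ‖(p : K)‖ = (p : ℝ)⁻¹) (X : NilpotentEnd K) :
    ((toLogNabla (Ioo 0 1)).obj X).IsOverconvergent := by
  intro η hη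
  obtain ⟨r, hηr, hr1⟩ := exists_between hη.2
  have hr0 : 0 < r := hη.1.trans hηr
  refine ⟨r, ⟨hr0, hr1⟩, fun J hJ hJr v => ?_⟩
  set b := Module.finBasis K X.V
  set c := b.baseChange (Fn J) with hc
  refine ⟨_, c, fun k => ?_⟩
  have h0 : 0 ∉ J.carrier := fun h => lt_irrefl _ (hJ h).1
  have hiter (j : ℕ) (v : Fn J ⊗[K] X.V) : algebraMap K (Fn J) (j.factorial : K)⁻¹ •
      (((toLogNabla (Ioo 0 1)).obj X).ddt J hJ h0)^[j] v =
        Fn.tInv h0 ^ j • aeval (X.tensorD J) (choosePoly K j) v :=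
    inv_factorial_smul_iterate_ddt X.isConnection_tensorD h0 j v
  obtain ⟨d, hd⟩ := X.nilpotent
  have hbound (v : Fn J ⊗[K] X.V) : ∃ B : ℝ, ∀ j : ℕ,
      ‖c.repr (aeval (X.tensorD J) (choosePoly K j) v) k‖ ≤ B * ((j + 1 : ℕ) : ℝ) ^ d := by
    induction v with
    | zero => exact ⟨0, fun j => by simp⟩
    | add x y hx hy =>
      obtain ⟨B, hB⟩ := hx
      obtain ⟨B', hB'⟩ := hy
      refine ⟨B + B', fun j => ?_⟩
      rw [map_add, map_add, Finsupp.add_apply, add_mul]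
      exact (norm_add_le _ _).trans (add_le_add (hB j) (hB' j))
    | tmul f x =>
      set B : ℝ := ∑ m ∈ Finset.range d, ‖b.repr ((X.N ^ m) x) k‖ with hBdef
      have hB0 : 0 ≤ B := Finset.sum_nonneg fun _ _ => norm_nonneg _
      have hN (l : ℕ) : ‖b.repr (aeval X.N (choosePoly K l) x) k‖ ≤ B * ((l + 1 : ℕ) : ℝ) ^ d := by
        rw [aeval_eq_sum_range, LinearMap.sum_apply, map_sum, Finsupp.finsetSum_apply]
        refine IsUltrametricDist.norm_sum_le_of_forall_le_of_nonneg (by positivity) fun m _ => ?_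
        rw [LinearMap.smul_apply, map_smul, Finsupp.smul_apply, smul_eq_mul, norm_mul, mul_comm]
        rcases lt_or_ge m d with hm | hm
        · refine mul_le_mul ?_ ?_ (norm_nonneg _) hB0
          · exact Finset.single_le_sum (f := fun m => ‖b.repr ((X.N ^ m) x) k‖)
              (fun _ _ => norm_nonneg _) (Finset.mem_range.2 hm)
          · exact (norm_coeff_choosePoly_le hp l m).trans
              (pow_le_pow_right₀ (by exact_mod_cast l.succ_pos) hm.le)
        · rw [pow_eq_zero_of_le hm hd]
          simp only [LinearMap.zero_apply, map_zero, Finsupp.coe_zero, Pi.zero_apply, norm_zero,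
            zero_mul]
          positivity
      refine ⟨‖f‖ * B, fun j => ?_⟩
      have hcomm : Commute (LinearMap.rTensor X.V (Fn.theta J)) (LinearMap.lTensor (Fn J) X.N) := by
        refine LinearMap.ext fun z => ?_
        induction z with
        | zero => simp
        | add x y hx hy => simp only [map_add, hx, hy]
        | tmul f v => rfl
      have h3 : aeval (X.tensorD J) (choosePoly K j) (f ⊗ₜ x) =
          ∑ ij ∈ Finset.HasAntidiagonal.antidiagonal j,
            aeval (Fn.theta J) (choosePoly K ij.1) f ⊗ₜ aeval X.N (choosePoly K ij.2) x := by
        rw [tensorD, aeval_choosePoly_add K hcomm, LinearMap.sum_apply]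
        refine Finset.sum_congr rfl fun ij _ => ?_
        have e1 := aeval_apply_of_comm K (TensorProduct.mk K (Fn J) X.V f) (D := X.N)
          (D' := LinearMap.lTensor (Fn J) X.N) (fun _ => rfl) (choosePoly K ij.2) x
        have e2 := aeval_apply_of_comm K ((TensorProduct.mk K (Fn J) X.V).flip
          (aeval X.N (choosePoly K ij.2) x)) (D := Fn.theta J)
          (D' := LinearMap.rTensor X.V (Fn.theta J)) (fun _ => rfl) (choosePoly K ij.1) f
        exact (congrArg _ e1.symm).trans e2.symm
      rw [h3, map_sum, Finsupp.finsetSum_apply]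
      refine IsUltrametricDist.norm_sum_le_of_forall_le_of_nonneg (by positivity) fun ij hij => ?_
      rw [hc, Module.Basis.baseChange_repr_tmul]
      refine (norm_smul_le _ _).trans ?_
      rw [mul_comm, mul_assoc]
      refine mul_le_mul ?_ ((hN _).trans ?_) (norm_nonneg _) (norm_nonneg _)
      · refine Fn.norm_aeval_theta_le (fun i => ?_) f
        obtain ⟨z, hz⟩ := eval_choosePoly_intCast K ij.1 i
        rw [hz]
        exact IsUltrametricDist.norm_intCast_le_one K z
      · refine mul_le_mul_of_nonneg_left (pow_le_pow_left₀ (by positivity) ?_ _) hB0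
        exact_mod_cast Nat.succ_le_succ (Finset.HasAntidiagonal.antidiagonal.snd_le hij)
  obtain ⟨B, hB⟩ := hbound v
  set q := η / r with hq
  have hq0 : 0 < q := div_pos hη.1 hr0
  have hq1 : q < 1 := (div_lt_one hr0).2 hηr
  -- The polynomial bound is in `j + 1`, so the limit is taken along shifted indices and the surplus
  -- factor `q` is undone by `q⁻¹`.
  have hlim := (((tendsto_pow_const_mul_const_pow_of_lt_one d hq0.le hq1).comp
    (tendsto_add_atTop_nat 1)).mul_const q⁻¹).const_mul B
  rw [zero_mul, mul_zero] at hlim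
  refine squeeze_zero (fun j => mul_nonneg (Fn.supNorm_nonneg _) (pow_nonneg hη.1.le j))
    (fun j => ?_) hlim
  have hlo : r ≤ J.lo := (hJr J.lo_mem).1
  have h4 : ‖Fn.tInv h0‖ ≤ r⁻¹ := (Fn.norm_tInv_le h0).trans (inv_anti₀ hr0 hlo)
  have h5 : Fn.supNorm (c.repr (algebraMap K (Fn J) (j.factorial : K)⁻¹ •
      (((toLogNabla (Ioo 0 1)).obj X).ddt J hJ h0)^[j] v) k) ≤
        (r⁻¹) ^ j * (B * ((j + 1 : ℕ) : ℝ) ^ d) := by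
    refine (congrArg (fun w => Fn.supNorm (c.repr w k)) (hiter j v)).le.trans ?_
    refine (Fn.supNorm_le_norm _).trans ?_
    rw [map_smul, Finsupp.smul_apply, smul_eq_mul]
    refine (norm_mul_le _ _).trans (mul_le_mul ((norm_pow_le _ _).trans
      (pow_le_pow_left₀ (norm_nonneg _) h4 _)) (hB j) (norm_nonneg _) (by positivity))
  refine (mul_le_mul_of_nonneg_right h5 (pow_nonneg hη.1.le j)).trans (le_of_eq ?_)
  have h6 : q ^ (j + 1) * q⁻¹ = r⁻¹ ^ j * η ^ j := by
    rw [pow_succ, mul_assoc, mul_inv_cancel₀ hq0.ne', mul_one, hq, div_eq_mul_inv, mul_pow, mul_comm]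
  simp only [Function.comp, mul_assoc, h6]
  ring

end NilpotentEnd

lemma NilpotentEnd.overconvergentLog_toLogNabla [CharZero K] {p : ℕ} [hpp : Fact p.Prime]
    (hp : ‖(p : K)‖ = (p : ℝ)⁻¹) (X : NilpotentEnd K) :
    overconvergentLog K ((NilpotentEnd.toLogNabla (Ico 0 1)).obj X) :=
  ⟨X.hasNilpotentResidue_toLogNabla, X.isOverconvergent_toLogNabla hp⟩

end RigidAnnulus

end

/-! ### Projection polynomials, Newton expansions, and divisibility by powers of `t`. -/

noncomputable section

namespace RigidAnnulus

open Polynomial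

section ProjPoly

variable (K : Type u) [Field K]

/-- An integer valued polynomial congruent to `1` modulo `X ^ d` and divisible by `(X - j) ^ d` for
`1 ≤ j ≤ n`. -/
def projPoly (d n : ℕ) : K[X] := 1 - (1 - binomPoly K n ^ d) ^ d

/-- The polynomial `∏_{j = 0}^n (X - j) ^ d`. -/
def rootPoly (d n : ℕ) : K[X] := ∏ j ∈ Finset.range (n + 1), (X - C (j : K)) ^ d

lemma projPoly_zero {d : ℕ} (hd : d ≠ 0) : projPoly K d 0 = 1 := by
  simp [projPoly, binomPoly_zero, hd]

lemma natDegree_projPoly_le (d n : ℕ) : (projPoly K d n).natDegree ≤ n * d ^ 2 := by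
  have h1 : (1 - binomPoly K n ^ d).natDegree ≤ d * n := by
    refine (natDegree_sub_le _ _).trans ?_
    simpa using natDegree_pow_le.trans (Nat.mul_le_mul_left d (natDegree_binomPoly_le K n))
  refine (natDegree_sub_le _ _).trans ?_
  simpa [pow_two, mul_comm, mul_left_comm] using
    natDegree_pow_le.trans (Nat.mul_le_mul_left d h1)

lemma eval_projPoly_intCast [CharZero K] (d n : ℕ) (i : ℤ) :
    ∃ z : ℤ, (projPoly K d n).eval (i : K) = z := by
  obtain ⟨z, hz⟩ := eval_binomPoly_intCast K n i
  refine ⟨1 - (1 - z ^ d) ^ d, ?_⟩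
  simp [projPoly, hz]

/-- Since `binomPoly K n` is `1` at `0`, the inner difference in `projPoly` is divisible by `X`, and
the outer power turns this into `X ^ d`. The inner power is there for the zeros of order `d` at `1,
…, n`. -/
lemma X_pow_dvd_projPoly_sub_one (d n : ℕ) : X ^ d ∣ projPoly K d n - 1 := by
  have h1 : (X : K[X]) ∣ 1 - binomPoly K n ^ d := by
    rw [X_dvd_iff, coeff_zero_eq_eval_zero]
    simp [eval_zero_binomPoly]
  rw [projPoly, sub_sub_cancel_left, dvd_neg]
  exact pow_dvd_pow_of_dvd h1 d

lemma binomPoly_pow_dvd_projPoly (d n : ℕ) : binomPoly K n ^ d ∣ projPoly K d n := by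
  have h1 := sub_dvd_pow_sub_pow (1 : K[X]) (1 - binomPoly K n ^ d) d
  rwa [sub_sub_cancel, one_pow] at h1

variable [CharZero K]

lemma X_sub_C_pow_dvd_projPoly (d : ℕ) {n j : ℕ} (hj : 1 ≤ j) (hjn : j ≤ n) :
    (X - C (j : K)) ^ d ∣ projPoly K d n := by
  refine (pow_dvd_pow_of_dvd ?_ d).trans (binomPoly_pow_dvd_projPoly K d n)
  exact dvd_iff_isRoot.2 (eval_binomPoly_eq_zero K hj hjn)

lemma rootPoly_dvd {d n : ℕ} {P : K[X]} (h : ∀ j ≤ n, (X - C (j : K)) ^ d ∣ P) :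
    rootPoly K d n ∣ P := by
  refine Finset.prod_dvd_of_coprime ?_ fun j hj => h j (Nat.lt_succ_iff.1 (Finset.mem_range.1 hj))
  intro i _ j _ hij
  exact (pairwise_coprime_X_sub_C (s := fun n : ℕ => (n : K)) Nat.cast_injective hij).pow

/-- Both polynomials vanish to order `d` at `1, …, n` and are congruent to `1` modulo `X ^ d`, so
their difference vanishes to order `d` at `0` too. Successive approximations will therefore differ
by multiples of `t ^ (n + 1)`. -/
lemma rootPoly_dvd_projPoly_sub (d n : ℕ) :
    rootPoly K d n ∣ projPoly K d n - projPoly K d (n + 1) := by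
  refine rootPoly_dvd K fun j hj => ?_
  rcases Nat.eq_zero_or_pos j with rfl | hj0
  · rw [Nat.cast_zero, C_0, sub_zero, ← sub_sub_sub_cancel_right _ _ 1]
    exact dvd_sub (X_pow_dvd_projPoly_sub_one K d n) (X_pow_dvd_projPoly_sub_one K d (n + 1))
  · exact dvd_sub (X_sub_C_pow_dvd_projPoly K d hj0 hj)
      (X_sub_C_pow_dvd_projPoly K d hj0 (hj.trans n.le_succ))

/-- Here `X ^ d` itself supplies the zero at `0`. This will show that the limit of the
approximations is killed by the `d`-th power of `t d/dt`. -/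
lemma rootPoly_dvd_X_pow_mul_projPoly (d n : ℕ) : rootPoly K d n ∣ X ^ d * projPoly K d n := by
  refine rootPoly_dvd K fun j hj => ?_
  rcases Nat.eq_zero_or_pos j with rfl | hj0
  · rw [Nat.cast_zero, C_0, sub_zero]
    exact dvd_mul_right _ _
  · exact (X_sub_C_pow_dvd_projPoly K d hj0 hj).mul_left _

end ProjPoly

section Newton

variable {K : Type u} [NormedField K] [IsUltrametricDist K] [CharZero K]

/-- Newton expansion: a polynomial with integral values at the natural numbers is an integral linear
combination of binomial coefficients. -/
lemma exists_eq_sum_choosePoly {P : K[X]} {m : ℕ} (hdeg : P.natDegree ≤ m)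
    (hP : ∀ i : ℕ, ‖P.eval (i : K)‖ ≤ 1) :
    ∃ c : ℕ → K, (∀ k, ‖c k‖ ≤ 1) ∧
      P = ∑ k ∈ Finset.range (m + 1), C (c k) * choosePoly K k := by
  let f : ℕ → K := fun i => P.eval (i : K)
  -- The Newton coefficients are iterated differences at `0`, integral combinations of values of
  -- `P`. Both sides have degree at most `m` and agree at `0, …, m`, so they coincide.
  let c : ℕ → K := fun k => (fwdDiff (1:ℕ))^[k] f 0
  refine ⟨c, fun k => ?_, ?_⟩
  · simp only [c, fwdDiff_iter_eq_sum_shift]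
    refine IsUltrametricDist.norm_sum_le_of_forall_le_of_nonneg zero_le_one fun i _ => ?_
    rw [zsmul_eq_mul, norm_mul]
    exact mul_le_one₀ (IsUltrametricDist.norm_intCast_le_one K _) (norm_nonneg _) (hP _)
  · refine eq_of_degrees_lt_of_eval_index_eq (s := Finset.range (m + 1)) (v := fun n : ℕ => (n : K))
      Nat.cast_injective.injOn ?_ ?_ fun n hn => ?_
    · rw [Finset.card_range]
      exact (degree_le_of_natDegree_le hdeg).trans_lt (by exact_mod_cast m.lt_succ_self)
    · rw [Finset.card_range]
      refine (degree_le_of_natDegree_le (natDegree_sum_le_of_forall_le (n := m) _ _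
        fun k hk => ?_)).trans_lt (by exact_mod_cast m.lt_succ_self)
      exact (natDegree_C_mul_le _ _).trans ((natDegree_choosePoly_le K k).trans
        (Nat.lt_succ_iff.1 (Finset.mem_range.1 hk)))
    · have h1 := shift_eq_sum_fwdDiff_iter (1 : ℕ) f n 0
      rw [zero_add, smul_eq_mul, mul_one] at h1
      have h2 : f n = ∑ k ∈ Finset.range (m + 1), n.choose k • c k := by
        rw [h1]
        refine Finset.sum_subset (Finset.range_mono (by have := Finset.mem_range.1 hn; omega)) ?_
        intro k _ hk
        rw [Finset.mem_range, not_lt] at hk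
        rw [Nat.choose_eq_zero_of_lt (by omega), zero_smul]
      change f n = _
      rw [h2, eval_finsetSum]
      refine Finset.sum_congr rfl fun k _ => ?_
      rw [eval_mul, eval_C, eval_choosePoly_natCast, nsmul_eq_mul, mul_comm]

end Newton

variable {K : Type u} [NormedField K] [IsUltrametricDist K] [CompleteSpace K]

section Connection

variable {J : ClosedInterval K} {M : Type*} [AddCommGroup M] [Module K M] [Module (Fn J) M]
  [IsScalarTower K (Fn J) M] {D : Module.End K M}

/-- The Leibniz rule gives `(D - n) t^n = t^n D`. -/
lemma aeval_X_sub_C_pow_apply_t_pow_smul (hD : IsConnection J D) (n k : ℕ) (m : M) :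
    aeval D ((X - C (n : K)) ^ k) ((Fn.t : Fn J) ^ n • m) = (Fn.t : Fn J) ^ n • (D ^ k) m := by
  induction k with
  | zero => simp
  | succ k ih =>
    rw [pow_succ', map_mul, Module.End.mul_apply, ih, pow_succ', Module.End.mul_apply, map_sub,
      aeval_X, aeval_C, LinearMap.sub_apply, hD, Fn.theta_t_pow, Module.algebraMap_end_apply,
      smul_assoc, add_sub_cancel_left]

/-- Once the factors for `j ≤ n` have produced `t ^ (n + 1)`, the factor `(X - (n + 1)) ^ d` acts
behind it as `D ^ d`, which yields one more `t`. -/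
lemma exists_aeval_eq_t_pow_smul (hD : IsConnection J D) {d : ℕ}
    (hd : ∀ m, ∃ y, (D ^ d) m = (Fn.t : Fn J) • y) {n : ℕ} {P : K[X]} (hP : rootPoly K d n ∣ P)
    (m : M) : ∃ y, aeval D P m = (Fn.t : Fn J) ^ (n + 1) • y := by
  have key (n : ℕ) (m : M) : ∃ y, aeval D (rootPoly K d n) m = (Fn.t : Fn J) ^ (n + 1) • y := by
    induction n with
    | zero =>
      obtain ⟨y, hy⟩ := hd m
      exact ⟨y, by simpa [rootPoly] using hy⟩
    | succ n ih =>
      obtain ⟨y, hy⟩ := ih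
      obtain ⟨z, hz⟩ := hd y
      refine ⟨z, ?_⟩
      rw [rootPoly, Finset.prod_range_succ, ← rootPoly, mul_comm, map_mul, Module.End.mul_apply, hy,
        aeval_X_sub_C_pow_apply_t_pow_smul hD, hz, smul_smul, ← pow_succ]
  obtain ⟨Q, rfl⟩ := hP
  rw [map_mul, Module.End.mul_apply]
  exact key n _

lemma exists_pow_apply_t_pow_smul (hD : IsConnection J D) (n k : ℕ) (m : M) :
    ∃ y, (D ^ k) ((Fn.t : Fn J) ^ n • m) = (Fn.t : Fn J) ^ n • y := by
  induction k with
  | zero => exact ⟨m, rfl⟩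
  | succ k ih =>
    obtain ⟨y, hy⟩ := ih
    refine ⟨(n : K) • y + D y, ?_⟩
    rw [pow_succ', Module.End.mul_apply, hy, hD, Fn.theta_t_pow, smul_assoc, smul_add, smul_comm]

end Connection

end RigidAnnulus

end

/-! ### Null sections on a disc as limits of polynomials in `t d/dt`. -/

noncomputable section

namespace RigidAnnulus

open Polynomial

variable {K : Type u} [NormedField K] [IsUltrametricDist K] [CompleteSpace K]

namespace LogNablaModule

variable {I : Set ℝ} {E : LogNablaModule K I}

section Estimates

variable {J : ClosedInterval K} {hJ : J.carrier ⊆ I} {h0 : 0 ∉ J.carrier} {η : ℝ}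
  {w : E.obj J hJ}

/-- Only the boundedness of the null sequence is used. Multiplying by `t ^ j`, of norm at most `1`,
removes the power of `t⁻¹`, and expansion in the basis carries the bound to any functional. -/
lemma IsNullSeq.exists_norm_aeval_choosePoly_le (hcirc : J.lo = J.hi) (hη : 0 < η)
    (hw : E.IsNullSeq J hJ η fun j => algebraMap K (Fn J) (j.factorial : K)⁻¹ •
      (E.ddt J hJ h0)^[j] w) (φ : E.obj J hJ →ₗ[Fn J] Fn J) :
    ∃ C, 0 ≤ C ∧ ∀ j, ‖φ (aeval (E.linD J hJ) (choosePoly K j) w)‖ ≤ C * η⁻¹ ^ j := by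
  obtain ⟨n, b, hb⟩ := hw
  have hbdd (i : Fin n) := (hb i).bddAbove_range
  choose B hB using hbdd
  have hB' (i : Fin n) (j : ℕ) := hB i (mem_range_self j)
  have hB0 (i : Fin n) : 0 ≤ B i :=
    (mul_nonneg (Fn.supNorm_nonneg _) (pow_nonneg hη.le 0)).trans (hB' i 0)
  refine ⟨∑ i, B i * ‖φ (b i)‖, Finset.sum_nonneg fun i _ => mul_nonneg (hB0 i) (norm_nonneg _),
    fun j => ?_⟩
  set x := algebraMap K (Fn J) (j.factorial : K)⁻¹ • (E.ddt J hJ h0)^[j] w with hx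
  have h1 : aeval (E.linD J hJ) (choosePoly K j) w = (Fn.t : Fn J) ^ j • x := by
    have h2 : x = Fn.tInv h0 ^ j • aeval (E.linD J hJ) (choosePoly K j) w :=
      inv_factorial_smul_iterate_ddt (E.isConnection_linD J hJ) h0 j w
    rw [h2, smul_smul, ← mul_pow, Fn.t_mul_tInv, one_pow, one_smul]
  have h3 : φ x = ∑ i, b.repr x i * φ (b i) := by
    conv_lhs => rw [← b.sum_repr x]
    simp only [map_sum, map_smul, smul_eq_mul]
  have h4 (i : Fin n) : ‖b.repr x i‖ ≤ B i * η⁻¹ ^ j := by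
    rw [inv_pow, ← div_eq_mul_inv, le_div_iff₀ (pow_pos hη j)]
    exact (mul_le_mul_of_nonneg_right (Fn.norm_le_supNorm hcirc _) (pow_nonneg hη.le j)).trans
      (hB' i j)
  have ht : ‖(Fn.t : Fn J) ^ j‖ ≤ 1 :=
    (norm_pow_le _ _).trans (pow_le_one₀ (norm_nonneg _) (Fn.norm_t_le.trans J.hi_lt_one.le))
  rw [h1, map_smul, smul_eq_mul, h3]
  refine (norm_mul_le _ _).trans ((mul_le_of_le_one_left (norm_nonneg _) ht).trans ?_)
  refine (norm_sum_le _ _).trans ?_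
  rw [Finset.sum_mul]
  refine Finset.sum_le_sum fun i _ => (norm_mul_le _ _).trans ?_
  rw [mul_right_comm]
  exact mul_le_mul_of_nonneg_right (h4 i) (norm_nonneg _)

/-- By Newton expansion, the bound for binomial coefficients passes to every polynomial with
integral values, with a constant independent of the polynomial and a loss depending only on its
degree. -/
lemma IsNullSeq.exists_norm_aeval_le [CharZero K] (hcirc : J.lo = J.hi) (hη : 0 < η) (hη1 : η ≤ 1)
    (hw : E.IsNullSeq J hJ η fun j => algebraMap K (Fn J) (j.factorial : K)⁻¹ •
      (E.ddt J hJ h0)^[j] w) (φ : E.obj J hJ →ₗ[Fn J] Fn J) :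
    ∃ C, 0 ≤ C ∧ ∀ (m : ℕ) (P : K[X]), P.natDegree ≤ m → (∀ i : ℕ, ‖P.eval (i : K)‖ ≤ 1) →
      ‖φ (aeval (E.linD J hJ) P w)‖ ≤ C * η⁻¹ ^ m := by
  obtain ⟨C, hC0, hC⟩ := hw.exists_norm_aeval_choosePoly_le hcirc hη φ
  refine ⟨C, hC0, fun m P hdeg hP => ?_⟩
  obtain ⟨c, hc, hsum⟩ := exists_eq_sum_choosePoly hdeg hP
  rw [hsum, map_sum, LinearMap.sum_apply, map_sum]
  have hη' : 1 ≤ η⁻¹ := (one_le_inv₀ hη).2 hη1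
  refine IsUltrametricDist.norm_sum_le_of_forall_le_of_nonneg (by positivity) fun k hk => ?_
  rw [map_mul, Module.End.mul_apply, aeval_C, Module.algebraMap_end_apply,
    ← algebraMap_smul (Fn J), map_smul, smul_eq_mul, ← Algebra.smul_def]
  refine (norm_smul_le _ _).trans ((mul_le_of_le_one_left (norm_nonneg _) (hc k)).trans ?_)
  exact (hC k).trans (mul_le_mul_of_nonneg_left
    (pow_le_pow_right₀ hη' (Nat.lt_succ_iff.1 (Finset.mem_range.1 hk))) hC0)

end Estimates

lemma aeval_linD_res {J J' : ClosedInterval K} (hJ : J.carrier ⊆ I)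
    (h : J'.carrier ⊆ J.carrier) (P : K[X]) (m : E.obj J hJ) :
    aeval (E.linD J' (h.trans hJ)) P (E.res hJ h m) = E.res hJ h (aeval (E.linD J hJ) P m) :=
  (aeval_apply_of_comm K (E.linRes hJ h) (fun m => (E.D_res hJ h m).symm) P m).symm

/-- A section over the disc `A(J')` which satisfies, on the boundary, a growth condition for the action
of binomial coefficients in `t d/dt`, is congruent modulo `t` on a smaller disc `A(J)` to a section
killed by a power of `t d/dt`. -/
lemma exists_mem_null_sub_eq_t_smul [CharZero K] {J J' : ClosedInterval K} (hJ' : J'.carrier ⊆ I)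
    (h : J.carrier ⊆ J'.carrier) (h0 : 0 ∈ J.carrier) {d : ℕ} (hd0 : d ≠ 0)
    (hd : ∀ m, ∃ y, (E.linD J (h.trans hJ') ^ d) m = (Fn.t : Fn J) • y) {η : ℝ} (hη : 0 < η)
    (hlt : J.hi < J'.hi * η ^ d ^ 2) (w : E.obj J' hJ')
    (hw : ∀ φ : E.obj J'.outer (J'.outer_subset.trans hJ') →ₗ[Fn J'.outer] Fn J'.outer,
      ∃ C, 0 ≤ C ∧ ∀ (m : ℕ) (P : K[X]), P.natDegree ≤ m → (∀ i : ℕ, ‖P.eval (i : K)‖ ≤ 1) →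
        ‖φ (aeval (E.linD J'.outer _) P (E.res hJ' J'.outer_subset w))‖ ≤ C * η⁻¹ ^ m) :
    ∃ v ∈ E.null J (h.trans hJ'), ∃ y, v - E.res hJ' h w = (Fn.t : Fn J) • y := by
  obtain ⟨n, ι', π', hπι'⟩ := E.exists_embedding J' hJ'
  obtain ⟨ι, π, hπι, hι⟩ := exists_extend_embedding hJ' h hπι'
  obtain ⟨ιo, -, -, hιo⟩ := exists_extend_embedding hJ' J'.outer_subset hπι'
  have hπι_apply (m) : π (ι m) = m := LinearMap.congr_fun hπι m
  have hρ := J.hi_pos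
  have hR := J'.hi_pos
  have hρR : J.hi ≤ J'.hi := (h J.hi_mem).2
  set D' := E.linD J' hJ'
  -- The null section will be the limit of `projPoly K d N` evaluated at `t d/dt` and applied to
  -- `w`; `Q N` is the decrement from one approximation to the next.
  let Q : ℕ → K[X] := fun N => projPoly K d N - projPoly K d (N + 1)
  have hQdeg (N : ℕ) : (Q N).natDegree ≤ (N + 1) * d ^ 2 :=
    (natDegree_sub_le _ _).trans (max_le ((natDegree_projPoly_le K d N).trans
      (Nat.mul_le_mul_right _ N.le_succ)) (natDegree_projPoly_le K d (N + 1)))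
  have hQeval (N i : ℕ) : ‖(Q N).eval (i : K)‖ ≤ 1 := by
    obtain ⟨a, ha⟩ := eval_projPoly_intCast K d N i
    obtain ⟨b, hb⟩ := eval_projPoly_intCast K d (N + 1) i
    rw [Int.cast_natCast] at ha hb
    rw [eval_sub, ha, hb, ← Int.cast_sub]
    exact IsUltrametricDist.norm_intCast_le_one K _
  let f : ℕ → Fin n → Fn J := fun N k => ι (E.res hJ' h (aeval D' (Q N) w)) k
  have hf_coeff (N : ℕ) (k : Fin n) {i : ℤ} (hi : i < (N + 1 : ℕ)) : (f N k).coeff i = 0 := by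
    obtain ⟨y, hy⟩ := exists_aeval_eq_t_pow_smul (E.isConnection_linD J (h.trans hJ')) hd
      (rootPoly_dvd_projPoly_sub K d N) (E.res hJ' h w)
    rw [aeval_linD_res] at hy
    change (ι (E.res hJ' h (aeval D' (projPoly K d N - projPoly K d (N + 1)) w)) k).coeff i = 0
    rw [hy, map_smul, Pi.smul_apply, smul_eq_mul, Fn.coeff_t_pow_mul]
    exact Fn.converges _ |>.2 h0 _ (by omega)
  -- A series starting at `t ^ (N + 1)` gains `(J.hi / J'.hi) ^ (N + 1)` between the two radii,
  -- while the degree `(N + 1) d ^ 2` of `Q N` loses at most `η⁻¹` to that power. The ratio `q`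
  -- compares the two.
  set q := J.hi / (J'.hi * η ^ d ^ 2) with hq
  have hden : 0 < J'.hi * η ^ d ^ 2 := by positivity
  have hq0 : 0 ≤ q := by positivity
  have hq1 : q < 1 := (div_lt_one hden).2 hlt
  have hsum (k : Fin n) : Summable fun N => f N k := by
    obtain ⟨C, hC0, hC⟩ := hw (LinearMap.proj k ∘ₗ ιo)
    have hgeom := ((summable_nat_add_iff 1).2 (summable_geometric_of_lt_one hq0 hq1)).mul_left C
    refine Summable.of_norm_bounded hgeom fun N => ?_
    refine Fn.norm_le fun i => ?_
    rw [weight_of_lo_eq_zero (zero_mem_carrier_iff.1 h0)]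
    rcases lt_or_ge i ((N + 1 : ℕ) : ℤ) with hi | hi
    · rw [hf_coeff N k hi, norm_zero, zero_mul]
      positivity
    · have h1 := hC _ (Q N) (hQdeg N) (hQeval N)
      rw [aeval_linD_res, LinearMap.comp_apply, LinearMap.proj_apply] at h1
      have h2 := (Fn.coeff_weight_le (ιo (E.res hJ' J'.outer_subset (aeval D' (Q N) w)) k) i).trans h1
      have h3 : (ιo (E.res hJ' J'.outer_subset (aeval D' (Q N) w)) k).coeff i = (f N k).coeff i := by
        rw [hιo]
        change _ = (ι (E.res hJ' h (aeval D' (Q N) w)) k).coeff i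
        rw [hι, Fn.coeff_res, Fn.coeff_res]
      have h4 : weight J'.outer i = J'.hi ^ i := max_self _
      rw [h3, h4] at h2
      have h5 : (J.hi / J'.hi) ^ i ≤ (J.hi / J'.hi) ^ (N + 1) := by
        rw [← zpow_natCast]
        exact zpow_le_zpow_right_of_le_one₀ (div_pos hρ hR) ((div_le_one hR).2 hρR) hi
      have h6 : J.hi ^ i = J'.hi ^ i * (J.hi / J'.hi) ^ i := by
        rw [← mul_zpow, mul_div_cancel₀ _ hR.ne']
      rw [h6, ← mul_assoc]
      refine (mul_le_mul h2 h5 (by positivity) (by positivity)).trans (le_of_eq ?_)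
      rw [hq, mul_comm (N + 1), pow_mul, mul_assoc, ← mul_pow, inv_pow]
      congr 2
      field_simp
  let S : Fin n → Fn J := fun k => ∑' N, f N k
  have hS_coeff (N : ℕ) (k : Fin n) {i : ℤ} (hi : i < (N + 1 : ℕ)) :
      (∑ j ∈ Finset.range N, f j k - S k).coeff i = 0 := by
    let c : Fn J →+ K := { toFun := fun g => g.coeff i, map_zero' := rfl, map_add' := fun _ _ => rfl }
    have h1 : HasSum (fun j => c (f j k)) (c (S k)) := (hsum k).hasSum.map c (Fn.continuous_coeff i)
    have h2 : HasSum (fun j => c (f j k)) (∑ j ∈ Finset.range N, c (f j k)) := by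
      refine hasSum_sum_of_ne_finset_zero fun j hj => hf_coeff j k ?_
      rw [Finset.mem_range, not_lt] at hj
      exact hi.trans_le (by exact_mod_cast Nat.succ_le_succ hj)
    change c (∑ j ∈ Finset.range N, f j k - S k) = 0
    rw [map_sub, map_sum, h1.unique h2, sub_self]
  -- As `projPoly K d 0 = 1`, the decrements telescope and `v` is the limit of the approximations.
  set v := E.res hJ' h w - π S with hv
  have happrox (N : ℕ) : ∃ y, v - E.res hJ' h (aeval D' (projPoly K d N) w) =
      (Fn.t : Fn J) ^ (N + 1) • y := by
    have h1 (k : Fin n) := Fn.exists_eq_t_pow_mul h0 (N + 1) (∑ j ∈ Finset.range N, f j k - S k)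
      fun i hi => hS_coeff N k hi
    choose g hg using h1
    refine ⟨π g, ?_⟩
    have h2 : (Fn.t : Fn J) ^ (N + 1) • g = ∑ j ∈ Finset.range N, f j - S := by
      ext1 k
      rw [Pi.smul_apply, smul_eq_mul, ← hg, Pi.sub_apply, Finset.sum_apply]
    have h3 : ∑ j ∈ Finset.range N, aeval D' (Q j) w = w - aeval D' (projPoly K d N) w := by
      rw [← LinearMap.sum_apply, ← map_sum, Finset.sum_range_sub', projPoly_zero K hd0, map_sub,
        map_one]
      rfl
    have h4 : π (∑ j ∈ Finset.range N, f j) =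
        E.res hJ' h w - E.res hJ' h (aeval D' (projPoly K d N) w) := by
      rw [← map_sub, ← h3, map_sum, map_sum]
      exact Finset.sum_congr rfl fun j _ => hπι_apply _
    rw [← map_smul, h2, map_sub, h4, hv]
    abel
  refine ⟨v, ⟨d, ?_⟩, ?_⟩
  -- Modulo `t ^ (N + 1)`, `D ^ d v` agrees with `D ^ d` of the `N`-th approximation, which is
  -- itself divisible by `t ^ (N + 1)`. A section divisible by all powers of `t` vanishes.
  · have h1 (N : ℕ) : ∃ y, (E.linD J (h.trans hJ') ^ d) v = (Fn.t : Fn J) ^ (N + 1) • y := by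
      obtain ⟨y, hy⟩ := happrox N
      obtain ⟨y₁, hy₁⟩ := exists_pow_apply_t_pow_smul (E.isConnection_linD J (h.trans hJ')) (N + 1) d y
      obtain ⟨y₂, hy₂⟩ := exists_aeval_eq_t_pow_smul (E.isConnection_linD J (h.trans hJ')) hd
        (rootPoly_dvd_X_pow_mul_projPoly K d N) (E.res hJ' h w)
      refine ⟨y₁ + y₂, ?_⟩
      rw [map_mul, map_pow, aeval_X, Module.End.mul_apply, aeval_linD_res] at hy₂
      rw [eq_add_of_sub_eq hy, map_add, hy₁, hy₂, smul_add]
    rw [← hπι_apply ((E.linD J (h.trans hJ') ^ d) v)]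
    convert map_zero π
    ext k i
    rw [Pi.zero_apply, Fn.coeff_zero]
    -- Divisibility by `t ^ (i.toNat + 1)` is enough to kill the coefficient of index `i`.
    obtain ⟨y, hy⟩ := h1 i.toNat
    rw [hy, map_smul, Pi.smul_apply, smul_eq_mul, Fn.coeff_t_pow_mul]
    exact Fn.converges _ |>.2 h0 _ (by omega)
  · obtain ⟨y, hy⟩ := happrox 0
    refine ⟨y, ?_⟩
    rwa [projPoly_zero K hd0, map_one, zero_add, pow_one] at hy

end LogNablaModule

end RigidAnnulus

end

/-! ### Overconvergent log-modules are generated by null sections. -/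

noncomputable section

namespace RigidAnnulus

variable {K : Type u} [NormedField K]

/-- The interval `[0, r]`, corresponding to the closed disc of radius `r`. -/
def ClosedInterval.disc {r : ℝ} (hr : r ∈ valueGroup K) (hr1 : r < 1) : ClosedInterval K where
  lo := 0
  hi := r
  lo_nonneg := le_rfl
  lo_le_hi := hr.1.le
  hi_lt_one := hr1
  lo_aligned := Or.inl rfl
  hi_aligned := hr

/-- The interval `[r, r]`, corresponding to the circle of radius `r`. -/
def ClosedInterval.circle {r : ℝ} (hr : r ∈ valueGroup K) (hr1 : r < 1) : ClosedInterval K where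
  lo := r
  hi := r
  lo_nonneg := hr.1.le
  lo_le_hi := le_rfl
  hi_lt_one := hr1
  lo_aligned := Or.inr hr
  hi_aligned := hr

variable [IsUltrametricDist K] [CompleteSpace K]

namespace LogNablaModule

section Span

variable {I : Set ℝ} {E : LogNablaModule K I} {J : ClosedInterval K}
  {hJ : J.carrier ⊆ I}

lemma D_mem_span_null {m : E.obj J hJ}
    (hm : m ∈ Submodule.span (Fn J) (E.null J hJ : Set (E.obj J hJ))) :
    E.D J hJ m ∈ Submodule.span (Fn J) (E.null J hJ : Set (E.obj J hJ)) := by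
  induction hm using Submodule.span_induction with
  | mem x hx => exact Submodule.subset_span (D_mem_null hJ hx)
  | zero => rw [map_zero]; exact Submodule.zero_mem _
  | add x y _ _ hx hy => rw [map_add]; exact Submodule.add_mem _ hx hy
  | smul f x hx' hx =>
    rw [E.leibniz]
    exact Submodule.add_mem _ (Submodule.smul_mem _ _ hx') (Submodule.smul_mem _ _ hx)

/-- A version of Nakayama's lemma on a disc. -/
lemma span_null_eq_top [CharZero K] (h0 : 0 ∈ J.carrier)
    (h : ∀ m : E.obj J hJ, ∃ u ∈ Submodule.span (Fn J) (E.null J hJ : Set (E.obj J hJ)),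
      ∃ y, m = u + (Fn.t : Fn J) • y) :
    Submodule.span (Fn J) (E.null J hJ : Set (E.obj J hJ)) = ⊤ := by
  set U := Submodule.span (Fn J) (E.null J hJ : Set (E.obj J hJ))
  have := E.finite J hJ
  obtain ⟨g, hg, hgU⟩ := Submodule.exists_sub_one_mem_and_smul_le_of_fg_of_le_sup
    (I := Ideal.span {(Fn.t : Fn J)}) (N := U) (N' := ⊤) (P := ⊤) Module.Finite.fg_top
    le_top (by
      intro m _
      obtain ⟨u, hu, y, rfl⟩ := h m
      exact Submodule.add_mem_sup hu
        (Submodule.smul_mem_smul (Ideal.mem_span_singleton_self _) Submodule.mem_top))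
  -- The element `g ≡ 1` modulo `t` need not be a unit. But the ideal of all `a` with `a M ⊆ U` is
  -- `θ`-stable, since `θ(a) m = D (a m) - a D m` and `U` is stable under `D`, and it contains `g`,
  -- whose constant coefficient is `1`.
  let A : Ideal (Fn J) :=
    { carrier := {a | ∀ m : E.obj J hJ, a • m ∈ U}
      zero_mem' := fun m => by rw [zero_smul]; exact U.zero_mem
      add_mem' := fun ha hb m => by rw [add_smul]; exact U.add_mem (ha m) (hb m)
      smul_mem' := fun c a ha m => by rw [smul_assoc]; exact U.smul_mem c (ha m) }
  have hA : ∀ a ∈ A, Fn.theta J a ∈ A := fun a ha m => by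
    have h1 := D_mem_span_null (ha m)
    rw [E.leibniz] at h1
    exact (Submodule.add_mem_iff_left _ (ha _)).1 h1
  have hgA : g ∈ A := fun m => hgU (Submodule.smul_mem_pointwise_smul m g ⊤ Submodule.mem_top)
  have hg0 : g.coeff 0 = 1 := by
    obtain ⟨a, ha⟩ := Ideal.mem_span_singleton.1 hg
    rw [eq_add_of_sub_eq ha, Fn.coeff_add, Fn.coeff_t_mul, Fn.coeff_one, if_pos rfl,
      a.converges.2 h0 _ (by norm_num), zero_add]
  have htop := Fn.eq_top_of_theta_stable A hA hgA hg0
  refine eq_top_iff.2 fun m _ => ?_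
  have h1 : (1 : Fn J) ∈ A := htop ▸ Submodule.mem_top
  simpa using h1 m

end Span

end LogNablaModule

lemma exists_lt_pow_of_lt_one {ρ : ℝ} (hρ : ρ < 1) (k : ℕ) : ∃ η ∈ Ioo (0 : ℝ) 1, ρ < η ^ k := by
  have h1 : Tendsto (fun η : ℝ => η ^ k) (𝓝[<] 1) (𝓝 1) := by
    simpa using ((continuous_pow k).tendsto (1 : ℝ)).mono_left nhdsWithin_le_nhds
  obtain ⟨η, h2, h3⟩ := ((h1.eventually (lt_mem_nhds hρ)).and
    (Ioo_mem_nhdsLT (zero_lt_one' ℝ))).exists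
  exact ⟨η, h3, h2⟩

namespace LogNablaModule

lemma HasNilpotentResidue.exists_linD_pow_eq_t_smul {I : Set ℝ} {E : LogNablaModule K I}
    (hE : E.HasNilpotentResidue) {J : ClosedInterval K} (hJ : J.carrier ⊆ I)
    (h0 : 0 ∈ J.carrier) :
    ∃ d ≠ 0, ∀ m, ∃ y, (E.linD J hJ ^ d) m = (Fn.t : Fn J) • y := by
  obtain ⟨n, hn⟩ := hE J hJ h0
  -- The exponent is raised by one because the residue may have zeroth power `0`, when the fibre
  -- vanishes.
  refine ⟨n + 1, n.succ_ne_zero, fun m => ?_⟩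
  have h1 := residue_pow_mk E hJ n (E.D J hJ m)
  rw [hn] at h1
  have h2 : (E.D J hJ)^[n] (E.D J hJ m) ∈ (E.tSubmodule J hJ).toAddSubgroup :=
    (QuotientAddGroup.eq_zero_iff _).1 h1.symm
  obtain ⟨y, hy⟩ := h2
  refine ⟨y, ?_⟩
  rw [pow_succ, Module.End.mul_apply, Module.End.coe_pow]
  exact hy.symm

variable [CharZero K] {p : ℕ} [hpp : Fact p.Prime] (hp : ‖(p : K)‖ = (p : ℝ)⁻¹)
  {E : LogNablaModule K (Ico 0 1)}

-- Sections over a slightly larger disc are congruent modulo `t` to null sections, and their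
-- restrictions generate over `A(J)`, so the Nakayama argument applies.
include hp in
lemma span_null_eq_top_of_overconvergentLog (hE : overconvergentLog K E) (J : ClosedInterval K)
    (hJ : J.carrier ⊆ Ico 0 1) (h0 : 0 ∈ J.carrier) :
    Submodule.span (Fn J) (E.null J hJ : Set (E.obj J hJ)) = ⊤ := by
  obtain ⟨d, hd0, hd⟩ := hE.1.exists_linD_pow_eq_t_smul hJ h0
  -- The exponent `d ^ 2 + 1` leaves one spare factor `η`: as soon as the outer radius `R` exceeds
  -- `η`, `J.hi < η ^ (d ^ 2 + 1)` gives `J.hi < R η ^ d ^ 2`. Taking `R > r` also places its circle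
  -- where overconvergence applies.
  obtain ⟨η, hη, hρη⟩ := exists_lt_pow_of_lt_one J.hi_lt_one (d ^ 2 + 1)
  obtain ⟨r, hr, hnull⟩ := hE.2 η hη
  obtain ⟨R, hR, hlt, hR1⟩ := exists_mem_valueGroup hp
    (J.hi_pos.le.trans (le_max_right (max r η) J.hi)) (max_lt (max_lt hr.2 hη.2) J.hi_lt_one)
  rw [max_lt_iff, max_lt_iff] at hlt
  obtain ⟨⟨hrR, hηR⟩, hρR⟩ := hlt
  let J' : ClosedInterval K := ClosedInterval.disc hR hR1
  have hJ' : J'.carrier ⊆ Ico 0 1 := fun x hx => ⟨hx.1, hx.2.trans_lt hR1⟩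
  have h : J.carrier ⊆ J'.carrier := fun x hx => ⟨(hJ hx).1, hx.2.trans hρR.le⟩
  have hout : J'.outer.carrier ⊆ Ico r 1 := fun x hx => ⟨hrR.le.trans hx.1, hx.2.trans_lt hR1⟩
  have hout' : J'.outer.carrier ⊆ Ioo 0 1 := fun x hx => ⟨hr.1.trans_le (hout hx).1, (hout hx).2⟩
  have hlt : J.hi < J'.hi * η ^ d ^ 2 := by
    refine hρη.trans_le ?_
    rw [pow_succ, mul_comm]
    exact mul_le_mul_of_nonneg_right hηR.le (pow_nonneg hη.1.le _)
  have key (w : E.obj J' hJ') := exists_mem_null_sub_eq_t_smul hJ' h h0 hd0 hd hη.1 hlt w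
    (IsNullSeq.exists_norm_aeval_le (h0 := J'.zero_notMem_outer) rfl hη.1 hη.2.le
      (hnull J'.outer hout' hout (E.res hJ' J'.outer_subset w)))
  refine span_null_eq_top h0 fun m => ?_
  have hm : m ∈ Submodule.span (Fn J) (range (E.res hJ' h)) := by
    rw [span_range_res]; exact Submodule.mem_top
  induction hm using Submodule.span_induction with
  | mem x hx =>
    obtain ⟨w, rfl⟩ := hx
    obtain ⟨v, hv, y, hy⟩ := key w
    exact ⟨v, Submodule.subset_span hv, -y, by rw [smul_neg, ← hy]; abel⟩
  | zero => exact ⟨0, Submodule.zero_mem _, 0, by simp⟩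
  | add x y _ _ hx hy =>
    obtain ⟨u, hu, x', rfl⟩ := hx
    obtain ⟨v, hv, y', rfl⟩ := hy
    exact ⟨u + v, Submodule.add_mem _ hu hv, x' + y', by rw [smul_add]; abel⟩
  | smul f x _ hx =>
    obtain ⟨u, hu, x', rfl⟩ := hx
    exact ⟨f • u, Submodule.smul_mem _ _ hu, f • x', by rw [smul_add, smul_comm f]⟩

include hp in
/-- On an overconvergent log-`∇`-module on the open unit disc with nilpotent residue, the sections
killed by powers of `t d/dt` generate. -/
lemma isSpannedByNull_of_overconvergentLog (hE : overconvergentLog K E) : E.IsSpannedByNull := by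
  intro J hJ
  -- Every `A(J)` lies in the disc with the same outer radius, and generators restrict to
  -- generators.
  let J' : ClosedInterval K := ClosedInterval.disc J.hi_aligned J.hi_lt_one
  have hJ' : J'.carrier ⊆ Ico 0 1 := fun x hx => ⟨hx.1, hx.2.trans_lt J.hi_lt_one⟩
  have h : J.carrier ⊆ J'.carrier := fun x hx => ⟨(hJ hx).1, hx.2⟩
  have hspan := span_null_eq_top_of_overconvergentLog hp hE J' hJ' ⟨le_rfl, J.hi_pos.le⟩
  rw [eq_top_iff, ← span_range_res E hJ' h, Submodule.span_le]
  rintro _ ⟨m, rfl⟩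
  have hm : m ∈ Submodule.span (Fn J') (E.null J' hJ' : Set (E.obj J' hJ')) :=
    hspan ▸ Submodule.mem_top
  change _ ∈ Submodule.span _ _
  induction hm using Submodule.span_induction with
  | mem x hx => exact Submodule.subset_span (res_mem_null hJ' h hx)
  | zero => rw [map_zero]; exact Submodule.zero_mem _
  | add x y _ _ hx hy => rw [map_add]; exact Submodule.add_mem _ hx hy
  | smul f x _ hx => rw [res_smul]; exact Submodule.smul_mem _ _ hx

end LogNablaModule

end RigidAnnulus

end

/-! ### Germs near the outer boundary and assembly of the equivalences. -/

noncomputable section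

lemma CategoryTheory.ObjectProperty.isEquivalence_lift {A C : Type*} [Category* A] [Category* C]
    (P : ObjectProperty C) (F : A ⥤ C) [F.Full] [F.Faithful] (hF : ∀ X, P (F.obj X))
    (h : ∀ Y, P Y → ∃ X, Nonempty (F.obj X ≅ Y)) : (P.lift F hF).IsEquivalence where
  essSurj := ⟨fun Y => by
    obtain ⟨X, ⟨e⟩⟩ := h Y.obj Y.property
    exact ⟨X, ⟨P.isoMk e⟩⟩⟩

/-- The inverse of `e` followed by the lift of `F` is an equivalence, and `α` together with the
counit of `e` identifies it with `G`. This is how equivalences out of (a) become statements about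
restriction from (b). -/
lemma CategoryTheory.ObjectProperty.exists_equivalence_of_lift {A B C : Type*} [Category* A]
    [Category* B] [Category* C] (e : A ≌ B) (G : B ⥤ C) (P : ObjectProperty C) (F : A ⥤ C)
    (hF : ∀ X, P (F.obj X)) (hlift : (P.lift F hF).IsEquivalence) (α : F ≅ e.functor ⋙ G) :
    ∃ e' : B ≌ P.FullSubcategory, Nonempty (e'.functor ⋙ P.ι ≅ G) :=
  ⟨e.symm.trans (P.lift F hF).asEquivalence,
    ⟨Functor.isoWhiskerLeft e.inverse α ≪≫ Functor.isoWhiskerRight e.counitIso G⟩⟩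

namespace RigidAnnulus

variable {K : Type u} [NormedField K]

lemma ClosedInterval.carrier_circle {r : ℝ} (hr : r ∈ valueGroup K) (hr1 : r < 1) :
    (ClosedInterval.circle hr hr1).carrier = {r} := Icc_self r

lemma ClosedInterval.exists_carrier_subset_of_isOpen {p : ℕ} [Fact p.Prime]
    (hp : ‖(p : K)‖ = (p : ℝ)⁻¹) {I : Set ℝ} (hI : I ⊆ Ioo 0 1) (hne : I.Nonempty)
    (hopen : IsOpen I) : ∃ J : ClosedInterval K, J.carrier ⊆ I := by
  obtain ⟨x, hx⟩ := hne
  obtain ⟨l, u, hxu, hu⟩ := mem_nhds_iff_exists_Ioo_subset.1 (hopen.mem_nhds hx)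
  obtain ⟨r, hr, hxr, hru⟩ := exists_mem_valueGroup hp (hI hx).1.le hxu.2
  have hrI : r ∈ I := hu ⟨hxu.1.trans hxr, hru⟩
  exact ⟨.circle hr (hI hrI).2, by rwa [carrier_circle, singleton_subset_iff]⟩

variable [IsUltrametricDist K] [CompleteSpace K]

namespace NilpotentEnd

lemma eq_of_tensorMap_eq {X Y : NilpotentEnd K} {f g : X ⟶ Y} (J : ClosedInterval K)
    (h : tensorMap f J = tensorMap g J) : f = g :=
  Hom.ext (LinearMap.ext fun v => one_tmul_injective (J := J) Y
    (congrArg (fun φ => φ ((1 : Fn J) ⊗ₜ[K] v)) h))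

variable {p : ℕ} [Fact p.Prime] (hp : ‖(p : K)‖ = (p : ℝ)⁻¹) {r : ℝ}
  (hr : r ∈ valueGroup K ∩ Ioo 0 1)

-- Equal germs agree on some `A[s, 1)`, and a single circle of radius beyond `s` already determines
-- the map `V → W`.
include hp in
lemma toLogNabla_comp_ofLogNabla_faithful :
    (toLogNabla (Ico r 1) ⋙ GermModule.ofLogNabla r hr).Faithful where
  map_injective {X Y} f g hfg := by
    obtain ⟨s, hs1, hrs, -, h⟩ := Quotient.exact hfg
    have hrs' : r ≤ s := hrs
    obtain ⟨s', hs', hss', hs'1⟩ := exists_mem_valueGroup hp (hr.2.1.le.trans hrs') hs1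
    have hmem : s' ∈ Ico r 1 := ⟨hrs'.trans hss'.le, hs'1⟩
    refine eq_of_tensorMap_eq (.circle hs' hs'1) (h (.circle hs' hs'1) ?_ ?_ ?_)
    · rwa [ClosedInterval.carrier_circle, singleton_subset_iff]
    · rwa [ClosedInterval.carrier_circle, singleton_subset_iff]
    · rw [ClosedInterval.carrier_circle, singleton_subset_iff]
      exact ⟨hss'.le, hs'1⟩

/-- A germ of a morphism is defined on an honest annulus `A[s, 1)`, where fullness is known. -/
lemma toLogNabla_comp_ofLogNabla_full [CharZero K] :
    (toLogNabla (Ico r 1) ⋙ GermModule.ofLogNabla r hr).Full where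
  map_surjective {X Y} φ := by
    induction φ using Quotient.inductionOn with
    | h φ =>
      have hJ : (ClosedInterval.circle φ.s_mem.1 φ.s_mem.2.2).carrier ⊆ Ico φ.s 1 := by
        rw [ClosedInterval.carrier_circle, singleton_subset_iff]
        exact ⟨le_rfl, φ.s_mem.2.2⟩
      have := toLogNabla_full (K := K) ordConnected_Ico hJ
      obtain ⟨f, hf⟩ := (toLogNabla (K := K) (Ico φ.s 1)).map_surjective (X := X) (Y := Y) φ.hom
      refine ⟨f, Quotient.sound ⟨φ.s, φ.s_mem.2.2, φ.left, le_rfl, fun J _ hJ _ => ?_⟩⟩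
      exact congrArg (fun ψ => LogNablaModule.Hom.app ψ J hJ) hf

lemma unipotentGerm_toLogNabla (X : NilpotentEnd K) :
    unipotentGerm K ((toLogNabla (Ico r 1) ⋙ GermModule.ofLogNabla r hr).obj X) :=
  ⟨r, hr, le_rfl, (isUnipotent_toLogNabla X).restrict _⟩

include hp in
lemma exists_iso_germ_of_isUnipotent [CharZero K] {Y : GermModule K} (hY : Y.IsUnipotent) :
    ∃ X, Nonempty ((toLogNabla (Ico r 1) ⋙ GermModule.ofLogNabla r hr).obj X ≅ Y) := by
  obtain ⟨s, hs, hYs, hU⟩ := hY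
  -- Generation by null sections needs an open annulus, so the inner boundary is dropped. The
  -- isomorphism found on `A(s, 1)` is then restricted to `A[s', 1)` with `s' > max s r`, where both
  -- germs are defined.
  have hU' := hU.restrict (I' := Ioo s 1) Ioo_subset_Ico_self
  have hsub : Ioo s 1 ⊆ Ioo 0 1 := Ioo_subset_Ioo_left hs.2.1.le
  obtain ⟨J₀, hJ₀⟩ := ClosedInterval.exists_carrier_subset_of_isOpen hp hsub
    (nonempty_Ioo.2 hs.2.2) isOpen_Ioo
  obtain ⟨X, ⟨e⟩⟩ := LogNablaModule.exists_iso_toLogNabla ordConnected_Ioo hJ₀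
    (hU'.isSpannedByNull hp hsub ordConnected_Ioo isOpen_Ioo)
  obtain ⟨s', hs', hlt, hs'1⟩ := exists_mem_valueGroup hp (hs.2.1.le.trans (le_max_left s r))
    (max_lt hs.2.2 hr.2.2)
  rw [max_lt_iff] at hlt
  have hmem : s' ∈ valueGroup K ∩ Ioo 0 1 := ⟨hs', hs.2.1.trans hlt.1, hs'1⟩
  have hss' : Ico s' 1 ⊆ Ioo s 1 := Ico_subset_Ioo_left hlt.1
  let f : GermModule.PreHom ((toLogNabla (Ico r 1) ⋙ GermModule.ofLogNabla r hr).obj X) Y :=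
    ⟨s', hmem, hlt.2.le, hYs.trans hlt.1.le, (LogNablaModule.restrict hss').map e.hom⟩
  let g : GermModule.PreHom Y ((toLogNabla (Ico r 1) ⋙ GermModule.ofLogNabla r hr).obj X) :=
    ⟨s', hmem, hYs.trans hlt.1.le, hlt.2.le, (LogNablaModule.restrict hss').map e.inv⟩
  refine ⟨X, ⟨⟨Quotient.mk _ f, Quotient.mk _ g, ?_, ?_⟩⟩⟩
  · refine Quotient.sound ⟨s', hs'1, (max_self s').le, hlt.2.le, fun J _ _ hJ => ?_⟩
    exact congrArg (fun ψ => LogNablaModule.Hom.app ψ J (hJ.trans hss')) e.hom_inv_id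
  · refine Quotient.sound ⟨s', hs'1, (max_self s').le, hYs.trans hlt.1.le, fun J _ _ hJ => ?_⟩
    exact congrArg (fun ψ => LogNablaModule.Hom.app ψ J (hJ.trans hss')) e.inv_hom_id

end NilpotentEnd

end RigidAnnulus

end

/-- The categories of (a) finite dimensional `K`-vector spaces with a nilpotent endomorphism,
(b) log-`∇`-modules on `A[0, 1)` with nilpotent residue whose restrictions to `A(0, 1)` are
overconvergent, and (c) unipotent `∇`-modules on `A(I)`, for `I` a nonempty open
subinterval of `(0, 1)`, are equivalent, via `V ↦ O ⊗ V` from (a) to (b), and restriction from (b)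
to (c). The same holds with (c) replaced by the category of unipotent `∇`-modules on annuli
`A[r, 1)` up to shrinking, i.e. by unipotent objects of the direct limit category. -/
theorem propositionP {K : Type u} [NormedField K] [IsUltrametricDist K] [CompleteSpace K]
    [CharZero K] (p : ℕ) [Fact p.Prime] (hp : ‖(p : K)‖ = (p : ℝ)⁻¹) :
    (∃ e : RigidAnnulus.NilpotentEnd K ≌ RigidAnnulus.OverconvergentLogModule K,
      Nonempty (e.functor ⋙ (RigidAnnulus.overconvergentLog K).ι ≅
        RigidAnnulus.NilpotentEnd.toLogNabla (Ico 0 1))) ∧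
    (∀ (I : Set ℝ) (hI : I ⊆ Ioo 0 1), I.OrdConnected → I.Nonempty → IsOpen I →
      ∃ e : RigidAnnulus.OverconvergentLogModule K ≌ RigidAnnulus.UnipotentModule K I,
        Nonempty (e.functor ⋙ (RigidAnnulus.unipotent K I).ι ≅
          (RigidAnnulus.overconvergentLog K).ι ⋙
          RigidAnnulus.LogNablaModule.restrict (hI.trans Ioo_subset_Ico_self))) ∧
    (∀ (r : ℝ) (hr : r ∈ RigidAnnulus.valueGroup K ∩ Ioo 0 1),
      ∃ e : RigidAnnulus.OverconvergentLogModule K ≌ RigidAnnulus.UnipotentGerm K,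
        Nonempty (e.functor ⋙ (RigidAnnulus.unipotentGerm K).ι ≅
          (RigidAnnulus.overconvergentLog K).ι ⋙
          RigidAnnulus.LogNablaModule.restrict (Ico_subset_Ico_left hr.2.1.le) ⋙
          RigidAnnulus.GermModule.ofLogNabla r hr)) := by
  have h01 : (Ioo (0 : ℝ) 1).Nonempty := nonempty_Ioo.2 zero_lt_one
  obtain ⟨J₀, hJ₀⟩ := RigidAnnulus.ClosedInterval.exists_carrier_subset_of_isOpen (K := K) hp
    Subset.rfl h01 isOpen_Ioo
  have hJ₁ := hJ₀.trans (Ioo_subset_Ico_self (a := (0 : ℝ)) (b := 1))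
  have := RigidAnnulus.NilpotentEnd.toLogNabla_faithful (K := K) hJ₁
  have := RigidAnnulus.NilpotentEnd.toLogNabla_full (K := K) ordConnected_Ico hJ₁
  have hab := (RigidAnnulus.overconvergentLog K).isEquivalence_lift
    (RigidAnnulus.NilpotentEnd.toLogNabla (Ico 0 1))
    (RigidAnnulus.NilpotentEnd.overconvergentLog_toLogNabla hp) fun E hE =>
      RigidAnnulus.LogNablaModule.exists_iso_toLogNabla ordConnected_Ico hJ₁
        (RigidAnnulus.LogNablaModule.isSpannedByNull_of_overconvergentLog hp hE)
  let e := ((RigidAnnulus.overconvergentLog K).lift (RigidAnnulus.NilpotentEnd.toLogNabla (Ico 0 1))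
    (RigidAnnulus.NilpotentEnd.overconvergentLog_toLogNabla hp)).asEquivalence
  -- The comparison isomorphisms are identities, because restricting `O ⊗ V` yields `O ⊗ V` by
  -- definition.
  refine ⟨⟨e, ⟨Iso.refl _⟩⟩, fun I hI hconn hne hopen => ?_, fun r hr => ?_⟩
  · obtain ⟨J, hJ⟩ := RigidAnnulus.ClosedInterval.exists_carrier_subset_of_isOpen (K := K) hp hI
      hne hopen
    have := RigidAnnulus.NilpotentEnd.toLogNabla_faithful (K := K) hJ
    have := RigidAnnulus.NilpotentEnd.toLogNabla_full (K := K) hconn hJ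
    exact ObjectProperty.exists_equivalence_of_lift e _ (RigidAnnulus.unipotent K I)
      (RigidAnnulus.NilpotentEnd.toLogNabla I) RigidAnnulus.NilpotentEnd.isUnipotent_toLogNabla
      (ObjectProperty.isEquivalence_lift _ _ _ fun E hE =>
        RigidAnnulus.LogNablaModule.exists_iso_toLogNabla hconn hJ
          (RigidAnnulus.LogNablaModule.IsUnipotent.isSpannedByNull hp hI hconn hopen hE))
      (Iso.refl _)
  · have := RigidAnnulus.NilpotentEnd.toLogNabla_comp_ofLogNabla_faithful hp hr
    have := RigidAnnulus.NilpotentEnd.toLogNabla_comp_ofLogNabla_full hr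
    exact ObjectProperty.exists_equivalence_of_lift e _ (RigidAnnulus.unipotentGerm K)
      (RigidAnnulus.NilpotentEnd.toLogNabla (Ico r 1) ⋙ RigidAnnulus.GermModule.ofLogNabla r hr)
      (RigidAnnulus.NilpotentEnd.unipotentGerm_toLogNabla hr)
      (ObjectProperty.isEquivalence_lift _ _ _ fun _ hY =>
        RigidAnnulus.NilpotentEnd.exists_iso_germ_of_isUnipotent hp hr hY)
      (Iso.refl _)
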